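/- Let $(M,\tau)$ be a $C_2$-manifold: a paracompact Hausdorff smooth finite-dimensional manifold $M$ without boundary together with a smooth map $\tau\colon M\to M$ such that $\tau\circ\tau=\mathrm{id}$. **Real Deligne cohomology.** For $p\ge 0$ let $\mathbb Z_{\mathcal D,\mathcal R}(p)$ be the complex of sheaves on $M$ $$ i\mathbb Z\longrightarrow i\mathcal A^0\xrightarrow{\ d\ } i\mathcal A^1\xrightarrow{\ d\ }\cdots\xrightarrow{\ d\ } i\mathcal A^{p-1}\longrightarrow 0,$$ with the locally constant sheaf $i\mathbb Z$ in degree $0$ and $i\mathcal A^k$ the sheaf of smooth imaginary-valued $k$-forms, on which $C_2$ acts by $\omega\mapsto\overline{\tau^*\omega}$. For an open cover $\mathcal U=\{U_i\}_{i\in I}$ with a free involution $\tau$ of the index set $I$ such that $U_{\tau(i)}=\tau(U_i)$, let $T^*(\mathcal U)$ be the total complex of the double complex of those Čech cochains $c$ of $\mathcal U$ with values in $\mathbb Z_{\mathcal D,\mathcal R}(p)$ that satisfy $\overline{\tau^*c_{\tau(i_0),\dots,\tau(i_q)}}=c_{i_0,\dots,i_q}$. Put $H^n_{\mathcal D,\mathcal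 R}(M;\mathbb Z(p))=\operatorname{colim}_{\mathcal U}H^n(T^*(\mathcal U))$, the colimit over all such covers and their equivariant refinement maps. **Real line bundles.** A Real (Hermitian) line bundle over $(M,\tau)$ is a smooth complex line bundle $L\to M$ with a smooth Hermitian metric $h$ and a smooth involution $\sigma\colon L\to L$ covering $\tau$ which is antilinear on the fibres and satisfies $h(\sigma u,\sigma w)=\overline{h(u,w)}$ (equivalently, a Real principal $U(1)$-bundle). A Real connection on $L$ is a connection $\nabla$ on $L$ which is compatible with $h$ and satisfies $\nabla\circ\sigma_0=\sigma_1\circ\nabla$, where $\sigma_0(s)=\sigma\circ s\circ\tau$ on sections and $\sigma_1(s\otimes\omega)=\sigma_0(s)\otimes\overline{\tau^*\omega}$ on $L$-valued $1$-forms. It is flat if its curvature vanishes. Isomorphisms are fibrewise linear isometric diffeomorphisms over $\mathrm{id}_M$ that commute with the involutions and preserve the connections. **Statement.** The tensor product of line bundles with metric, Real structure and connection makes the set of isomorphism classes of Real line bundles over $(M,\tau)$ with flat Real connection an abelian group, and for every integer $p>2$ this group is isomorphic to $H^2_{\mathcal D,\mathcal R}(M;\mathbb Z(p))$. -/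

import Mathlib

open scoped Manifold ContDiff Topology

noncomputable section

namespace RealDeligne

universe v u

section Forms

variable {E : Type v} [NormedAddCommGroup E] [NormedSpace ℝ E]
  {M : Type u} [TopologicalSpace M] [ChartedSpace E M]

/-- Complex-valued alternating `k`-forms on the tangent space `T_x M`. -/
abbrev FormAt (E : Type v) [NormedAddCommGroup E] [NormedSpace ℝ E]
    {M : Type u} [TopologicalSpace M] [ChartedSpace E M] (k : ℕ) (x : M) : Type v :=
  TangentSpace 𝓘(ℝ, E) x [⋀^Fin k]→L[ℝ] ℂ

instance formAtAddCommGroup (k : ℕ) (x : M) : AddCommGroup (FormAt E k x) := inferInstance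

/-- Pullback of a form at the point `f x` to a form at `x` along the differential of `f`. -/
def pullAt {k : ℕ} (f : M → M) (x : M) : FormAt E k (f x) →+ FormAt E k x where
  toFun η := η.compContinuousLinearMap (mfderiv 𝓘(ℝ, E) 𝓘(ℝ, E) f x)
  map_zero' := rfl
  map_add' _ _ := rfl

/-- Complex conjugation of the values of a form. -/
def conjForm {k : ℕ} {x : M} : FormAt E k x →+ FormAt E k x where
  toFun η := (Complex.conjCLE : ℂ →L[ℝ] ℂ).compContinuousAlternatingMap η
  map_zero' := by ext; simp
  map_add' _ _ := by ext; simp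

/-- The expression of a family of forms `α` in the preferred chart at `x₀`: its pullback to the
model space along the inverse of the chart (meaningful on the target of the chart). -/
def chartRep {k : ℕ} (x₀ : M) (α : ∀ x : M, FormAt E k x) (y : E) : E [⋀^Fin k]→L[ℝ] ℂ :=
  (α ((chartAt E x₀).symm y)).compContinuousLinearMap
    (mfderiv 𝓘(ℝ, E) 𝓘(ℝ, E) (chartAt E x₀).symm y)

/-- `α` is a smooth differential form on the open set `W`: its expressions in the charts are
smooth. -/
def SmoothFormOn {k : ℕ} (α : ∀ x : M, FormAt E k x) (W : Set M) : Prop :=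
  ∀ x₀ : M, ContDiffOn ℝ ∞ (chartRep x₀ α) ((chartAt E x₀).target ∩ (chartAt E x₀).symm ⁻¹' W)

/-- The exterior derivative at `x`, computed in the preferred chart at `x` and pulled back.
`extDeriv_chartRep` shows that every other chart around `x` gives the same result. -/
def extD {k : ℕ} (α : ∀ x : M, FormAt E k x) (x : M) : FormAt E (k + 1) x :=
  (extDeriv (chartRep x α) (chartAt E x x)).compContinuousLinearMap
    (mfderiv 𝓘(ℝ, E) 𝓘(ℝ, E) (chartAt E x) x)

lemma chartRep_add {k : ℕ} (x₀ : M) (α η : ∀ x : M, FormAt E k x) :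
    chartRep x₀ (α + η) = chartRep x₀ α + chartRep x₀ η := rfl

lemma chartRep_neg {k : ℕ} (x₀ : M) (α : ∀ x : M, FormAt E k x) :
    chartRep x₀ (-α) = -chartRep x₀ α := rfl

lemma chartRep_zero {k : ℕ} (x₀ : M) :
    chartRep x₀ (0 : ∀ x : M, FormAt E k x) = 0 := rfl

lemma chartRep_congr {k : ℕ} {x₀ x : M} (hx : x ∈ (chartAt E x₀).source)
    {α η : ∀ x : M, FormAt E k x}
    (h : ∀ᶠ y in 𝓝 x, α y = η y) :
    chartRep x₀ α =ᶠ[𝓝 (chartAt E x₀ x)] chartRep x₀ η := by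
  have hc : Filter.Tendsto (chartAt E x₀).symm (𝓝 (chartAt E x₀ x)) (𝓝 x) := by
    have := (chartAt E x₀).symm.continuousAt ((chartAt E x₀).map_source hx)
    rwa [ContinuousAt, (chartAt E x₀).left_inv hx] at this
  filter_upwards [hc.eventually h] with y hy
  simp only [chartRep, hy]

lemma extD_congr {k : ℕ} {x : M} {α η : ∀ x : M, FormAt E k x}
    (h : ∀ᶠ y in 𝓝 x, α y = η y) : extD α x = extD η x := by
  simp only [extD, (chartRep_congr (mem_chart_source E x) h).extDeriv_eq]

lemma SmoothFormOn.contDiffAt {k : ℕ} {α : ∀ x : M, FormAt E k x} {W : Set M}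
    (hW : IsOpen W) (h : SmoothFormOn α W) {x₀ x : M} (hx : x ∈ (chartAt E x₀).source)
    (hxW : x ∈ W) : ContDiffAt ℝ ∞ (chartRep x₀ α) (chartAt E x₀ x) := by
  refine (h x₀).contDiffAt (((chartAt E x₀).isOpen_inter_preimage_symm hW).mem_nhds ?_)
  exact ⟨(chartAt E x₀).map_source hx, by simpa [(chartAt E x₀).left_inv hx] using hxW⟩

lemma chartRep_pull [IsManifold 𝓘(ℝ, E) ∞ M] {k : ℕ} {f : M → M}
    (hf : ContMDiff 𝓘(ℝ, E) 𝓘(ℝ, E) ∞ f) (α : ∀ x : M, FormAt E k x) {x₀ x₁ x : M}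
    (hx : x ∈ (chartAt E x₀).source) (hfx : f x ∈ (chartAt E x₁).source) :
    (fun y => chartRep x₀ (fun z => pullAt f z (α (f z))) y) =ᶠ[𝓝 (chartAt E x₀ x)]
      fun y => (chartRep x₁ α ((chartAt E x₁ ∘ f ∘ (chartAt E x₀).symm) y)).compContinuousLinearMap
        (fderiv ℝ (chartAt E x₁ ∘ f ∘ (chartAt E x₀).symm) y) := by
  have hmem : ∀ᶠ y in 𝓝 (chartAt E x₀ x), y ∈ (chartAt E x₀).target ∧
      f ((chartAt E x₀).symm y) ∈ (chartAt E x₁).source := by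
    have h1 : ∀ᶠ y in 𝓝 (chartAt E x₀ x), y ∈ (chartAt E x₀).target :=
      (chartAt E x₀).open_target.mem_nhds ((chartAt E x₀).map_source hx)
    have hc : ContinuousAt (fun y => f ((chartAt E x₀).symm y)) (chartAt E x₀ x) := by
      refine ContinuousAt.comp (g := f) hf.continuous.continuousAt ?_
      exact (chartAt E x₀).symm.continuousAt ((chartAt E x₀).map_source hx)
    refine h1.and (hc.eventually ((chartAt E x₁).open_source.mem_nhds ?_))
    simpa [(chartAt E x₀).left_inv hx] using hfx
  filter_upwards [hmem, hmem.eventually_nhds] with y hy hy'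
  have hw : (chartAt E x₁).symm (chartAt E x₁ (f ((chartAt E x₀).symm y))) =
      f ((chartAt E x₀).symm y) := (chartAt E x₁).left_inv hy.2
  have hd0 : MDifferentiableAt 𝓘(ℝ, E) 𝓘(ℝ, E) (chartAt E x₀).symm y :=
    mdifferentiableAt_atlas_symm (chart_mem_atlas E x₀) hy.1
  have hd1 : MDifferentiableAt 𝓘(ℝ, E) 𝓘(ℝ, E) (chartAt E x₁) (f ((chartAt E x₀).symm y)) :=
    mdifferentiableAt_atlas (chart_mem_atlas E x₁) hy.2
  have hdf : MDifferentiableAt 𝓘(ℝ, E) 𝓘(ℝ, E) f ((chartAt E x₀).symm y) :=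
    (hf.mdifferentiable (by simp)) _
  have hdh : MDifferentiableAt 𝓘(ℝ, E) 𝓘(ℝ, E) (chartAt E x₁ ∘ f ∘ (chartAt E x₀).symm) y :=
    hd1.comp y (hdf.comp y hd0)
  have hd1' : MDifferentiableAt 𝓘(ℝ, E) 𝓘(ℝ, E) (chartAt E x₁).symm
      ((chartAt E x₁ ∘ f ∘ (chartAt E x₀).symm) y) :=
    mdifferentiableAt_atlas_symm (chart_mem_atlas E x₁) ((chartAt E x₁).map_source hy.2)
  have key : mfderiv 𝓘(ℝ, E) 𝓘(ℝ, E) (f ∘ (chartAt E x₀).symm) y =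
      mfderiv 𝓘(ℝ, E) 𝓘(ℝ, E)
        ((chartAt E x₁).symm ∘ (chartAt E x₁ ∘ f ∘ (chartAt E x₀).symm)) y := by
    refine Filter.EventuallyEq.mfderiv_eq ?_
    filter_upwards [hy'] with z hz
    exact ((chartAt E x₁).left_inv hz.2).symm
  rw [mfderiv_comp y hdf hd0, mfderiv_comp y hd1' hdh, mfderiv_eq_fderiv] at key
  let αE : M → E [⋀^Fin k]→L[ℝ] ℂ := α
  have hα : αE ((chartAt E x₁).symm (chartAt E x₁ (f ((chartAt E x₀).symm y)))) =
    αE (f ((chartAt E x₀).symm y)) := congrArg αE hw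
  have key' : ∀ v : E, (mfderiv 𝓘(ℝ, E) 𝓘(ℝ, E) f ((chartAt E x₀).symm y) :)
      ((mfderiv 𝓘(ℝ, E) 𝓘(ℝ, E) (chartAt E x₀).symm y :) v) =
      (mfderiv 𝓘(ℝ, E) 𝓘(ℝ, E) (chartAt E x₁).symm
        ((chartAt E x₁ ∘ f ∘ (chartAt E x₀).symm) y) :)
        (fderiv ℝ (chartAt E x₁ ∘ f ∘ (chartAt E x₀).symm) y v) :=
    fun v => congrArg (fun L : E →L[ℝ] E => L v) key
  ext v
  change αE (f ((chartAt E x₀).symm y)) (fun i => _) =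
    αE ((chartAt E x₁).symm (chartAt E x₁ (f ((chartAt E x₀).symm y)))) (fun i => _)
  rw [hα]
  exact congrArg _ (funext fun i => key' (v i))

lemma contDiffAt_transition [IsManifold 𝓘(ℝ, E) ∞ M] {f : M → M}
    (hf : ContMDiff 𝓘(ℝ, E) 𝓘(ℝ, E) ∞ f) {x₀ x₁ x : M}
    (hx : x ∈ (chartAt E x₀).source) (hfx : f x ∈ (chartAt E x₁).source) :
    ContDiffAt ℝ ∞ (chartAt E x₁ ∘ f ∘ (chartAt E x₀).symm) (chartAt E x₀ x) := by
  rw [← contMDiffAt_iff_contDiffAt]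
  have hl := (chartAt E x₀).left_inv hx
  have h1 : ContMDiffAt 𝓘(ℝ, E) 𝓘(ℝ, E) ∞ (chartAt E x₁) (f x) :=
    contMDiffOn_chart.contMDiffAt ((chartAt E x₁).open_source.mem_nhds hfx)
  have h0 : ContMDiffAt 𝓘(ℝ, E) 𝓘(ℝ, E) ∞ (chartAt E x₀).symm (chartAt E x₀ x) :=
    contMDiffOn_chart_symm.contMDiffAt
      ((chartAt E x₀).open_target.mem_nhds ((chartAt E x₀).map_source hx))
  refine ContMDiffAt.comp _ (by simpa [hl] using h1) (ContMDiffAt.comp _ (hf _) h0)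

lemma mfderiv_chart_comp_symm [IsManifold 𝓘(ℝ, E) ∞ M] (x : M) (v : E) :
    (mfderiv 𝓘(ℝ, E) 𝓘(ℝ, E) (chartAt E x) x : E →L[ℝ] E)
      ((mfderiv 𝓘(ℝ, E) 𝓘(ℝ, E) (chartAt E x).symm (chartAt E x x) : E →L[ℝ] E) v) = v := by
  have hmd := mdifferentiable_of_mem_atlas (I := 𝓘(ℝ, E)) (chart_mem_atlas E x)
  have := hmd.comp_symm_deriv (x := chartAt E x x) (mem_chart_target E x)
  rw [(chartAt E x).left_inv (mem_chart_source E x)] at this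
  exact congrArg (fun L : E →L[ℝ] E => L v) this

lemma mfderiv_symm_comp_chart [IsManifold 𝓘(ℝ, E) ∞ M] (x : M) (v : E) :
    (mfderiv 𝓘(ℝ, E) 𝓘(ℝ, E) (chartAt E x).symm (chartAt E x x) : E →L[ℝ] E)
      ((mfderiv 𝓘(ℝ, E) 𝓘(ℝ, E) (chartAt E x) x : E →L[ℝ] E) v) = v := by
  have hmd := mdifferentiable_of_mem_atlas (I := 𝓘(ℝ, E)) (chart_mem_atlas E x)
  exact congrArg (fun L : E →L[ℝ] E => L v) (hmd.symm_comp_deriv (mem_chart_source E x))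

lemma chartRep_extD_self [IsManifold 𝓘(ℝ, E) ∞ M] {k : ℕ} (α : ∀ x : M, FormAt E k x) (x : M) :
    chartRep x (extD α) (chartAt E x x) = extDeriv (chartRep x α) (chartAt E x x) := by
  let A : M → E [⋀^Fin (k + 1)]→L[ℝ] ℂ := extD α
  have hA : A ((chartAt E x).symm (chartAt E x x)) = A x :=
    congrArg A ((chartAt E x).left_inv (mem_chart_source E x))
  ext v
  change A ((chartAt E x).symm (chartAt E x x)) (fun i => _) = _
  rw [hA]
  change extDeriv (chartRep x α) (chartAt E x x) (fun i => _) = _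
  exact congrArg _ (funext fun i => mfderiv_chart_comp_symm x (v i))

/-- Naturality of the exterior derivative with respect to smooth self-maps. -/
lemma extDeriv_chartRep_pull [IsManifold 𝓘(ℝ, E) ∞ M] {k : ℕ} {f : M → M}
    (hf : ContMDiff 𝓘(ℝ, E) 𝓘(ℝ, E) ∞ f) (α : ∀ x : M, FormAt E k x) {x₀ x : M}
    (hx : x ∈ (chartAt E x₀).source)
    (hα : ContDiffAt ℝ ∞ (chartRep (f x) α) (chartAt E (f x) (f x))) :
    extDeriv (chartRep x₀ (fun z => pullAt f z (α (f z)))) (chartAt E x₀ x) =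
      chartRep x₀ (fun z => pullAt f z (extD α (f z))) (chartAt E x₀ x) := by
  have hfx := mem_chart_source E (f x)
  have hl := (chartAt E x₀).left_inv hx
  rw [(chartRep_pull hf α hx hfx).extDeriv_eq,
    extDeriv_pullback (r := ∞) (by simpa [hl] using hα.differentiableAt (by simp))
    (contDiffAt_transition hf hx hfx) (by simp [ENat.LEInfty.out])]
  rw [(chartRep_pull hf (extD α) hx hfx).eq_of_nhds]
  simp only [Function.comp_apply, hl]
  rw [chartRep_extD_self]

lemma pullAt_id {k : ℕ} {x : M} (η : FormAt E k x) : pullAt (fun z => z) x η = η := by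
  ext v
  have h : mfderiv 𝓘(ℝ, E) 𝓘(ℝ, E) (fun z : M => z) x = ContinuousLinearMap.id ℝ _ :=
    mfderiv_id
  simp [pullAt, h]

lemma extDeriv_chartRep [IsManifold 𝓘(ℝ, E) ∞ M] {k : ℕ} (α : ∀ x : M, FormAt E k x) {x₀ x : M}
    (hx : x ∈ (chartAt E x₀).source)
    (hα : ContDiffAt ℝ ∞ (chartRep x α) (chartAt E x x)) :
    extDeriv (chartRep x₀ α) (chartAt E x₀ x) = chartRep x₀ (extD α) (chartAt E x₀ x) := by
  have h := extDeriv_chartRep_pull (f := fun z => z) contMDiff_id α hx hα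
  simpa only [pullAt_id] using h

lemma SmoothFormOn.extD [IsManifold 𝓘(ℝ, E) ∞ M] {k : ℕ} {α : ∀ x : M, FormAt E k x}
    {W : Set M} (hW : IsOpen W) (h : SmoothFormOn α W) : SmoothFormOn (extD α) W := by
  intro x₀
  have ho := (chartAt E x₀).isOpen_inter_preimage_symm hW
  have h1 : ContDiffOn ℝ ∞ (extDeriv (chartRep x₀ α))
      ((chartAt E x₀).target ∩ (chartAt E x₀).symm ⁻¹' W) := by
    have h2 := (h x₀).fderiv_of_isOpen ho (m := ∞) (by simp)
    exact (ContinuousAlternatingMap.alternatizeUncurryFinCLM ℝ E ℂ).contDiff.comp_contDiffOn h2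
  refine h1.congr fun y hy => ?_
  have hs := (chartAt E x₀).map_target hy.1
  have := extDeriv_chartRep α hs (h.contDiffAt hW (mem_chart_source E _) hy.2)
  rw [(chartAt E x₀).right_inv hy.1] at this
  exact this.symm

lemma extD_pullAt [IsManifold 𝓘(ℝ, E) ∞ M] {k : ℕ} {f : M → M}
    (hf : ContMDiff 𝓘(ℝ, E) 𝓘(ℝ, E) ∞ f) (α : ∀ x : M, FormAt E k x) {x : M}
    (hα : ContDiffAt ℝ ∞ (chartRep (f x) α) (chartAt E (f x) (f x))) :
    extD (fun z => pullAt f z (α (f z))) x = pullAt f x (extD α (f x)) := by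
  have h := extDeriv_chartRep_pull hf α (mem_chart_source E x) hα
  let A : M → E [⋀^Fin (k + 1)]→L[ℝ] ℂ := fun z => pullAt f z (extD α (f z))
  have hA : A ((chartAt E x).symm (chartAt E x x)) = A x :=
    congrArg A ((chartAt E x).left_inv (mem_chart_source E x))
  change (extDeriv (chartRep x _) (chartAt E x x)).compContinuousLinearMap _ = A x
  rw [h]
  refine ContinuousAlternatingMap.ext fun v => ?_
  change A ((chartAt E x).symm (chartAt E x x)) (fun i => _) = A x v
  rw [hA]
  exact congrArg (A x) (funext fun i => mfderiv_symm_comp_chart x (v i))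

lemma extDeriv_conj {k : ℕ} {F : E → E [⋀^Fin k]→L[ℝ] ℂ} {y : E} (hF : DifferentiableAt ℝ F y) :
    extDeriv (fun z => (Complex.conjCLE : ℂ →L[ℝ] ℂ).compContinuousAlternatingMap (F z)) y =
      (Complex.conjCLE : ℂ →L[ℝ] ℂ).compContinuousAlternatingMap (extDeriv F y) := by
  have h : HasFDerivAt
      (fun z => (Complex.conjCLE : ℂ →L[ℝ] ℂ).compContinuousAlternatingMap (F z))
      ((ContinuousLinearMap.compContinuousAlternatingMapCLM (𝕜 := ℝ) (E := E) (ι := Fin k) ℂ ℂ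
        (Complex.conjCLE : ℂ →L[ℝ] ℂ)).comp (fderiv ℝ F y)) y :=
    (ContinuousLinearMap.compContinuousAlternatingMapCLM (𝕜 := ℝ) (E := E) (ι := Fin k) ℂ ℂ
        (Complex.conjCLE : ℂ →L[ℝ] ℂ)).hasFDerivAt.comp y hF.hasFDerivAt
  ext v
  simp [extDeriv, h.fderiv, ContinuousAlternatingMap.alternatizeUncurryFin_apply]

lemma extD_conjForm {k : ℕ} (α : ∀ x : M, FormAt E k x) {x : M}
    (hα : ContDiffAt ℝ ∞ (chartRep x α) (chartAt E x x)) :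
    extD (fun z => conjForm (α z)) x = conjForm (extD α x) := by
  have h : extDeriv (chartRep x (fun z => conjForm (α z))) (chartAt E x x) =
      (Complex.conjCLE : ℂ →L[ℝ] ℂ).compContinuousAlternatingMap
        (extDeriv (chartRep x α) (chartAt E x x)) :=
    extDeriv_conj (hα.differentiableAt (by simp))
  change (extDeriv (chartRep x _) (chartAt E x x)).compContinuousLinearMap _ = _
  rw [h]
  rfl

lemma extD_add {k : ℕ} (α β : ∀ x : M, FormAt E k x) {x : M}
    (hα : ContDiffAt ℝ ∞ (chartRep x α) (chartAt E x x))
    (hβ : ContDiffAt ℝ ∞ (chartRep x β) (chartAt E x x)) :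
    extD (α + β) x = extD α x + extD β x := by
  have h : extDeriv (chartRep x (α + β)) (chartAt E x x) = _ :=
    extDeriv_add (hα.differentiableAt (by simp)) (hβ.differentiableAt (by simp))
  change (extDeriv (chartRep x _) (chartAt E x x)).compContinuousLinearMap _ = _
  rw [h]
  rfl

lemma extD_zero {k : ℕ} (x : M) : extD (0 : ∀ x : M, FormAt E k x) x = 0 := by
  have h : extDeriv (chartRep x (0 : ∀ x : M, FormAt E k x)) (chartAt E x x) = 0 := by
    rw [chartRep_zero]
    ext v
    simp [extDeriv, ContinuousAlternatingMap.alternatizeUncurryFin_apply]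
  change (extDeriv (chartRep x _) (chartAt E x x)).compContinuousLinearMap _ = _
  rw [h]
  rfl

lemma extD_neg {k : ℕ} (α : ∀ x : M, FormAt E k x) {x : M}
    (hα : ContDiffAt ℝ ∞ (chartRep x α) (chartAt E x x)) :
    extD (-α) x = -extD α x := by
  have h := extD_add α (-α) hα (by rw [chartRep_neg]; exact hα.neg)
  rw [add_neg_cancel, extD_zero] at h
  exact (neg_eq_of_add_eq_zero_right h.symm).symm

lemma SmoothFormOn.congr {k : ℕ} {α β : ∀ x : M, FormAt E k x} {W : Set M}
    (h : SmoothFormOn α W) (hab : ∀ x ∈ W, β x = α x) : SmoothFormOn β W := by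
  intro x₀
  refine (h x₀).congr fun y hy => ?_
  simp only [chartRep, hab _ hy.2]

lemma SmoothFormOn.mono {k : ℕ} {α : ∀ x : M, FormAt E k x} {W V : Set M}
    (h : SmoothFormOn α W) (hV : V ⊆ W) : SmoothFormOn α V := fun x₀ =>
  (h x₀).mono (Set.inter_subset_inter_right _ (Set.preimage_mono hV))

end Forms
/-- A smooth involution of the manifold `M`, i.e. the structure of a `C₂`-manifold. -/
structure SmoothInvolution (E : Type v) [NormedAddCommGroup E] [NormedSpace ℝ E]
    (M : Type u) [TopologicalSpace M] [ChartedSpace E M] where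
  toFun : M → M
  contMDiff : ContMDiff 𝓘(ℝ, E) 𝓘(ℝ, E) ∞ toFun
  involutive : Function.Involutive toFun

instance {E : Type v} [NormedAddCommGroup E] [NormedSpace ℝ E]
    {M : Type u} [TopologicalSpace M] [ChartedSpace E M] :
    CoeFun (SmoothInvolution E M) (fun _ => M → M) := ⟨SmoothInvolution.toFun⟩

section Sections

variable {E : Type v} [NormedAddCommGroup E] [NormedSpace ℝ E]
  {M : Type u} [TopologicalSpace M] [ChartedSpace E M]

open TopologicalSpace (Opens)

instance sectionAddCommGroup (k : ℕ) (W : Opens M) :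
    AddCommGroup (∀ x : W, FormAt E k (x : M)) := Pi.addCommGroup

open Classical in
/-- Extension by zero of a section over `W`; it is only used to speak about smoothness and
exterior derivatives at points of `W`, where it does not matter. -/
def zeroExt {k : ℕ} (W : Opens M) (α : ∀ x : W, FormAt E k (x : M)) (x : M) : FormAt E k x :=
  if h : x ∈ W then α ⟨x, h⟩ else 0

/-- The exterior derivative of a form on the open set `W`. -/
def secD {k : ℕ} (W : Opens M) (α : ∀ x : W, FormAt E k (x : M)) (x : W) :
    FormAt E (k + 1) (x : M) :=
  extD (zeroExt W α) x

lemma zeroExt_of_mem {k : ℕ} {W : Opens M} (α : ∀ x : W, FormAt E k (x : M)) {x : M}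
    (h : x ∈ W) : zeroExt W α x = α ⟨x, h⟩ := dif_pos h

lemma zeroExt_add {k : ℕ} (W : Opens M) (α β : ∀ x : W, FormAt E k (x : M)) :
    zeroExt W (α + β) = zeroExt W α + zeroExt W β := by
  funext x
  by_cases h : x ∈ W <;> simp [zeroExt, h]

lemma zeroExt_neg {k : ℕ} (W : Opens M) (α : ∀ x : W, FormAt E k (x : M)) :
    zeroExt W (-α) = -zeroExt W α := by
  funext x
  by_cases h : x ∈ W <;> simp [zeroExt, h]

lemma zeroExt_zero {k : ℕ} (W : Opens M) :
    zeroExt W (0 : ∀ x : W, FormAt E k (x : M)) = 0 := by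
  funext x
  by_cases h : x ∈ W <;> simp [zeroExt, h]

/-- Smooth `k`-forms on `W` with purely imaginary values. -/
def imagForms (k : ℕ) (W : Opens M) : AddSubgroup (∀ x : W, FormAt E k (x : M)) where
  carrier := {α | SmoothFormOn (zeroExt W α) W ∧ ∀ x, ∀ w, (α x w).re = 0}
  zero_mem' := by
    refine ⟨fun x₀ => ?_, fun x w => by simp⟩
    rw [zeroExt_zero, chartRep_zero]
    exact contDiffOn_const
  add_mem' := by
    rintro α β ⟨ha, ha'⟩ ⟨hb, hb'⟩
    refine ⟨fun x₀ => ?_, fun x w => by simp [ha', hb']⟩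
    rw [zeroExt_add, chartRep_add]
    exact (ha x₀).add (hb x₀)
  neg_mem' := by
    rintro α ⟨ha, ha'⟩
    refine ⟨fun x₀ => ?_, fun x w => by simp [ha']⟩
    rw [zeroExt_neg, chartRep_neg]
    exact (ha x₀).neg

/-- The sheaf of locally constant functions with values in `iℤ`, written as `0`-forms
(a `0`-form at `x` is determined by its value at the empty tuple of vectors). -/
def imagInts (W : Opens M) : AddSubgroup (∀ x : W, FormAt E 0 (x : M)) where
  carrier := {α | IsLocallyConstant (fun x : W => α x ![]) ∧
    ∀ x : W, ∃ n : ℤ, α x ![] = n * Complex.I}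
  zero_mem' := ⟨IsLocallyConstant.const 0, fun x => ⟨0, by simp⟩⟩
  add_mem' := by
    rintro α β ⟨ha, ha'⟩ ⟨hb, hb'⟩
    refine ⟨ha.add hb, fun x => ?_⟩
    obtain ⟨n, hn⟩ := ha' x
    obtain ⟨m, hm⟩ := hb' x
    exact ⟨n + m, by simp [hn, hm, add_mul]⟩
  neg_mem' := by
    rintro α ⟨ha, ha'⟩
    refine ⟨ha.neg, fun x => ?_⟩
    obtain ⟨n, hn⟩ := ha' x
    exact ⟨-n, by simp [hn]⟩

lemma imagInts_le_imagForms (W : Opens M) :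
    (imagInts W : AddSubgroup (∀ x : W, FormAt E 0 (x : M))) ≤ imagForms 0 W := by
  rintro α ⟨ha, ha'⟩
  refine ⟨fun x₀ y hy => ?_, fun x w => ?_⟩
  · have ho := (chartAt E x₀).isOpen_inter_preimage_symm W.isOpen
    have hyW : (chartAt E x₀).symm y ∈ W := hy.2
    refine ContDiffAt.contDiffWithinAt ?_
    refine ContDiffAt.congr_of_eventuallyEq
      (contDiffAt_const (c := chartRep x₀ (zeroExt W α) y)) ?_
    obtain ⟨O, hO, hyO, hOc⟩ := (IsLocallyConstant.iff_exists_open _).1 ha ⟨_, hyW⟩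
    obtain ⟨O', hO', rfl⟩ := isOpen_induced_iff.1 hO
    have hc : Filter.Tendsto (chartAt E x₀).symm (𝓝 y) (𝓝 ((chartAt E x₀).symm y)) :=
      (chartAt E x₀).symm.continuousAt hy.1
    filter_upwards [ho.mem_nhds hy, hc.eventually (hO'.mem_nhds hyO)] with z hz hzO
    have hzW : (chartAt E x₀).symm z ∈ W := hz.2
    have := hOc ⟨_, hzW⟩ hzO
    ext w
    have hw : w = ![] := Subsingleton.elim _ _
    subst hw
    simp only [chartRep, zeroExt_of_mem α hzW, zeroExt_of_mem α hyW]
    exact (congrArg (α ⟨_, hzW⟩) (Subsingleton.elim _ _)).trans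
      (this.trans (congrArg (α ⟨_, hyW⟩) (Subsingleton.elim _ _)))
  · have hw : w = ![] := Subsingleton.elim _ _
    subst hw
    obtain ⟨n, hn⟩ := ha' x
    simp [hn]

lemma conj_eq_neg_of_re {k : ℕ} {x : M} {η : FormAt E k x} (h : ∀ w, (η w).re = 0) :
    conjForm η = -η := by
  refine ContinuousAlternatingMap.ext fun w => ?_
  apply Complex.ext <;> simp [conjForm, h]

lemma secD_mem [IsManifold 𝓘(ℝ, E) ∞ M] {k : ℕ} {W : Opens M}
    {α : ∀ x : W, FormAt E k (x : M)} (h : α ∈ imagForms k W) :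
    secD W α ∈ imagForms (k + 1) W := by
  refine ⟨(h.1.extD W.isOpen).congr fun x hx => zeroExt_of_mem _ hx, fun x w => ?_⟩
  have hs := h.1.contDiffAt W.isOpen (mem_chart_source E (x : M)) x.2
  have h1 := extD_conjForm _ hs
  have h2 : (fun z => conjForm (zeroExt W α z)) = -zeroExt W α := by
    funext z
    by_cases hz : z ∈ W
    · rw [Pi.neg_apply, zeroExt_of_mem α hz]
      exact conj_eq_neg_of_re (h.2 ⟨z, hz⟩)
    · simp [zeroExt, hz]
  rw [h2, extD_neg _ hs] at h1
  have h3 := congrArg (fun η : FormAt E (k + 1) (x : M) => (η w).re) h1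
  simp [conjForm] at h3
  change (extD (zeroExt W α) x w).re = 0
  linarith

lemma secD_add [IsManifold 𝓘(ℝ, E) ∞ M] {k : ℕ} {W : Opens M}
    {α β : ∀ x : W, FormAt E k (x : M)} (ha : α ∈ imagForms k W) (hb : β ∈ imagForms k W) :
    secD W (α + β) = secD W α + secD W β := by
  funext x
  simp only [secD, zeroExt_add, Pi.add_apply]
  exact extD_add _ _ (ha.1.contDiffAt W.isOpen (mem_chart_source E (x : M)) x.2)
    (hb.1.contDiffAt W.isOpen (mem_chart_source E (x : M)) x.2)

/-- Restriction of sections to a smaller open set. -/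
def restrict {k : ℕ} {V W : Opens M} (h : V ≤ W) (α : ∀ x : W, FormAt E k (x : M)) (x : V) :
    FormAt E k (x : M) := α ⟨x, h x.2⟩

lemma zeroExt_restrict {k : ℕ} {V W : Opens M} (h : V ≤ W) (α : ∀ x : W, FormAt E k (x : M))
    {x : M} (hx : x ∈ V) : zeroExt V (restrict h α) x = zeroExt W α x := by
  rw [zeroExt_of_mem _ hx, zeroExt_of_mem _ (h hx)]; rfl

lemma secD_restrict {k : ℕ} {V W : Opens M} (h : V ≤ W) (α : ∀ x : W, FormAt E k (x : M)) :
    secD V (restrict h α) = restrict h (secD W α) := by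
  funext x
  refine extD_congr ?_
  filter_upwards [V.isOpen.mem_nhds x.2] with y hy
  exact zeroExt_restrict h α hy

lemma imagForms_restrict {k : ℕ} {V W : Opens M} (h : V ≤ W) {α : ∀ x : W, FormAt E k (x : M)}
    (ha : α ∈ imagForms k W) : restrict h α ∈ imagForms k V :=
  ⟨(ha.1.mono h).congr fun _ hx => zeroExt_restrict h α hx, fun _ _ => ha.2 _ _⟩

lemma imagInts_restrict {V W : Opens M} (h : V ≤ W) {α : ∀ x : W, FormAt E 0 (x : M)}
    (ha : α ∈ imagInts W) : restrict h α ∈ imagInts V :=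
  ⟨ha.1.comp_continuous (continuous_inclusion h), fun _ => ha.2 _⟩

/-- The `C₂`-action: a form at `τ x` is sent to the complex conjugate of its pullback along `τ`. -/
def conjPullAt {k : ℕ} (τ : SmoothInvolution E M) (x : M) : FormAt E k (τ x) →+ FormAt E k x :=
  conjForm.comp (pullAt τ x)

lemma conjPullAt_secD [IsManifold 𝓘(ℝ, E) ∞ M] {k : ℕ} (τ : SmoothInvolution E M)
    {V W : Opens M} (hVW : ∀ x ∈ V, τ x ∈ W) {α : ∀ x : V, FormAt E k (x : M)}
    {β : ∀ x : W, FormAt E k (x : M)} (hb : β ∈ imagForms k W)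
    (h : ∀ x : V, conjPullAt τ x (β ⟨τ x, hVW x x.2⟩) = α x) (x : V) :
    conjPullAt τ x (secD W β ⟨τ x, hVW x x.2⟩) = secD V α x := by
  have hs := hb.1.contDiffAt W.isOpen (mem_chart_source E (τ x)) (hVW x x.2)
  have hs' : ContDiffAt ℝ ∞ (chartRep (τ x) fun z => conjForm (zeroExt W β z))
      (chartAt E (τ x) (τ x)) :=
    (ContinuousLinearMap.compContinuousAlternatingMapCLM (𝕜 := ℝ) (E := E) (ι := Fin k) ℂ ℂ
        (Complex.conjCLE : ℂ →L[ℝ] ℂ)).contDiff.contDiffAt.comp _ hs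
  have h1 := extD_pullAt τ.contMDiff (fun z => conjForm (zeroExt W β z)) hs'
  rw [extD_conjForm _ hs] at h1
  refine Eq.trans ?_ (h1.symm.trans (extD_congr ?_))
  · rfl
  · filter_upwards [V.isOpen.mem_nhds x.2] with y hy
    rw [zeroExt_of_mem α hy, zeroExt_of_mem β (hVW y hy), ← h ⟨y, hy⟩]
    rfl

/-- The form degree of the sections in degree `j` of the Deligne complex: degree `0` holds `iℤ`
(inside the `0`-forms) and degree `k + 1` holds the `k`-forms. -/
abbrev formDegree : ℕ → ℕ
  | 0 => 0
  | k + 1 => k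

/-- Sections over `W` of the degree `j` part of the Real Deligne complex
`iℤ → i𝒜⁰ → i𝒜¹ → ⋯ → i𝒜ᵖ⁻¹ → 0`, where `iℤ` sits in degree `0`. -/
def deligneSections (p : ℕ) :
    ∀ (j : ℕ) (W : Opens M), AddSubgroup (∀ x : W, FormAt E (formDegree j) (x : M))
  | 0, W => imagInts W
  | k + 1, W => if k < p then imagForms k W else ⊥

/-- The inclusion `iℤ → i𝒜⁰` in degree `0`, the exterior derivative in positive degrees. -/
def rawDiff : ∀ (j : ℕ) (W : Opens M), (∀ x : W, FormAt E (formDegree j) (x : M)) →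
    ∀ x : W, FormAt E (formDegree (j + 1)) (x : M)
  | 0, _, α => α
  | _ + 1, W, α => secD W α

/-- The differential of the Real Deligne complex, which vanishes in degrees `j ≥ p`. -/
def sheafDiff (p j : ℕ) (W : Opens M) (α : ∀ x : W, FormAt E (formDegree j) (x : M)) :
    ∀ x : W, FormAt E (formDegree (j + 1)) (x : M) :=
  if j < p then rawDiff j W α else 0

lemma sheafDiff_mem [IsManifold 𝓘(ℝ, E) ∞ M] {p j : ℕ} {W : Opens M}
    {α : ∀ x : W, FormAt E (formDegree j) (x : M)} (h : α ∈ deligneSections p j W) :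
    sheafDiff p j W α ∈ deligneSections p (j + 1) W := by
  by_cases hj : j < p
  · simp only [sheafDiff, hj, if_true, deligneSections]
    cases j with
    | zero => exact imagInts_le_imagForms W h
    | succ k =>
      have hk : k < p := by omega
      simp only [deligneSections, hk, if_true] at h
      exact secD_mem h
  · simp only [sheafDiff, hj, if_false]
    exact zero_mem _

lemma sheafDiff_add [IsManifold 𝓘(ℝ, E) ∞ M] {p j : ℕ} {W : Opens M}
    {α β : ∀ x : W, FormAt E (formDegree j) (x : M)} (ha : α ∈ deligneSections p j W)
    (hb : β ∈ deligneSections p j W) :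
    sheafDiff p j W (α + β) = sheafDiff p j W α + sheafDiff p j W β := by
  by_cases hj : j < p
  · simp only [sheafDiff, hj, if_true]
    cases j with
    | zero => rfl
    | succ k =>
      have hk : k < p := by omega
      simp only [deligneSections, hk, if_true] at ha hb
      exact secD_add ha hb
  · simp [sheafDiff, hj]

lemma deligneSections_restrict {p j : ℕ} {V W : Opens M} (h : V ≤ W)
    {α : ∀ x : W, FormAt E (formDegree j) (x : M)} (ha : α ∈ deligneSections p j W) :
    restrict h α ∈ deligneSections p j V := by
  cases j with
  | zero => exact imagInts_restrict h ha
  | succ k =>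
    by_cases hk : k < p
    · simp only [deligneSections, hk, if_true] at ha ⊢
      exact imagForms_restrict h ha
    · simp only [deligneSections, hk, if_false, AddSubgroup.mem_bot] at ha ⊢
      subst ha
      rfl

lemma sheafDiff_restrict {p j : ℕ} {V W : Opens M} (h : V ≤ W)
    (α : ∀ x : W, FormAt E (formDegree j) (x : M)) :
    sheafDiff p j V (restrict h α) = restrict h (sheafDiff p j W α) := by
  by_cases hj : j < p
  · simp only [sheafDiff, hj, if_true]
    cases j with
    | zero => rfl
    | succ k => exact secD_restrict h α
  · simp only [sheafDiff, hj, if_false]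
    rfl

lemma conjPullAt_sheafDiff [IsManifold 𝓘(ℝ, E) ∞ M] {p j : ℕ} (τ : SmoothInvolution E M)
    {V W : Opens M} (hVW : ∀ x ∈ V, τ x ∈ W)
    {α : ∀ x : V, FormAt E (formDegree j) (x : M)}
    {β : ∀ x : W, FormAt E (formDegree j) (x : M)} (hb : β ∈ deligneSections p j W)
    (h : ∀ x : V, conjPullAt τ x (β ⟨τ x, hVW x x.2⟩) = α x) (x : V) :
    conjPullAt τ x (sheafDiff p j W β ⟨τ x, hVW x x.2⟩) = sheafDiff p j V α x := by
  by_cases hj : j < p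
  · simp only [sheafDiff, hj, if_true]
    cases j with
    | zero => exact h x
    | succ k =>
      have hk : k < p := by omega
      simp only [deligneSections, hk, if_true] at hb
      exact conjPullAt_secD τ hVW hb h x
  · simp [sheafDiff, hj]

end Sections

section Cech

open TopologicalSpace (Opens)

variable {E : Type v} [NormedAddCommGroup E] [NormedSpace ℝ E]
  {M : Type u} [TopologicalSpace M] [ChartedSpace E M]

/-- An open cover of `M`, indexed by a set with a free involution, such that the member with index
`inv i` is the image under `τ` of the member with index `i`. -/
structure EquivariantCover (τ : SmoothInvolution E M) where
  ι : Type u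
  U : ι → Opens M
  covers : ∀ x : M, ∃ i, x ∈ U i
  inv : ι → ι
  inv_involutive : Function.Involutive inv
  inv_ne : ∀ i, inv i ≠ i
  mem_inv : ∀ i x, x ∈ U (inv i) ↔ τ x ∈ U i

namespace EquivariantCover

variable {τ : SmoothInvolution E M}

/-- The intersection `U_{s 0} ∩ ⋯ ∩ U_{s q}`. -/
def inter (𝒰 : EquivariantCover τ) {q : ℕ} (s : Fin (q + 1) → 𝒰.ι) : Opens M :=
  ⟨⋂ a, (𝒰.U (s a) : Set M), isOpen_iInter_of_finite fun a => (𝒰.U (s a)).isOpen⟩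

lemma mem_inter {𝒰 : EquivariantCover τ} {q : ℕ} {s : Fin (q + 1) → 𝒰.ι} {x : M} :
    x ∈ 𝒰.inter s ↔ ∀ a, x ∈ 𝒰.U (s a) := Set.mem_iInter

lemma inter_face (𝒰 : EquivariantCover τ) {q : ℕ} (s : Fin (q + 2) → 𝒰.ι) (a : Fin (q + 2)) :
    𝒰.inter s ≤ 𝒰.inter (s ∘ a.succAbove) :=
  fun _ hx => mem_inter.2 fun b => mem_inter.1 hx (a.succAbove b)

lemma inter_inv (𝒰 : EquivariantCover τ) {q : ℕ} (s : Fin (q + 1) → 𝒰.ι) {x : M}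
    (hx : x ∈ 𝒰.inter s) : τ x ∈ 𝒰.inter (𝒰.inv ∘ s) :=
  mem_inter.2 fun a => (𝒰.mem_inv (s a) (τ x)).2 <| by
    rw [τ.involutive x]; exact mem_inter.1 hx a

/-- An equivariant refinement map from the cover `𝒱` to the cover `𝒰`. -/
structure Refinement (𝒱 𝒰 : EquivariantCover τ) where
  toFun : 𝒱.ι → 𝒰.ι
  map_inv : ∀ i, toFun (𝒱.inv i) = 𝒰.inv (toFun i)
  le : ∀ i, 𝒱.U i ≤ 𝒰.U (toFun i)

lemma Refinement.inter_le {𝒱 𝒰 : EquivariantCover τ} (φ : Refinement 𝒱 𝒰) {q : ℕ}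
    (s : Fin (q + 1) → 𝒱.ι) : 𝒱.inter s ≤ 𝒰.inter (φ.toFun ∘ s) :=
  fun _ hx => mem_inter.2 fun a => φ.le (s a) (mem_inter.1 hx a)

end EquivariantCover

variable {τ : SmoothInvolution E M} (𝒰 : EquivariantCover τ) (p : ℕ)

/-- Equivariant Čech `q`-cochains of the cover with values in degree `j` of the Deligne complex. -/
def cochains (q j : ℕ) : AddSubgroup
    (∀ (s : Fin (q + 1) → 𝒰.ι) (x : 𝒰.inter s), FormAt E (formDegree j) (x : M)) where
  carrier := {c | (∀ s, c s ∈ deligneSections p j (𝒰.inter s)) ∧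
    ∀ s (x : 𝒰.inter s), conjPullAt τ x (c (𝒰.inv ∘ s) ⟨τ x, 𝒰.inter_inv s x.2⟩) = c s x}
  zero_mem' := ⟨fun _ => zero_mem _, fun _ _ => map_zero _⟩
  add_mem' ha hb := ⟨fun s => add_mem (ha.1 s) (hb.1 s), fun s x => by
    simp only [Pi.add_apply, map_add, ha.2, hb.2]⟩
  neg_mem' ha := ⟨fun s => neg_mem (ha.1 s), fun s x => by
    simp only [Pi.neg_apply, map_neg, ha.2]⟩

/-- The Čech coboundary, the alternating sum of the restrictions. -/
def cechDiff (q j : ℕ) : cochains 𝒰 p q j →+ cochains 𝒰 p (q + 1) j where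
  toFun c := ⟨fun s x => ∑ a : Fin (q + 2),
      (-1 : ℤ) ^ (a : ℕ) • c.1 (s ∘ a.succAbove) ⟨x, 𝒰.inter_face s a x.2⟩, by
    refine ⟨fun s => ?_, fun s x => ?_⟩
    · have h : (fun x : 𝒰.inter s => ∑ a : Fin (q + 2),
          (-1 : ℤ) ^ (a : ℕ) • c.1 (s ∘ a.succAbove) ⟨x, 𝒰.inter_face s a x.2⟩) =
          ∑ a : Fin (q + 2), (-1 : ℤ) ^ (a : ℕ) •
            restrict (𝒰.inter_face s a) (c.1 (s ∘ a.succAbove)) := by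
        funext x
        simp [restrict]
      refine Eq.mpr (congrArg (· ∈ deligneSections p j (𝒰.inter s)) h) ?_
      exact sum_mem fun a _ => zsmul_mem
        (deligneSections_restrict (𝒰.inter_face s a) (c.2.1 _)) _
    · rw [map_sum]
      refine Finset.sum_congr rfl fun a _ => ?_
      rw [map_zsmul]
      congr 1
      exact c.2.2 (s ∘ a.succAbove) ⟨x, 𝒰.inter_face s a x.2⟩⟩
  map_zero' := by
    apply Subtype.ext
    funext s x
    simp
  map_add' c c' := by
    apply Subtype.ext
    funext s x
    simp [Finset.sum_add_distrib]

/-- The map induced on cochains by the differential of the Deligne complex. -/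
def formDiff [IsManifold 𝓘(ℝ, E) ∞ M] (q j : ℕ) :
    cochains 𝒰 p q j →+ cochains 𝒰 p q (j + 1) :=
  AddMonoidHom.mk' (fun c => ⟨fun s => sheafDiff p j (𝒰.inter s) (c.1 s),
    fun s => sheafDiff_mem (c.2.1 s),
    fun s x => conjPullAt_sheafDiff τ (fun _ hx => 𝒰.inter_inv s hx) (c.2.1 _) (c.2.2 s) x⟩)
    fun c c' => by
      apply Subtype.ext
      funext s
      exact sheafDiff_add (c.2.1 s) (c'.2.1 s)

instance cochainsAddCommGroup (q j : ℕ) : AddCommGroup (cochains 𝒰 p q j) := inferInstance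

/-- All cochains of the double complex: `c q j` has Čech degree `q` and sheaf degree `j`. -/
abbrev BiCochains : Type (max u v) := ∀ q j : ℕ, cochains 𝒰 p q j

instance biCochainsAddCommGroup : AddCommGroup (BiCochains 𝒰 p) := Pi.addCommGroup

/-- The total differential: Čech coboundary plus `(-1)^q` times the sheaf differential, where `q`
is the Čech degree. -/
def totalDiff [IsManifold 𝓘(ℝ, E) ∞ M] : BiCochains 𝒰 p →+ BiCochains 𝒰 p :=
  AddMonoidHom.mk' (fun c q j => match q, j with
    | 0, 0 => 0
    | q + 1, 0 => cechDiff 𝒰 p q 0 (c q 0)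
    | 0, j + 1 => formDiff 𝒰 p 0 j (c 0 j)
    | q + 1, j + 1 => cechDiff 𝒰 p q (j + 1) (c q (j + 1)) +
        (-1 : ℤ) ^ (q + 1) • formDiff 𝒰 p (q + 1) j (c (q + 1) j)) fun c c' => by
    funext q j
    match q, j with
    | 0, 0 => exact (add_zero 0).symm
    | q + 1, 0 => exact map_add (cechDiff 𝒰 p q 0) _ _
    | 0, j + 1 => exact map_add (formDiff 𝒰 p 0 j) _ _
    | q + 1, j + 1 =>
      simp only [Pi.add_apply]
      rw [map_add (cechDiff 𝒰 p q (j + 1)), map_add (formDiff 𝒰 p (q + 1) j), zsmul_add]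
      exact add_add_add_comm _ _ _ _

/-- The part of total degree `n`. -/
def totalDegree (n : ℕ) : AddSubgroup (BiCochains 𝒰 p) where
  carrier := {c | ∀ q j, q + j ≠ n → c q j = 0}
  zero_mem' _ _ _ := rfl
  add_mem' ha hb q j h := by simp [ha q j h, hb q j h]
  neg_mem' ha q j h := by simp [ha q j h]

/-- Cocycles of total degree `n`. -/
def totalCocycles [IsManifold 𝓘(ℝ, E) ∞ M] (n : ℕ) : AddSubgroup (BiCochains 𝒰 p) :=
  totalDegree 𝒰 p n ⊓ (totalDiff 𝒰 p).ker

/-- Coboundaries of total degree `n`. -/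
def totalCoboundaries [IsManifold 𝓘(ℝ, E) ∞ M] : ℕ → AddSubgroup (BiCochains 𝒰 p)
  | 0 => ⊥
  | n + 1 => (totalDegree 𝒰 p n).map (totalDiff 𝒰 p)

/-- The equivariant Čech hypercohomology of a cover in degree `n`. -/
abbrev CoverCohomology [IsManifold 𝓘(ℝ, E) ∞ M] (n : ℕ) : Type (max u v) :=
  totalCocycles 𝒰 p n ⧸ (totalCoboundaries 𝒰 p n).addSubgroupOf (totalCocycles 𝒰 p n)

instance coverCohomologyAddCommGroup [IsManifold 𝓘(ℝ, E) ∞ M] (n : ℕ) :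
    AddCommGroup (CoverCohomology 𝒰 p n) := QuotientAddGroup.Quotient.addCommGroup _

variable {𝒰} {𝒱 : EquivariantCover τ} (φ : EquivariantCover.Refinement 𝒱 𝒰)

/-- Pullback of cochains along a refinement map. -/
def cochainPullback (q j : ℕ) : cochains 𝒰 p q j →+ cochains 𝒱 p q j where
  toFun c := ⟨fun s => restrict (φ.inter_le s) (c.1 (φ.toFun ∘ s)),
    fun s => deligneSections_restrict (φ.inter_le s) (c.2.1 _), fun s x => by
      have h := c.2.2 (φ.toFun ∘ s) ⟨x, φ.inter_le s x.2⟩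
      have hs : 𝒰.inv ∘ φ.toFun ∘ s = φ.toFun ∘ 𝒱.inv ∘ s := by
        funext a
        exact (φ.map_inv (s a)).symm
      refine Eq.trans ?_ h
      congr 1
      have key : ∀ (t t' : Fin (q + 1) → 𝒰.ι) (ht : t = t') (y : M) (hy : y ∈ 𝒰.inter t)
          (hy' : y ∈ 𝒰.inter t'), c.1 t' ⟨y, hy'⟩ = c.1 t ⟨y, hy⟩ := by
        rintro t _ rfl y _ _
        rfl
      exact key _ _ hs _ _ _⟩
  map_zero' := rfl
  map_add' _ _ := rfl

/-- Pullback on the double complex along a refinement map. -/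
def biPullback : BiCochains 𝒰 p →+ BiCochains 𝒱 p where
  toFun c q j := cochainPullback p φ q j (c q j)
  map_zero' := rfl
  map_add' _ _ := rfl

lemma totalDiff_biPullback [IsManifold 𝓘(ℝ, E) ∞ M] (c : BiCochains 𝒰 p) :
    totalDiff 𝒱 p (biPullback p φ c) = biPullback p φ (totalDiff 𝒰 p c) := by
  have h1 : ∀ q j (b : cochains 𝒰 p q j), cechDiff 𝒱 p q j (cochainPullback p φ q j b) =
      cochainPullback p φ (q + 1) j (cechDiff 𝒰 p q j b) := fun _ _ _ => rfl
  have h2 : ∀ q j (b : cochains 𝒰 p q j), formDiff 𝒱 p q j (cochainPullback p φ q j b) =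
      cochainPullback p φ q (j + 1) (formDiff 𝒰 p q j b) := fun q j b => by
    apply Subtype.ext
    funext s
    exact sheafDiff_restrict (φ.inter_le s) (b.1 (φ.toFun ∘ s))
  funext q j
  cases q <;> cases j
  · exact (map_zero (cochainPullback p φ 0 0)).symm
  · exact h2 _ _ _
  · exact h1 _ _ _
  · change cechDiff 𝒱 p _ _ (cochainPullback p φ _ _ _) +
        (-1 : ℤ) ^ _ • formDiff 𝒱 p _ _ (cochainPullback p φ _ _ _) =
      cochainPullback p φ _ _ (_ + (-1 : ℤ) ^ _ • _)
    rw [h1, h2, map_add, map_zsmul]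

lemma biPullback_mem {n : ℕ} {c : BiCochains 𝒰 p} (hc : c ∈ totalDegree 𝒰 p n) :
    biPullback p φ c ∈ totalDegree 𝒱 p n := fun q j h => by
  change cochainPullback p φ q j (c q j) = 0
  rw [hc q j h, map_zero]

/-- Pullback of cocycles along a refinement map. -/
def cocyclePullback [IsManifold 𝓘(ℝ, E) ∞ M] (n : ℕ) :
    totalCocycles 𝒰 p n →+ totalCocycles 𝒱 p n :=
  ((biPullback p φ).comp (totalCocycles 𝒰 p n).subtype).codRestrict _ fun c =>
    ⟨biPullback_mem p φ c.2.1, by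
      change totalDiff 𝒱 p (biPullback p φ c.1) = 0
      rw [totalDiff_biPullback, show totalDiff 𝒰 p c.1 = 0 from c.2.2, map_zero]⟩

/-- The map induced on hypercohomology by a refinement map. -/
def cohomologyPullback [IsManifold 𝓘(ℝ, E) ∞ M] (n : ℕ) :
    CoverCohomology 𝒰 p n →+ CoverCohomology 𝒱 p n :=
  QuotientAddGroup.map _ _ (cocyclePullback p φ n) fun c hc => by
    rw [AddSubgroup.mem_addSubgroupOf] at hc
    rw [AddSubgroup.mem_comap, AddSubgroup.mem_addSubgroupOf]
    change biPullback p φ c.1 ∈ _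
    cases n with
    | zero =>
      rw [show c.1 = 0 from hc, map_zero]
      exact zero_mem _
    | succ n =>
      obtain ⟨b, hb, hbc⟩ := hc
      exact ⟨biPullback p φ b, biPullback_mem p φ hb, by rw [totalDiff_biPullback, hbc]⟩

open Classical in
/-- The relations of the colimit: a class is identified with its pullback along every refinement. -/
def refinementRelations [IsManifold 𝓘(ℝ, E) ∞ M] (τ : SmoothInvolution E M) (p n : ℕ) :
    AddSubgroup (DirectSum (EquivariantCover τ) fun 𝒰 => CoverCohomology 𝒰 p n) :=
  AddSubgroup.closure {r | ∃ (𝒰 𝒱 : EquivariantCover τ) (φ : EquivariantCover.Refinement 𝒱 𝒰)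
    (c : CoverCohomology 𝒰 p n),
    r = DirectSum.of (fun 𝒲 : EquivariantCover τ => CoverCohomology 𝒲 p n) 𝒱
        (cohomologyPullback p φ n c) -
      DirectSum.of (fun 𝒲 : EquivariantCover τ => CoverCohomology 𝒲 p n) 𝒰 c}

/-- Real smooth Deligne cohomology `H^n_{D,R}(M; ℤ(p))`: the colimit of the abelian groups
`CoverCohomology 𝒰 p n` over all equivariant covers `𝒰` and their refinement maps, presented as
the direct sum modulo the relations of the colimit. -/
abbrev RealDeligneCohomology [IsManifold 𝓘(ℝ, E) ∞ M] (τ : SmoothInvolution E M) (p n : ℕ) :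
    Type (max (u + 1) v) :=
  (DirectSum (EquivariantCover τ) fun 𝒰 => CoverCohomology 𝒰 p n) ⧸ refinementRelations τ p n

end Cech

section LineBundles

open Bundle (TotalSpace)
open scoped ComplexConjugate

variable {E : Type v} [NormedAddCommGroup E] [NormedSpace ℝ E]
  {M : Type u} [TopologicalSpace M] [ChartedSpace E M]

/-- Smooth sections of a complex line bundle (over the real manifold `M`). -/
def SmoothSection {F : M → Type} [TopologicalSpace (TotalSpace ℂ F)]
    [∀ x, TopologicalSpace (F x)] [FiberBundle ℂ F] (s : ∀ x, F x) : Prop :=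
  ContMDiff 𝓘(ℝ, E) (𝓘(ℝ, E).prod 𝓘(ℝ, ℂ)) ∞ fun x => TotalSpace.mk' ℂ x (s x)

/-- A Real Hermitian line bundle over `(M, τ)`: a smooth complex line bundle with a smooth Hermitian
metric and a smooth antilinear involution `σ` of the total space covering `τ`, which is compatible
with the metric. The two `VectorBundle` fields say that the trivializations are `ℂ`-linear and that
the bundle is smooth over the real manifold `M`. Every line bundle is isomorphic to one whose fibres
live in `Type`, so this choice of universe loses nothing. -/
structure RealLineBundle (τ : SmoothInvolution E M) where
  Fiber : M → Type
  [addCommGroup : ∀ x, AddCommGroup (Fiber x)]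
  [module : ∀ x, Module ℂ (Fiber x)]
  [fiberTopology : ∀ x, TopologicalSpace (Fiber x)]
  [isTopologicalAddGroup : ∀ x, IsTopologicalAddGroup (Fiber x)]
  [continuousSMul : ∀ x, ContinuousSMul ℝ (Fiber x)]
  [totalTopology : TopologicalSpace (TotalSpace ℂ Fiber)]
  [fiberBundle : FiberBundle ℂ Fiber]
  [complexVectorBundle : VectorBundle ℂ ℂ Fiber]
  [realVectorBundle : VectorBundle ℝ ℂ Fiber]
  [smoothVectorBundle : ContMDiffVectorBundle ∞ ℂ Fiber 𝓘(ℝ, E)]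
  herm : ∀ x, Fiber x →ₗ⋆[ℂ] Fiber x →ₗ[ℂ] ℂ
  herm_symm : ∀ x u w, herm x w u = conj (herm x u w)
  herm_pos : ∀ x u, u ≠ 0 → 0 < (herm x u u).re
  herm_smooth : ∀ s t : ∀ x, Fiber x, SmoothSection (E := E) s → SmoothSection (E := E) t →
    ContMDiff 𝓘(ℝ, E) 𝓘(ℝ, ℂ) ∞ fun x => herm x (s x) (t x)
  σ : ∀ x, Fiber x →ₗ⋆[ℂ] Fiber (τ x)
  σ_smooth : ContMDiff (𝓘(ℝ, E).prod 𝓘(ℝ, ℂ)) (𝓘(ℝ, E).prod 𝓘(ℝ, ℂ)) ∞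
    fun e : TotalSpace ℂ Fiber => TotalSpace.mk' ℂ (τ e.proj) (σ e.proj e.snd)
  σ_involutive : Function.Involutive
    fun e : TotalSpace ℂ Fiber => TotalSpace.mk' ℂ (τ e.proj) (σ e.proj e.snd)
  herm_σ : ∀ x u w, herm (τ x) (σ x u) (σ x w) = conj (herm x u w)

attribute [instance] RealLineBundle.addCommGroup RealLineBundle.module
  RealLineBundle.fiberTopology RealLineBundle.isTopologicalAddGroup
  RealLineBundle.continuousSMul RealLineBundle.totalTopology RealLineBundle.fiberBundle
  RealLineBundle.complexVectorBundle RealLineBundle.realVectorBundle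
  RealLineBundle.smoothVectorBundle

variable [IsManifold 𝓘(ℝ, E) ∞ M] {τ : SmoothInvolution E M}

/-- Smooth vector fields. -/
def SmoothField (X : ∀ x : M, TangentSpace 𝓘(ℝ, E) x) : Prop :=
  ContMDiff 𝓘(ℝ, E) (𝓘(ℝ, E).prod 𝓘(ℝ, E)) ∞ fun x => TotalSpace.mk' E x (X x)

/-- A Real connection on a Real Hermitian line bundle: a smooth covariant derivative `∇` which is
`ℂ`-linear, compatible with the metric, and commutes with the involutions on sections and on
one-forms. In the field `real` the section `t` is the conjugate section `σ ∘ s ∘ τ` of `s`. -/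
structure RealConnection (L : RealLineBundle τ) where
  cov : CovariantDerivative 𝓘(ℝ, E) ℂ L.Fiber
  smooth : CovariantDerivative.ContMDiffCovariantDerivative cov ∞
  map_smul : ∀ (c : ℂ) (s : ∀ x, L.Fiber x), SmoothSection (E := E) s →
    ∀ x w, cov (c • s) x w = c • cov s x w
  metric : ∀ s t : ∀ x, L.Fiber x, SmoothSection (E := E) s → SmoothSection (E := E) t →
    ∀ (x : M) (w : TangentSpace 𝓘(ℝ, E) x),
      (mfderiv 𝓘(ℝ, E) 𝓘(ℝ, ℂ) (fun y => L.herm y (s y) (t y)) x w : ℂ) =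
        L.herm x (cov s x w) (t x) + L.herm x (s x) (cov t x w)
  real : ∀ s t : ∀ x, L.Fiber x, SmoothSection (E := E) s → SmoothSection (E := E) t →
    (∀ x, t (τ x) = L.σ x (s x)) → ∀ (x : M) (w : TangentSpace 𝓘(ℝ, E) x),
      cov t (τ x) (mfderiv 𝓘(ℝ, E) 𝓘(ℝ, E) τ x w) = L.σ x (cov s x w)

/-- The curvature `∇_X ∇_Y s - ∇_Y ∇_X s - ∇_[X,Y] s`. -/
def RealConnection.curvature {L : RealLineBundle τ} (D : RealConnection L)
    (X Y : ∀ x : M, TangentSpace 𝓘(ℝ, E) x) (s : ∀ x, L.Fiber x) (x : M) : L.Fiber x :=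
  D.cov (fun y => D.cov s y (Y y)) x (X x) - D.cov (fun y => D.cov s y (X y)) x (Y x) -
    D.cov s x (VectorField.mlieBracket 𝓘(ℝ, E) X Y x)

/-- The connection is flat: its curvature vanishes. -/
def RealConnection.IsFlat {L : RealLineBundle τ} (D : RealConnection L) : Prop :=
  ∀ X Y : ∀ x : M, TangentSpace 𝓘(ℝ, E) x, SmoothField X → SmoothField Y →
    ∀ s : ∀ x, L.Fiber x, SmoothSection (E := E) s → ∀ x, D.curvature X Y s x = 0

/-- A Real Hermitian line bundle with a flat Real connection. -/
structure FlatRealLineBundle (τ : SmoothInvolution E M) extends RealLineBundle τ where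
  conn : RealConnection toRealLineBundle
  flat : conn.IsFlat

namespace FlatRealLineBundle

/-- An isomorphism of Real Hermitian line bundles with connection, covering the identity of `M`. -/
structure Iso (L L' : FlatRealLineBundle τ) where
  map : ∀ x, L.Fiber x ≃ₗ[ℂ] L'.Fiber x
  smooth : ContMDiff (𝓘(ℝ, E).prod 𝓘(ℝ, ℂ)) (𝓘(ℝ, E).prod 𝓘(ℝ, ℂ)) ∞
    fun e : TotalSpace ℂ L.Fiber => TotalSpace.mk' ℂ e.proj (map e.proj e.snd)
  smooth_symm : ContMDiff (𝓘(ℝ, E).prod 𝓘(ℝ, ℂ)) (𝓘(ℝ, E).prod 𝓘(ℝ, ℂ)) ∞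
    fun e : TotalSpace ℂ L'.Fiber => TotalSpace.mk' ℂ e.proj ((map e.proj).symm e.snd)
  map_herm : ∀ x u w, L'.herm x (map x u) (map x w) = L.herm x u w
  map_σ : ∀ x u, map (τ x) (L.σ x u) = L'.σ x (map x u)
  map_conn : ∀ s : ∀ x, L.Fiber x, SmoothSection (E := E) s → ∀ x w,
    L'.conn.cov (fun y => map y (s y)) x w = map x (L.conn.cov s x w)

def Iso.refl (L : FlatRealLineBundle τ) : Iso L L where
  map x := LinearEquiv.refl ℂ (L.Fiber x)
  smooth := contMDiff_id
  smooth_symm := contMDiff_id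
  map_herm _ _ _ := rfl
  map_σ _ _ := rfl
  map_conn _ _ _ _ := rfl

def Iso.symm {L L' : FlatRealLineBundle τ} (f : Iso L L') : Iso L' L where
  map x := (f.map x).symm
  smooth := f.smooth_symm
  smooth_symm := f.smooth
  map_herm x u w := by simp [← f.map_herm]
  map_σ x u := by
    rw [LinearEquiv.symm_apply_eq, f.map_σ, LinearEquiv.apply_symm_apply]
  map_conn s hs x w := by
    have h := f.map_conn (fun y => (f.map y).symm (s y)) (f.smooth_symm.comp hs) x w
    simp only [LinearEquiv.apply_symm_apply] at h
    rw [LinearEquiv.eq_symm_apply, ← h]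

def Iso.trans {L L' L'' : FlatRealLineBundle τ} (f : Iso L L') (g : Iso L' L'') : Iso L L'' where
  map x := (f.map x).trans (g.map x)
  smooth := g.smooth.comp f.smooth
  smooth_symm := f.smooth_symm.comp g.smooth_symm
  map_herm x u w := by simp [g.map_herm, f.map_herm]
  map_σ x u := by simp [f.map_σ, g.map_σ]
  map_conn s hs x w := by
    have h := g.map_conn (fun y => f.map y (s y)) (f.smooth.comp hs) x w
    rw [f.map_conn s hs] at h
    exact h

/-- Being isomorphic. -/
instance isoSetoid (τ : SmoothInvolution E M) : Setoid (FlatRealLineBundle τ) where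
  r L L' := Nonempty (Iso L L')
  iseqv := ⟨fun L => ⟨Iso.refl L⟩, fun ⟨f⟩ => ⟨f.symm⟩, fun ⟨f⟩ ⟨g⟩ => ⟨f.trans g⟩⟩

/-- Isomorphism classes of Real Hermitian line bundles with flat Real connection. -/
def IsoClass (τ : SmoothInvolution E M) : Type (max (max u v) 1) :=
  Quotient (isoSetoid τ)

/-- The isomorphism class of a Real Hermitian line bundle with flat Real connection. -/
def isoClass (L : FlatRealLineBundle τ) : IsoClass τ := Quotient.mk (isoSetoid τ) L

/-- The data that makes `N` the tensor product of `L` and `L'` as Real Hermitian line bundles with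
connection: a smooth fibrewise tensor product under which the metric, the Real structure and the
connection of `N` are the tensor products of those of `L` and `L'`. -/
structure TensorStructure (L L' N : FlatRealLineBundle τ) where
  pair : ∀ x, L.Fiber x →ₗ[ℂ] L'.Fiber x →ₗ[ℂ] N.Fiber x
  isTensorProduct : ∀ x, IsTensorProduct (pair x)
  smooth : ∀ (s : ∀ x, L.Fiber x) (s' : ∀ x, L'.Fiber x),
    SmoothSection (E := E) s → SmoothSection (E := E) s' →
      SmoothSection (E := E) fun x => pair x (s x) (s' x)
  herm : ∀ x u w u' w', N.herm x (pair x u u') (pair x w w') = L.herm x u w * L'.herm x u' w'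
  σ : ∀ x u u', N.σ x (pair x u u') = pair (τ x) (L.σ x u) (L'.σ x u')
  conn : ∀ (s : ∀ x, L.Fiber x) (s' : ∀ x, L'.Fiber x),
    SmoothSection (E := E) s → SmoothSection (E := E) s' → ∀ x w,
      N.conn.cov (fun y => pair y (s y) (s' y)) x w =
        pair x (L.conn.cov s x w) (s' x) + pair x (s x) (L'.conn.cov s' x w)

/-- The group law `G` on isomorphism classes is the tensor product: any two bundles have a tensor
product, and the class of any tensor product is the product of the classes. -/
def IsTensorGroupLaw (G : CommGroup (IsoClass τ)) : Prop :=
  ∀ L L' : FlatRealLineBundle τ,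
    (∃ N : FlatRealLineBundle τ, Nonempty (TensorStructure L L' N)) ∧
    ∀ N : FlatRealLineBundle τ, Nonempty (TensorStructure L L' N) →
      G.mul (isoClass L) (isoClass L') = isoClass N

end FlatRealLineBundle

end LineBundles

end RealDeligne

end

/-! Both sides are described by locally constant `U(1)`-valued Čech cocycles `g` on equivariant
covers that satisfy `g_{inv i, inv j}(τ x) = conj (g_ij x)`.

Bundles. Relative to a local unit section, a metric connection is an imaginary one-form, and
flatness says that this form is closed. By the Poincaré lemma (`exists_primitive`) it is `dh` for an
imaginary `h`, and rescaling the section by `exp (-h)` gives a flat unit frame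
(`exists_isFlatFrame`). Ratios of flat unit frames are locally constant of modulus one. Since the
involution of the index set is free, a frame may be chosen on one member of each pair of sets and
transported to the other by the Real structure, so every bundle has a cocycle (`exists_hasCocycle`).
Conversely every cocycle glues to a flat Real bundle (`hasCocycle_flatBundle`). Bundles with the
same cocycle are isomorphic, a change of frames is a gauge transformation, and tensor products
multiply cocycles. The group axioms are therefore identities between cocycles on a common
refinement.

Deligne classes. A cocycle of degree two is a triple `(n, f, A)` with `n` integral, `f` imaginary
functions on double intersections and `A` imaginary one-forms, subject to `δn = 0`, `δf = -n`, `df =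
δA` and `dA = 0`. The last condition is present exactly because `p > 2`, and it is what makes the
bundle flat. On a refinement `A = dh`, and then `f - δh` is locally constant with integral
coboundary, so that `uexp (f - δh)`, with `uexp z = exp (2πz)`, is a cocycle of the previous kind.
Its isomorphism class depends neither on the refinement map nor on the primitives
(`Represents.unique`). It is additive in the data, trivial on coboundaries and unchanged by
pullback, whence the homomorphism `deligneClass`.

Bijectivity. Locally constant `U(1)`-valued functions have locally constant imaginary logarithms,
with no condition on the cover, and these can be made Real by choosing one index in each orbit
(`exists_real_lift`). Taking the logarithm of a cocycle, with `A = 0`, gives surjectivity. Taking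
the logarithm of a trivialising gauge exhibits a Deligne cocycle as a coboundary after refinement,
which gives injectivity. No good covers are needed, since the colimit allows every refinement. -/

noncomputable section

namespace RealDeligne

universe v u

open Bundle (TotalSpace)
open scoped ComplexConjugate
open TopologicalSpace (Opens)

/-! ### Differentials of complex-valued functions -/

section
variable {E : Type v} [NormedAddCommGroup E] [NormedSpace ℝ E]
  {M : Type u} [TopologicalSpace M] [ChartedSpace E M]

variable (E) in
/-- The differential of a complex-valued function. -/
def dC (f : M → ℂ) (x : M) : TangentSpace 𝓘(ℝ, E) x →L[ℝ] ℂ := mvfderiv 𝓘(ℝ, E) f x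

lemma dC_congr {f g : M → ℂ} {x : M} (h : f =ᶠ[𝓝 x] g) : dC E f x = dC E g x := by
  ext w
  have := h.mfderiv_eq (I := 𝓘(ℝ, E)) (I' := 𝓘(ℝ, ℂ))
  exact congrArg (fun L : E →L[ℝ] ℂ => L w) this

lemma HasMFDerivAt.dC_eq {f : M → ℂ} {x : M} {f' : E →L[ℝ] ℂ}
    (h : HasMFDerivAt 𝓘(ℝ, E) 𝓘(ℝ, ℂ) f x f') : dC E f x = f' := by
  ext w
  exact congrArg (fun L : E →L[ℝ] ℂ => L w) h.mfderiv

lemma dC_mul {f g : M → ℂ} {x : M} (hf : MDifferentiableAt 𝓘(ℝ, E) 𝓘(ℝ, ℂ) f x)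
    (hg : MDifferentiableAt 𝓘(ℝ, E) 𝓘(ℝ, ℂ) g x) :
    dC E (fun y => f y * g y) x = f x • dC E g x + g x • dC E f x := by
  exact HasMFDerivAt.dC_eq (hf.hasMFDerivAt.mul hg.hasMFDerivAt)

lemma dC_comp {f : M → ℂ} {G : ℂ → ℂ} {x : M} {G' : ℂ →L[ℝ] ℂ} (hG : HasFDerivAt G G' (f x))
    (hf : MDifferentiableAt 𝓘(ℝ, E) 𝓘(ℝ, ℂ) f x) :
    dC E (fun y => G (f y)) x = G' ∘L dC E f x :=
  HasMFDerivAt.dC_eq (hG.hasMFDerivAt.comp x hf.hasMFDerivAt)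

lemma dC_comp_map {f : M → ℂ} {k : M → M} {x : M}
    (hf : MDifferentiableAt 𝓘(ℝ, E) 𝓘(ℝ, ℂ) f (k x))
    (hk : MDifferentiableAt 𝓘(ℝ, E) 𝓘(ℝ, E) k x) (w : TangentSpace 𝓘(ℝ, E) x) :
    dC E (fun y => f (k y)) x w = dC E f (k x) (mfderiv 𝓘(ℝ, E) 𝓘(ℝ, E) k x w) := by
  have := HasMFDerivAt.dC_eq (hf.hasMFDerivAt.comp x hk.hasMFDerivAt)
  exact congrArg (fun L : E →L[ℝ] ℂ => L w) this


lemma dC_const (c : ℂ) (x : M) : dC E (fun _ => c) x = 0 :=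
  HasMFDerivAt.dC_eq (hasMFDerivAt_const c x)

lemma dC_add {f g : M → ℂ} {x : M} (hf : MDifferentiableAt 𝓘(ℝ, E) 𝓘(ℝ, ℂ) f x)
    (hg : MDifferentiableAt 𝓘(ℝ, E) 𝓘(ℝ, ℂ) g x) :
    dC E (fun y => f y + g y) x = dC E f x + dC E g x :=
  HasMFDerivAt.dC_eq (hf.hasMFDerivAt.add hg.hasMFDerivAt)

lemma dC_sub {f g : M → ℂ} {x : M} (hf : MDifferentiableAt 𝓘(ℝ, E) 𝓘(ℝ, ℂ) f x)
    (hg : MDifferentiableAt 𝓘(ℝ, E) 𝓘(ℝ, ℂ) g x) :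
    dC E (fun y => f y - g y) x = dC E f x - dC E g x :=
  HasMFDerivAt.dC_eq (hf.hasMFDerivAt.sub hg.hasMFDerivAt)

/-! ### Charts, local constancy and the Poincaré lemma -/

section Charts

variable [IsManifold 𝓘(ℝ, E) ∞ M]

lemma mfderiv_chart_symm_apply {x₀ x : M} (hx : x ∈ (chartAt E x₀).source) (v : E) :
    (mfderiv 𝓘(ℝ, E) 𝓘(ℝ, E) (chartAt E x₀) x : E →L[ℝ] E)
      ((mfderiv 𝓘(ℝ, E) 𝓘(ℝ, E) (chartAt E x₀).symm (chartAt E x₀ x) : E →L[ℝ] E) v) = v := by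
  have hmd := mdifferentiable_of_mem_atlas (I := 𝓘(ℝ, E)) (chart_mem_atlas E x₀)
  have := hmd.comp_symm_deriv ((chartAt E x₀).map_source hx)
  rw [(chartAt E x₀).left_inv hx] at this
  exact congrArg (fun L : E →L[ℝ] E => L v) this

lemma mfderiv_symm_chart_apply {x₀ x : M} (hx : x ∈ (chartAt E x₀).source) (v : E) :
    (mfderiv 𝓘(ℝ, E) 𝓘(ℝ, E) (chartAt E x₀).symm (chartAt E x₀ x) : E →L[ℝ] E)
      ((mfderiv 𝓘(ℝ, E) 𝓘(ℝ, E) (chartAt E x₀) x : E →L[ℝ] E) v) = v := by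
  have hmd := mdifferentiable_of_mem_atlas (I := 𝓘(ℝ, E)) (chart_mem_atlas E x₀)
  exact congrArg (fun L : E →L[ℝ] E => L v) (hmd.symm_comp_deriv hx)

lemma hasFDerivAt_comp_symm {f : M → ℂ} {x₀ x : M} (hx : x ∈ (chartAt E x₀).source)
    (hf : MDifferentiableAt 𝓘(ℝ, E) 𝓘(ℝ, ℂ) f x) :
    HasFDerivAt (f ∘ (chartAt E x₀).symm)
      ((dC E f x : E →L[ℝ] ℂ) ∘L
        (mfderiv 𝓘(ℝ, E) 𝓘(ℝ, E) (chartAt E x₀).symm (chartAt E x₀ x) : E →L[ℝ] E))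
      (chartAt E x₀ x) := by
  have hd0 : MDifferentiableAt 𝓘(ℝ, E) 𝓘(ℝ, E) (chartAt E x₀).symm (chartAt E x₀ x) :=
    mdifferentiableAt_atlas_symm (chart_mem_atlas E x₀) ((chartAt E x₀).map_source hx)
  have hl := (chartAt E x₀).left_inv hx
  have h := HasMFDerivAt.comp (g := f) (chartAt E x₀ x)
    (by rw [hl]; exact hf.hasMFDerivAt) hd0.hasMFDerivAt
  exact hasMFDerivAt_iff_hasFDerivAt.1 h

lemma dC_chart {f : M → ℂ} {x₀ x : M} (hx : x ∈ (chartAt E x₀).source)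
    (hf : MDifferentiableAt 𝓘(ℝ, E) 𝓘(ℝ, ℂ) f x) (w : TangentSpace 𝓘(ℝ, E) x) :
    dC E f x w = fderiv ℝ (f ∘ (chartAt E x₀).symm) (chartAt E x₀ x)
      (mfderiv 𝓘(ℝ, E) 𝓘(ℝ, E) (chartAt E x₀) x w) := by
  rw [(hasFDerivAt_comp_symm hx hf).fderiv]
  exact congrArg (dC E f x : E →L[ℝ] ℂ) (mfderiv_symm_chart_apply hx w).symm

lemma exists_ball_subset_chart {W : Set M} (hW : IsOpen W) {x : M} (hx : x ∈ W) :
    ∃ r > 0, Metric.ball (chartAt E x x) r ⊆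
      (chartAt E x).target ∩ (chartAt E x).symm ⁻¹' W := by
  refine Metric.isOpen_iff.1 ((chartAt E x).isOpen_inter_preimage_symm hW) _ ?_
  exact ⟨mem_chart_target E x, by simpa using hx⟩

/-- In a ball of the chart at `x`, which is convex, the function has zero derivative and so is
constant. Applied to ratios of flat frames and to differences `f - δh`, this produces locally
constant transition functions. -/
lemma eventuallyEq_of_dC_eq_zero {f : M → ℂ} {W : Set M} (hW : IsOpen W)
    (hf : ∀ x ∈ W, MDifferentiableAt 𝓘(ℝ, E) 𝓘(ℝ, ℂ) f x) (h0 : ∀ x ∈ W, dC E f x = 0)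
    {x : M} (hx : x ∈ W) : ∀ᶠ y in 𝓝 x, f y = f x := by
  obtain ⟨r, hr, hrW⟩ := exists_ball_subset_chart (E := E) hW hx
  have hd : ∀ y ∈ Metric.ball (chartAt E x x) r,
      HasFDerivAt (f ∘ (chartAt E x).symm) (0 : E →L[ℝ] ℂ) y := by
    intro y hy
    have hs := (chartAt E x).map_target (hrW hy).1
    have := hasFDerivAt_comp_symm hs (hf _ (hrW hy).2)
    rw [(chartAt E x).right_inv (hrW hy).1, h0 _ (hrW hy).2] at this
    exact this
  have hev : ∀ᶠ y in 𝓝 x, y ∈ (chartAt E x).source ∧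
      chartAt E x y ∈ Metric.ball (chartAt E x x) r :=
    Filter.Eventually.and ((chartAt E x).open_source.mem_nhds (mem_chart_source E x))
      (((chartAt E x).continuousAt (mem_chart_source E x)).eventually
        (Metric.ball_mem_nhds _ hr))
  filter_upwards [hev] with y hy
  have := (convex_ball (chartAt E x x) r).is_const_of_fderivWithin_eq_zero (𝕜 := ℝ)
    (f := f ∘ (chartAt E x).symm)
    (fun z hz => (hd z hz).differentiableAt.differentiableWithinAt)
    (fun z hz => by
      rw [fderivWithin_of_isOpen Metric.isOpen_ball hz, (hd z hz).fderiv])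
    hy.2 (Metric.mem_ball_self hr)
  simpa [(chartAt E x).left_inv hy.1, (chartAt E x).left_inv (mem_chart_source E x)] using this

/-- The expression in the chart at `x₀` of a family of linear forms on the tangent spaces. -/
def chartOneForm (A : ∀ x : M, TangentSpace 𝓘(ℝ, E) x →L[ℝ] ℂ) (x₀ : M) (y : E) : E →L[ℝ] ℂ :=
  (A ((chartAt E x₀).symm y) : E →L[ℝ] ℂ) ∘L
    (mfderiv 𝓘(ℝ, E) 𝓘(ℝ, E) (chartAt E x₀).symm y : E →L[ℝ] E)

lemma chartOneForm_apply_mfderiv (A : ∀ x : M, TangentSpace 𝓘(ℝ, E) x →L[ℝ] ℂ) {x₀ x : M}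
    (hx : x ∈ (chartAt E x₀).source) (w : TangentSpace 𝓘(ℝ, E) x) :
    chartOneForm A x₀ (chartAt E x₀ x) (mfderiv 𝓘(ℝ, E) 𝓘(ℝ, E) (chartAt E x₀) x w) = A x w := by
  let A' : M → E →L[ℝ] ℂ := A
  change A' ((chartAt E x₀).symm (chartAt E x₀ x)) _ = A' x w
  rw [(chartAt E x₀).left_inv hx]
  exact congrArg (A' x) (mfderiv_symm_chart_apply hx w)

/-- The Poincaré lemma for closed imaginary one-forms. -/
theorem exists_primitive {A : ∀ x : M, TangentSpace 𝓘(ℝ, E) x →L[ℝ] ℂ} {W : Set M}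
    (hW : IsOpen W) {x : M} (hx : x ∈ W)
    (hA : ContDiffOn ℝ ∞ (chartOneForm A x)
      ((chartAt E x).target ∩ (chartAt E x).symm ⁻¹' W))
    (hs : ∀ y ∈ (chartAt E x).target ∩ (chartAt E x).symm ⁻¹' W, ∀ v w : E,
      fderiv ℝ (chartOneForm A x) y v w = fderiv ℝ (chartOneForm A x) y w v)
    (hre : ∀ z ∈ W, ∀ w, (A z w).re = 0) :
    ∃ V : Set M, IsOpen V ∧ x ∈ V ∧ V ⊆ W ∧ ∃ h : M → ℂ,
      ContMDiffOn 𝓘(ℝ, E) 𝓘(ℝ, ℂ) ∞ h V ∧ (∀ z, (h z).re = 0) ∧ ∀ z ∈ V, dC E h z = A z := by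
  obtain ⟨r, hr, hrW⟩ := exists_ball_subset_chart (E := E) hW hx
  set B := Metric.ball (chartAt E x x) r
  set S := (chartAt E x).target ∩ (chartAt E x).symm ⁻¹' W
  have hSo : IsOpen S := (chartAt E x).isOpen_inter_preimage_symm hW
  obtain ⟨H, hH⟩ := (convex_ball (chartAt E x x) r).exists_forall_hasFDerivAt_of_fderiv_symmetric
    Metric.isOpen_ball ((hA.differentiableOn (by simp)).mono hrW) fun y hy => hs y (hrW hy)
  -- The form has imaginary values, so the imaginary part of `H` carries all of its derivative.
  -- Keeping only that part makes the primitive imaginary everywhere, not only on the ball.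
  set H' : E → ℂ := fun y => ((H y).im : ℂ) * Complex.I
  have hre' : ∀ y ∈ B, ∀ v, (chartOneForm A x y v).re = 0 := fun y hy v => hre _ (hrW hy).2 _
  have hH' : ∀ y ∈ B, HasFDerivAt H' (chartOneForm A x y) y := by
    intro y hy
    have h1 := ((Complex.ofRealCLM.comp Complex.imCLM).hasFDerivAt.comp y (hH y hy)).mul_const
      Complex.I
    refine h1.congr_fderiv ?_
    ext v
    apply Complex.ext <;> simp [hre' y hy v]
  have hH's : ContDiffOn ℝ ∞ H' B := by
    -- The derivative is the given smooth form, so the primitive is smooth.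
    rw [contDiffOn_infty_iff_fderiv_of_isOpen Metric.isOpen_ball]
    refine ⟨fun y hy => (hH' y hy).differentiableAt.differentiableWithinAt, ?_⟩
    exact (hA.mono hrW).congr fun y hy => (hH' y hy).fderiv
  have hVo : IsOpen ((chartAt E x).source ∩ chartAt E x ⁻¹' B) :=
    (chartAt E x).isOpen_inter_preimage Metric.isOpen_ball
  refine ⟨(chartAt E x).source ∩ chartAt E x ⁻¹' B, hVo,
    ⟨mem_chart_source E x, Metric.mem_ball_self hr⟩, fun z hz => ?_, H' ∘ chartAt E x, ?_, ?_, ?_⟩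
  · have := (hrW hz.2).2
    rwa [Set.mem_preimage, (chartAt E x).left_inv hz.1] at this
  · refine ContMDiffOn.comp (t := B) hH's.contMDiffOn
      ((contMDiffOn_chart (I := 𝓘(ℝ, E)) (x := x)).mono Set.inter_subset_left)
      Set.inter_subset_right
  · intro z
    simp [H']
  · intro z hz
    have hd1 : MDifferentiableAt 𝓘(ℝ, E) 𝓘(ℝ, E) (chartAt E x) z :=
      mdifferentiableAt_atlas (chart_mem_atlas E x) hz.1
    have h := HasMFDerivAt.dC_eq ((hH' _ hz.2).hasMFDerivAt.comp z hd1.hasMFDerivAt)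
    ext w
    refine (congrArg (fun L : E →L[ℝ] ℂ => L w) h).trans ?_
    exact chartOneForm_apply_mfderiv A hz.1 w

end Charts

/-! ### Forms of degree zero and one as functions and linear forms -/

section Forms

/-- A `1`-form at a point as a linear form. -/
def oneForm {x : M} (η : FormAt E 1 x) : TangentSpace 𝓘(ℝ, E) x →L[ℝ] ℂ :=
  (ContinuousAlternatingMap.ofSubsingleton ℝ (TangentSpace 𝓘(ℝ, E) x) ℂ (0 : Fin 1)).symm η

lemma oneForm_apply {x : M} (η : FormAt E 1 x) (w : TangentSpace 𝓘(ℝ, E) x) :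
    oneForm η w = η fun _ => w := rfl

lemma oneForm_injective {x : M} : Function.Injective (oneForm (E := E) (x := x)) :=
  Equiv.injective _

lemma oneForm_add {x : M} (η θ : FormAt E 1 x) : oneForm (η + θ) = oneForm η + oneForm θ := rfl

lemma oneForm_sub {x : M} (η θ : FormAt E 1 x) : oneForm (η - θ) = oneForm η - oneForm θ := rfl

variable [IsManifold 𝓘(ℝ, E) ∞ M]

lemma mdifferentiableAt_of_chartRep {α : ∀ x : M, FormAt E 0 x} {x : M}
    (hα : ContDiffAt ℝ ∞ (chartRep x α) (chartAt E x x)) :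
    ContMDiffAt 𝓘(ℝ, E) 𝓘(ℝ, ℂ) ∞ (fun y => α y ![]) x := by
  have h1 : ContDiffAt ℝ ∞ (fun y => chartRep x α y ![]) (chartAt E x x) :=
    (ContinuousAlternatingMap.apply ℝ E ℂ ![]).contDiff.contDiffAt.comp _ hα
  have h2 : ContMDiffAt 𝓘(ℝ, E) 𝓘(ℝ, E) ∞ (chartAt E x) x :=
    contMDiffOn_chart.contMDiffAt ((chartAt E x).open_source.mem_nhds (mem_chart_source E x))
  refine (h1.contMDiffAt.comp x h2).congr_of_eventuallyEq ?_
  filter_upwards [(chartAt E x).open_source.mem_nhds (mem_chart_source E x)] with y hy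
  let A : M → E [⋀^Fin 0]→L[ℝ] ℂ := α
  change A y ![] = A ((chartAt E x).symm (chartAt E x y)) (fun i => _)
  rw [(chartAt E x).left_inv hy]
  exact congrArg (A y) (Subsingleton.elim _ _)

/-- In degree zero the alternating sum that defines `extDeriv` has one term, so `extD` and `dC` have
the same expression in the chart. -/
lemma oneForm_extD {α : ∀ x : M, FormAt E 0 x} {x : M}
    (hα : ContDiffAt ℝ ∞ (chartRep x α) (chartAt E x x)) :
    oneForm (extD α x) = dC E (fun y => α y ![]) x := by
  ext w
  rw [dC_chart (mem_chart_source E x)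
    ((mdifferentiableAt_of_chartRep hα).mdifferentiableAt (by simp)) w, oneForm_apply]
  change extDeriv (chartRep x α) (chartAt E x x) (fun _ => _) = _
  rw [extDeriv_apply (hα.differentiableAt (by simp))]
  simp only [Nat.reduceAdd, Fin.sum_univ_one, Fin.isValue, Fin.val_zero, pow_zero, one_smul]
  congr 2
  funext y
  exact congrArg (α ((chartAt E x).symm y)) (Subsingleton.elim _ _)

lemma chartOneForm_oneForm (A : ∀ x : M, FormAt E 1 x) (x₀ : M) (y : E) (v : E) :
    chartOneForm (fun x => oneForm (A x)) x₀ y v = chartRep x₀ A y fun _ => v := rfl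

lemma chartOneForm_oneForm_eq (A : ∀ x : M, FormAt E 1 x) (x₀ : M) :
    chartOneForm (fun x => oneForm (A x)) x₀ =
      fun y => (ContinuousAlternatingMap.ofSubsingletonLIE (𝕜 := ℝ) (E := E)
        (F := ℂ) (0 : Fin 1)).symm
        (chartRep x₀ A y) := rfl

/-- Closed imaginary `1`-forms have local primitives. -/
theorem exists_primitive_of_extD_eq_zero {A : ∀ x : M, FormAt E 1 x} {W : Set M}
    (hW : IsOpen W) {x : M} (hx : x ∈ W) (hA : SmoothFormOn A W)
    (hd : ∀ z ∈ W, extD A z = 0) (hre : ∀ z ∈ W, ∀ w, (A z w).re = 0) :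
    ∃ V : Set M, IsOpen V ∧ x ∈ V ∧ V ⊆ W ∧ ∃ h : M → ℂ,
      ContMDiffOn 𝓘(ℝ, E) 𝓘(ℝ, ℂ) ∞ h V ∧ (∀ z, (h z).re = 0) ∧
        ∀ z ∈ V, dC E h z = oneForm (A z) := by
  refine exists_primitive hW hx (A := fun x => oneForm (A x)) ?_ ?_ fun z hz w => hre z hz _
  · rw [chartOneForm_oneForm_eq]
    exact (ContinuousAlternatingMap.ofSubsingletonLIE (𝕜 := ℝ) (E := E)
        (F := ℂ) (0 : Fin 1)).symm.contDiff.comp_contDiffOn (hA x)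
  · intro y hy v w
    have hdiff : DifferentiableAt ℝ (chartRep x A) y :=
      ((hA x).contDiffAt (((chartAt E x).isOpen_inter_preimage_symm hW).mem_nhds hy)).differentiableAt
        (by simp)
    -- At each point `extD` is computed in the chart preferred at that point; `extDeriv_chartRep`
    -- moves its vanishing to the fixed chart at `x`.
    have h0 : extDeriv (chartRep x A) y = 0 := by
      have hs := (chartAt E x).map_target hy.1
      have := extDeriv_chartRep A hs (hA.contDiffAt hW (mem_chart_source E _) hy.2)
      rw [(chartAt E x).right_inv hy.1] at this
      rw [this]
      change (extD A ((chartAt E x).symm y)).compContinuousLinearMap _ = 0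
      rw [hd _ hy.2]
      rfl
    -- Evaluated at `(v, w)`, the exterior derivative is the antisymmetrised derivative, so
    -- closedness is the symmetry that `exists_primitive` asks for.
    have h1 := congrArg (fun η => η ![v, w]) h0
    simp only [extDeriv_apply hdiff] at h1
    change ∑ i : Fin 2, _ = (0 : ℂ) at h1
    rw [Fin.sum_univ_two] at h1
    have hd' : DifferentiableAt ℝ (chartOneForm (fun x => oneForm (A x)) x) y := by
      rw [chartOneForm_oneForm_eq]
      exact (ContinuousAlternatingMap.ofSubsingletonLIE (𝕜 := ℝ) (E := E)
        (F := ℂ) (0 : Fin 1)).symm.differentiable.differentiableAt.comp y hdiff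
    have h2 : ∀ a b : E, fderiv ℝ (chartOneForm (fun x => oneForm (A x)) x) y a b =
        fderiv ℝ (fun z => chartRep x A z fun _ => b) y a := by
      intro a b
      have := (hd'.hasFDerivAt.clm_apply (hasFDerivAt_const b y)).fderiv
      simp only [chartOneForm_oneForm] at this
      rw [this]
      simp
    rw [h2, h2]
    have e0 : (0 : Fin 2).removeNth ![v, w] = fun _ => w := by
      funext i; fin_cases i; rfl
    have e1 : (1 : Fin 2).removeNth ![v, w] = fun _ => v := by
      funext i; fin_cases i; rfl
    rw [e0, e1] at h1
    simpa [sub_eq_zero, ← sub_eq_add_neg] using h1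

end Forms
end

/-! ### Vector fields in charts -/

section
section Fields
variable {E : Type v} [NormedAddCommGroup E] [NormedSpace ℝ E]
  {M : Type u} [TopologicalSpace M] [ChartedSpace E M] [IsManifold 𝓘(ℝ, E) ∞ M]

open VectorField

lemma isInvertible_mfderiv_chart {x₀ x : M} (hx : x ∈ (chartAt E x₀).source) :
    (mfderiv 𝓘(ℝ, E) 𝓘(ℝ, E) (chartAt E x₀) x).IsInvertible :=
  isInvertible_mfderiv_extChartAt (I := 𝓘(ℝ, E)) (by simpa using hx)

lemma isInvertible_mfderiv_chart_symm {x₀ x : M} (hx : x ∈ (chartAt E x₀).source) :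
    (mfderiv 𝓘(ℝ, E) 𝓘(ℝ, E) (chartAt E x₀).symm (chartAt E x₀ x)).IsInvertible := by
  have h := isInvertible_mfderivWithin_extChartAt_symm (I := 𝓘(ℝ, E)) (x := x₀)
    (y := chartAt E x₀ x) (by simpa using (chartAt E x₀).map_source hx)
  simp only [modelWithCornersSelf_coe, Set.range_id, mfderivWithin_univ] at h
  exact h

/-- The expression of a vector field in the chart at `x₀`. -/
def chartField (X : ∀ x : M, TangentSpace 𝓘(ℝ, E) x) (x₀ : M) (y : E) : E :=
  let L : E →L[ℝ] E := mfderiv 𝓘(ℝ, E) 𝓘(ℝ, E) (chartAt E x₀).symm y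
  L.inverse (X ((chartAt E x₀).symm y))

lemma mfderiv_symm_chartField (X : ∀ x : M, TangentSpace 𝓘(ℝ, E) x) {x₀ x : M}
    (hx : x ∈ (chartAt E x₀).source) :
    (mfderiv 𝓘(ℝ, E) 𝓘(ℝ, E) (chartAt E x₀).symm (chartAt E x₀ x) : E →L[ℝ] E)
      (chartField (E := E) X x₀ (chartAt E x₀ x)) = (X x : E) := by
  let X' : M → E := X
  change _ = X' x
  have h := (isInvertible_mfderiv_chart_symm hx).self_comp_inverse
  refine (congrArg (fun L : E →L[ℝ] E => L (X' ((chartAt E x₀).symm (chartAt E x₀ x)))) h).trans ?_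
  change X' _ = _
  rw [(chartAt E x₀).left_inv hx]

lemma mfderiv_chart_field (X : ∀ x : M, TangentSpace 𝓘(ℝ, E) x) {x₀ x : M}
    (hx : x ∈ (chartAt E x₀).source) :
    (mfderiv 𝓘(ℝ, E) 𝓘(ℝ, E) (chartAt E x₀) x : E →L[ℝ] E) (X x) =
      chartField X x₀ (chartAt E x₀ x) := by
  have h := mfderiv_symm_chartField X hx
  refine (congrArg (mfderiv 𝓘(ℝ, E) 𝓘(ℝ, E) (chartAt E x₀) x : E →L[ℝ] E) h.symm).trans ?_
  exact mfderiv_chart_symm_apply hx _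

lemma dC_apply_field {f : M → ℂ} (X : ∀ x : M, TangentSpace 𝓘(ℝ, E) x) {x₀ x : M}
    (hx : x ∈ (chartAt E x₀).source) (hf : MDifferentiableAt 𝓘(ℝ, E) 𝓘(ℝ, ℂ) f x) :
    dC E f x (X x) = fderiv ℝ (f ∘ (chartAt E x₀).symm) (chartAt E x₀ x)
      (chartField X x₀ (chartAt E x₀ x)) := by
  rw [dC_chart hx hf, ← mfderiv_chart_field X hx]

variable [CompleteSpace E]

lemma differentiableAt_chartField {X : ∀ x : M, TangentSpace 𝓘(ℝ, E) x} {x : M}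
    (hX : MDifferentiableAt 𝓘(ℝ, E) (𝓘(ℝ, E).prod 𝓘(ℝ, E))
      (fun x => Bundle.TotalSpace.mk' E x (X x)) x) :
    DifferentiableAt ℝ (chartField X x) (chartAt E x x) := by
  have : IsManifold 𝓘(ℝ, E) 2 M := IsManifold.of_le (n := ∞) ENat.LEInfty.out
  have h := MDifferentiableWithinAt.differentiableWithinAt_mpullbackWithin_vectorField
    (s := Set.univ) (V := X) hX.mdifferentiableWithinAt
  simp only [Set.preimage_univ, modelWithCornersSelf_coe, Set.range_id, Set.inter_univ] at h
  have e : mpullbackWithin 𝓘(ℝ, E) 𝓘(ℝ, E) (extChartAt 𝓘(ℝ, E) x).symm X Set.univ =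
      chartField X x := by
    funext y
    rw [mpullbackWithin_apply, mfderivWithin_univ]
    rfl
  rw [e] at h
  exact (show DifferentiableWithinAt ℝ (F := E) (chartField X x) Set.univ _ from
    h).differentiableAt Filter.univ_mem

/-- By definition the bracket is the model-space bracket of the chart expressions, carried back by
the inverse of the differential of the chart; applying that differential undoes the last step. -/
lemma mlieBracket_chart (X Y : ∀ x : M, TangentSpace 𝓘(ℝ, E) x) (x : M) :
    (mfderiv 𝓘(ℝ, E) 𝓘(ℝ, E) (chartAt E x) x : E →L[ℝ] E) (mlieBracket 𝓘(ℝ, E) X Y x) =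
      lieBracket ℝ (chartField X x) (chartField Y x) (chartAt E x x) := by
  have e : ∀ X : ∀ x : M, TangentSpace 𝓘(ℝ, E) x,
      mpullbackWithin 𝓘(ℝ, E) 𝓘(ℝ, E) (extChartAt 𝓘(ℝ, E) x).symm X Set.univ =
      chartField X x := by
    intro X
    funext y
    rw [mpullbackWithin_apply, mfderivWithin_univ]
    rfl
  rw [← mlieBracketWithin_univ, mlieBracketWithin_apply]
  simp only [Set.preimage_univ, Set.univ_inter, modelWithCornersSelf_coe, Set.range_id, e]
  rw [lieBracketWithin_univ]
  exact congrArg (fun L : E →L[ℝ] E => L _)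
    (isInvertible_mfderiv_chart (mem_chart_source E x)).self_comp_inverse

/-- The action of a vector field on functions: `X (Y f) - Y (X f) = [X, Y] f`. -/
theorem dC_mlieBracket {f : M → ℂ} {W : Set M} (hW : IsOpen W)
    (hf : ContMDiffOn 𝓘(ℝ, E) 𝓘(ℝ, ℂ) ∞ f W) {X Y : ∀ x : M, TangentSpace 𝓘(ℝ, E) x} {x : M}
    (hx : x ∈ W)
    (hX : MDifferentiableAt 𝓘(ℝ, E) (𝓘(ℝ, E).prod 𝓘(ℝ, E))
      (fun x => Bundle.TotalSpace.mk' E x (X x)) x)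
    (hY : MDifferentiableAt 𝓘(ℝ, E) (𝓘(ℝ, E).prod 𝓘(ℝ, E))
      (fun x => Bundle.TotalSpace.mk' E x (Y x)) x) :
    dC E (fun y => dC E f y (Y y)) x (X x) - dC E (fun y => dC E f y (X y)) x (Y x) =
      dC E f x (mlieBracket 𝓘(ℝ, E) X Y x) := by
  set φ := chartAt E x with hφ
  have hs := mem_chart_source E x
  set F := f ∘ φ.symm with hF
  have hfd : ∀ y ∈ W, MDifferentiableAt 𝓘(ℝ, E) 𝓘(ℝ, ℂ) f y := fun y hy =>
    (hf.contMDiffAt (hW.mem_nhds hy)).mdifferentiableAt (by simp)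
  have hFs : ContDiffAt ℝ ∞ F (φ x) := by
    rw [← contMDiffAt_iff_contDiffAt]
    have h0 : ContMDiffAt 𝓘(ℝ, E) 𝓘(ℝ, E) ∞ φ.symm (φ x) :=
      contMDiffOn_chart_symm.contMDiffAt (φ.open_target.mem_nhds (φ.map_source hs))
    refine ContMDiffAt.comp _ ?_ h0
    rw [φ.left_inv hs]
    exact hf.contMDiffAt (hW.mem_nhds hx)
  have hF' : DifferentiableAt ℝ (fderiv ℝ F) (φ x) :=
    (hFs.fderiv_right (m := 1) (by exact_mod_cast (ENat.LEInfty.out : (2 : ℕ∞ω) ≤ ∞))).differentiableAt (by simp)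
  -- The product rule in the chart: `U (V f) = DF (DV · U) + D²F (U, V)`.
  have key : ∀ (V U : ∀ x : M, TangentSpace 𝓘(ℝ, E) x),
      MDifferentiableAt 𝓘(ℝ, E) (𝓘(ℝ, E).prod 𝓘(ℝ, E))
        (fun x => Bundle.TotalSpace.mk' E x (V x)) x →
      dC E (fun y => dC E f y (V y)) x (U x) =
        fderiv ℝ F (φ x) (fderiv ℝ (chartField V x) (φ x) (chartField U x (φ x))) +
        fderiv ℝ (fderiv ℝ F) (φ x) (chartField U x (φ x)) (chartField V x (φ x)) := by
    intro V U hV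
    have hG := hF'.hasFDerivAt.clm_apply (differentiableAt_chartField hV).hasFDerivAt
    have hd1 : MDifferentiableAt 𝓘(ℝ, E) 𝓘(ℝ, E) φ x :=
      mdifferentiableAt_atlas (chart_mem_atlas E x) hs
    have h1 := HasMFDerivAt.dC_eq (hG.hasMFDerivAt.comp x hd1.hasMFDerivAt)
    have h2 : (fun y => dC E f y (V y)) =ᶠ[𝓝 x]
        (fun y => (fderiv ℝ F y) (chartField V x y)) ∘ φ := by
      filter_upwards [hW.mem_nhds hx, φ.open_source.mem_nhds hs] with y hy hys
      exact dC_apply_field V hys (hfd y hy)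
    rw [dC_congr h2]
    refine (congrArg (fun L : E →L[ℝ] ℂ => L (U x)) h1).trans ?_
    exact congrArg (fun e : E => fderiv ℝ F (φ x) (fderiv ℝ (chartField V x) (φ x) e) +
      fderiv ℝ (fderiv ℝ F) (φ x) e (chartField V x (φ x))) (mfderiv_chart_field U hs)
  rw [key Y X hY, key X Y hX, dC_chart hs (hfd x hx)]
  have hb := mlieBracket_chart X Y x
  refine Eq.trans ?_ (congrArg (fderiv ℝ F (φ x)) hb).symm
  -- The second-order terms of the two iterated derivatives cancel by symmetry, leaving `DF` applied
  -- to the bracket.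
  have hsymm : IsSymmSndFDerivAt ℝ F (φ x) :=
    hFs.isSymmSndFDerivAt (by simp [ENat.LEInfty.out])
  rw [lieBracket, map_sub, hsymm.eq]
  ring

/-- A constant vector field on the model space. -/
def constField (v : E) (y : E) : TangentSpace 𝓘(ℝ, E) y := v

lemma contMDiff_constField (v : E) : ContMDiff 𝓘(ℝ, E) (𝓘(ℝ, E).prod 𝓘(ℝ, E)) ∞
    fun y : E => Bundle.TotalSpace.mk' E y (constField v y) := by
  intro y
  rw [Bundle.contMDiffAt_section]
  have h : (fun x => (trivializationAt E (TangentSpace 𝓘(ℝ, E)) y ⟨x, constField v x⟩).2) =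
      fun _ => v := by
    funext x
    simp [constField]
  rw [h]
  exact contMDiffAt_const

/-- The vector field which is constant in the chart at `x₀`. -/
def coordField (x₀ : M) (v : E) : ∀ x : M, TangentSpace 𝓘(ℝ, E) x :=
  mpullback 𝓘(ℝ, E) 𝓘(ℝ, E) (chartAt E x₀) (constField v)

omit [CompleteSpace E] in
lemma coordField_apply {x₀ x : M} (hx : x ∈ (chartAt E x₀).source) (v : E) :
    coordField x₀ v x =
      (mfderiv 𝓘(ℝ, E) 𝓘(ℝ, E) (chartAt E x₀).symm (chartAt E x₀ x) : E →L[ℝ] E) v := by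
  have h := mfderiv_chart_symm_apply hx v
  have h2 := (isInvertible_mfderiv_chart hx).inverse_comp_self
  refine (congrArg (mfderiv 𝓘(ℝ, E) 𝓘(ℝ, E) (chartAt E x₀) x).inverse h.symm).trans ?_
  exact congrArg (fun L : E →L[ℝ] E => L _) h2

lemma contMDiffOn_coordField (x₀ : M) (v : E) :
    ContMDiffOn 𝓘(ℝ, E) (𝓘(ℝ, E).prod 𝓘(ℝ, E)) ∞
      (fun x => Bundle.TotalSpace.mk' E x (coordField x₀ v x)) (chartAt E x₀).source := by
  intro x hx
  refine ContMDiffAt.contMDiffWithinAt ?_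
  exact (contMDiff_constField v _).mpullback_vectorField_preimage (f := chartAt E x₀) (n := ∞)
    (contMDiffOn_chart.contMDiffAt ((chartAt E x₀).open_source.mem_nhds hx))
    (isInvertible_mfderiv_chart hx) (by simp)

/-- The bracket commutes with pullback, and constant fields on the model space have zero bracket.
Testing flatness on these fields removes the bracket term from the curvature. -/
lemma mlieBracket_coordField {x₀ x : M} (hx : x ∈ (chartAt E x₀).source) (v w : E) :
    mlieBracket 𝓘(ℝ, E) (coordField x₀ v) (coordField x₀ w) x = 0 := by
  have hV : ∀ v : E, MDifferentiableAt 𝓘(ℝ, E) (𝓘(ℝ, E).prod 𝓘(ℝ, E))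
      (fun y : E => Bundle.TotalSpace.mk' E y (constField v y)) (chartAt E x₀ x) :=
    fun v => (contMDiff_constField v _).mdifferentiableAt (by simp)
  have : IsManifold 𝓘(ℝ, E) (minSmoothness ℝ 2) M :=
    IsManifold.of_le (n := ∞) (by simp [ENat.LEInfty.out])
  have h := mpullback_mlieBracket (f := chartAt E x₀) (n := ∞) (hV v) (hV w)
    (contMDiffOn_chart.contMDiffAt ((chartAt E x₀).open_source.mem_nhds hx))
    (by simp [ENat.LEInfty.out])
  rw [coordField, coordField, ← h, mpullback_apply]
  have h0 : mlieBracket 𝓘(ℝ, E) (constField v) (constField w) (chartAt E x₀ x) = 0 := by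
    rw [← mlieBracketWithin_univ, mlieBracketWithin_eq_lieBracketWithin]
    change lieBracketWithin ℝ (fun _ : E => v) (fun _ : E => w) Set.univ _ = 0
    simp [lieBracket]
  exact (congrArg _ h0).trans (map_zero _)

end Fields
end

/-! ### Global extensions of germs of sections -/

section Cutoff
variable {E : Type v} [NormedAddCommGroup E] [NormedSpace ℝ E] [FiniteDimensional ℝ E]
  {M : Type u} [TopologicalSpace M] [T2Space M] [ChartedSpace E M] [IsManifold 𝓘(ℝ, E) ∞ M]

/-- A local smooth section of a vector bundle agrees near any point with a global one. -/
lemma exists_contMDiff_section_eq {F : Type*} [NormedAddCommGroup F] [NormedSpace ℝ F]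
    {V : M → Type*} [TopologicalSpace (TotalSpace F V)] [∀ x, TopologicalSpace (V x)]
    [FiberBundle F V] [∀ x, AddCommGroup (V x)] [∀ x, Module ℝ (V x)] [VectorBundle ℝ F V]
    {s : ∀ x, V x} {W : Set M} (hW : IsOpen W) {x : M} (hx : x ∈ W)
    (hs : ContMDiffOn 𝓘(ℝ, E) (𝓘(ℝ, E).prod 𝓘(ℝ, F)) ∞ (fun y => TotalSpace.mk' F y (s y)) W) :
    ∃ t : ∀ x, V x, ContMDiff 𝓘(ℝ, E) (𝓘(ℝ, E).prod 𝓘(ℝ, F)) ∞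
      (fun y => TotalSpace.mk' F y (t y)) ∧ ∀ᶠ y in 𝓝 x, t y = s y := by
  obtain ⟨ψ, -, hψ⟩ := (SmoothBumpFunction.nhds_basis_tsupport (I := 𝓘(ℝ, E)) x).mem_iff.1
    (hW.mem_nhds hx)
  refine ⟨(ψ : M → ℝ) • s, ContMDiffOn.smul_section_of_tsupport ψ.contMDiff.contMDiffOn hW hψ hs,
    ?_⟩
  filter_upwards [ψ.eventuallyEq_one] with y hy
  simp [hy]

end Cutoff

section Mul
variable {EN : Type*} [NormedAddCommGroup EN] [NormedSpace ℝ EN] {HN : Type*} [TopologicalSpace HN]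
  {IN : ModelWithCorners ℝ EN HN} {N : Type*} [TopologicalSpace N] [ChartedSpace HN N]

lemma contMDiffAt_complex_mul {a b : N → ℂ} {n : N} (ha : ContMDiffAt IN 𝓘(ℝ, ℂ) ∞ a n)
    (hb : ContMDiffAt IN 𝓘(ℝ, ℂ) ∞ b n) : ContMDiffAt IN 𝓘(ℝ, ℂ) ∞ (fun x => a x * b x) n :=
  (contDiff_mul (𝕜 := ℝ) (𝔸 := ℂ)).contMDiff.contMDiffAt.comp n (ha.prodMk_space hb)

end Mul

/-! ### Local sections of a line bundle and the Real structure -/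

section Local
variable {E : Type v} [NormedAddCommGroup E] [NormedSpace ℝ E]
  {M : Type u} [TopologicalSpace M] [ChartedSpace E M] {τ : SmoothInvolution E M}

/-- Smooth sections over a subset. -/
def RealLineBundle.SmoothOn (L : RealLineBundle τ) (s : ∀ x, L.Fiber x) (W : Set M) : Prop :=
  ContMDiffOn 𝓘(ℝ, E) (𝓘(ℝ, E).prod 𝓘(ℝ, ℂ)) ∞ (fun y => TotalSpace.mk' ℂ y (s y)) W

namespace RealLineBundle

variable {L : RealLineBundle τ}

lemma SmoothOn.mono {s : ∀ x, L.Fiber x} {W V : Set M} (h : L.SmoothOn s W) (hV : V ⊆ W) :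
    L.SmoothOn s V := ContMDiffOn.mono h hV

lemma SmoothOn.contMDiffAt {s : ∀ x, L.Fiber x} {W : Set M} (hW : IsOpen W) (h : L.SmoothOn s W)
    {x : M} (hx : x ∈ W) :
    ContMDiffAt 𝓘(ℝ, E) (𝓘(ℝ, E).prod 𝓘(ℝ, ℂ)) ∞ (fun y => TotalSpace.mk' ℂ y (s y)) x :=
  ContMDiffOn.contMDiffAt h (hW.mem_nhds hx)

lemma SmoothOn.mdifferentiableAt {s : ∀ x, L.Fiber x} {W : Set M} (hW : IsOpen W)
    (h : L.SmoothOn s W) {x : M} (hx : x ∈ W) :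
    MDifferentiableAt 𝓘(ℝ, E) (𝓘(ℝ, E).prod 𝓘(ℝ, ℂ)) (fun y => TotalSpace.mk' ℂ y (s y)) x :=
  (h.contMDiffAt hW hx).mdifferentiableAt (by simp)

/-- The value of a vector in a trivialization around `x₀`. -/
def coord (L : RealLineBundle τ) (x₀ : M) (e : TotalSpace ℂ L.Fiber) : ℂ :=
  (trivializationAt ℂ L.Fiber x₀ e).2

lemma coord_smul {x₀ x : M} (hx : x ∈ (trivializationAt ℂ L.Fiber x₀).baseSet) (c : ℂ)
    (u : L.Fiber x) : L.coord x₀ ⟨x, c • u⟩ = c * L.coord x₀ ⟨x, u⟩ :=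
  ((trivializationAt ℂ L.Fiber x₀).linear ℂ hx).map_smul c u

lemma coord_injective {x₀ x : M} (hx : x ∈ (trivializationAt ℂ L.Fiber x₀).baseSet)
    {u u' : L.Fiber x} (h : L.coord x₀ ⟨x, u⟩ = L.coord x₀ ⟨x, u'⟩) : u = u' :=
  ((trivializationAt ℂ L.Fiber x₀).linearEquivAt ℂ x hx).injective h

lemma eventually_mem_baseSet (L : RealLineBundle τ) (x₀ : M) :
    ∀ᶠ x in 𝓝 x₀, x ∈ (trivializationAt ℂ L.Fiber x₀).baseSet :=
  (trivializationAt ℂ L.Fiber x₀).open_baseSet.mem_nhds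
    (FiberBundle.mem_baseSet_trivializationAt ℂ L.Fiber x₀)

/-- Vectors in a fibre are multiples of any nonzero vector. -/
lemma exists_smul_eq {x : M} {e : L.Fiber x} (he : e ≠ 0) (u : L.Fiber x) : ∃ c : ℂ, u = c • e := by
  have hx := FiberBundle.mem_baseSet_trivializationAt ℂ L.Fiber x
  have h0 : L.coord x ⟨x, e⟩ ≠ 0 := by
    intro h
    refine he (coord_injective hx ?_)
    rw [h]
    have := coord_smul hx 0 e
    rw [zero_smul, zero_mul] at this
    exact this.symm
  refine ⟨L.coord x ⟨x, u⟩ / L.coord x ⟨x, e⟩, coord_injective hx ?_⟩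
  rw [coord_smul hx, div_mul_cancel₀ _ h0]

lemma ne_zero_of_herm_eq_one {x : M} {e : L.Fiber x} (he : L.herm x e e = 1) : e ≠ 0 := by
  rintro rfl
  simp at he

/-- Fibres are lines and the metric is linear in its second variable, so pairing with a unit vector
reads off the coefficient along it. -/
lemma eq_herm_smul {x : M} {e : L.Fiber x} (he : L.herm x e e = 1) (u : L.Fiber x) :
    u = L.herm x e u • e := by
  obtain ⟨c, rfl⟩ := exists_smul_eq (ne_zero_of_herm_eq_one he) u
  simp [he]

section General

variable {EN : Type*} [NormedAddCommGroup EN] [NormedSpace ℝ EN] {HN : Type*} [TopologicalSpace HN]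
  {IN : ModelWithCorners ℝ EN HN} {N : Type*} [TopologicalSpace N] [ChartedSpace HN N]

lemma contMDiffAt_smul_section {b : N → M} {a : N → ℂ} {s : ∀ x, L.Fiber x} {n₀ : N}
    (hb : ContMDiffAt IN 𝓘(ℝ, E) ∞ b n₀) (ha : ContMDiffAt IN 𝓘(ℝ, ℂ) ∞ a n₀)
    (hs : ContMDiffAt 𝓘(ℝ, E) (𝓘(ℝ, E).prod 𝓘(ℝ, ℂ)) ∞
      (fun y => TotalSpace.mk' ℂ y (s y)) (b n₀)) :
    ContMDiffAt IN (𝓘(ℝ, E).prod 𝓘(ℝ, ℂ)) ∞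
      (fun n => TotalSpace.mk' ℂ (b n) (a n • s (b n))) n₀ := by
  rw [Bundle.contMDiffAt_totalSpace]
  refine ⟨hb, ?_⟩
  have h1 : ContMDiffAt IN 𝓘(ℝ, ℂ) ∞ (fun n => L.coord (b n₀) ⟨b n, s (b n)⟩) n₀ :=
    ContMDiffAt.comp (g := fun x => L.coord (b n₀) ⟨x, s x⟩) n₀
      ((Bundle.contMDiffAt_section _).1 hs) hb
  refine (contMDiffAt_complex_mul ha h1).congr_of_eventuallyEq ?_
  filter_upwards [hb.continuousAt.eventually (L.eventually_mem_baseSet (b n₀))] with n hn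
  exact coord_smul hn _ _

/-- The field `herm_smooth` concerns sections over `M`, whereas `f` here starts from any manifold,
in particular from the total space. The coefficient is therefore obtained as a quotient of two
coordinates in a trivialization. -/
lemma contMDiffAt_coeff {f : N → TotalSpace ℂ L.Fiber} {e : ∀ x, L.Fiber x} {W : Set M} {n₀ : N}
    (hW : IsOpen W) (he : L.SmoothOn e W) (hu : ∀ x ∈ W, L.herm x (e x) (e x) = 1)
    (hf : ContMDiffAt IN (𝓘(ℝ, E).prod 𝓘(ℝ, ℂ)) ∞ f n₀) (hn : (f n₀).proj ∈ W) :
    ContMDiffAt IN 𝓘(ℝ, ℂ) ∞ (fun n => L.herm (f n).proj (e (f n).proj) (f n).snd) n₀ := by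
  rw [Bundle.contMDiffAt_totalSpace] at hf
  set x₀ := (f n₀).proj
  have h1 : ContMDiffAt IN 𝓘(ℝ, ℂ) ∞ (fun n => L.coord x₀ ⟨(f n).proj, e (f n).proj⟩) n₀ :=
    ContMDiffAt.comp (g := fun x => L.coord x₀ ⟨x, e x⟩) n₀
      ((Bundle.contMDiffAt_section _).1 (he.contMDiffAt hW hn)) hf.1
  have hx₀ := FiberBundle.mem_baseSet_trivializationAt ℂ L.Fiber x₀
  have hne : ∀ x ∈ (trivializationAt ℂ L.Fiber x₀).baseSet, x ∈ W →
      L.coord x₀ ⟨x, e x⟩ ≠ 0 := by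
    intro x hx hxW h
    refine ne_zero_of_herm_eq_one (hu x hxW) (coord_injective hx ?_)
    have := coord_smul hx 0 (e x)
    rw [zero_smul, zero_mul] at this
    rw [h, this]
  have h2 : ContMDiffAt IN 𝓘(ℝ, ℂ) ∞
      (fun n => (L.coord x₀ ⟨(f n).proj, e (f n).proj⟩)⁻¹) n₀ :=
    (contDiffAt_inv ℝ (hne _ hx₀ hn)).contMDiffAt.comp n₀ h1
  refine (contMDiffAt_complex_mul hf.2 h2).congr_of_eventuallyEq ?_
  filter_upwards [hf.1.continuousAt.eventually (L.eventually_mem_baseSet x₀),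
    hf.1.continuousAt.eventually (hW.mem_nhds hn)] with n hb hnW
  change _ = L.coord x₀ (f n) * _
  have h3 : L.coord x₀ (f n) = L.herm (f n).proj (e (f n).proj) (f n).snd *
      L.coord x₀ ⟨(f n).proj, e (f n).proj⟩ := by
    rw [← coord_smul hb, ← eq_herm_smul (hu _ hnW)]
  rw [h3, mul_assoc, mul_inv_cancel₀ (hne _ hb hnW), mul_one]

end General

lemma SmoothOn.smul {s : ∀ x, L.Fiber x} {W : Set M} (hW : IsOpen W) (hs : L.SmoothOn s W)
    {a : M → ℂ} (ha : ContMDiffOn 𝓘(ℝ, E) 𝓘(ℝ, ℂ) ∞ a W) :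
    L.SmoothOn (fun x => a x • s x) W := fun x hx =>
  (contMDiffAt_smul_section contMDiffAt_id (ha.contMDiffAt (hW.mem_nhds hx))
    (hs.contMDiffAt hW hx)).contMDiffWithinAt

/-- The involution of the total space. -/
def totalInv (L : RealLineBundle τ) (e : TotalSpace ℂ L.Fiber) : TotalSpace ℂ L.Fiber :=
  TotalSpace.mk' ℂ (τ e.proj) (L.σ e.proj e.snd)

/-- The conjugate section `σ ∘ s ∘ τ`. -/
def conjSec (L : RealLineBundle τ) (s : ∀ x, L.Fiber x) (x : M) : L.Fiber x :=
  cast (congrArg L.Fiber (τ.involutive x)) (L.σ (τ x) (s (τ x)))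

/-- In the total space the transport along `τ (τ x) = x` becomes an equality of points, so
smoothness of the conjugate section follows from that of `σ`. -/
lemma mk_conjSec (s : ∀ x, L.Fiber x) (x : M) :
    TotalSpace.mk' ℂ x (L.conjSec s x) = L.totalInv (TotalSpace.mk' ℂ (τ x) (s (τ x))) := by
  have key : ∀ (y : M) (h : y = x) (u : L.Fiber y),
      TotalSpace.mk' ℂ x (cast (congrArg L.Fiber h) u) = TotalSpace.mk' ℂ y u := by
    rintro y rfl u
    rfl
  exact key _ (τ.involutive x) _

lemma conjSec_apply_inv (s : ∀ x, L.Fiber x) (x : M) :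
    L.conjSec s (τ x) = L.σ x (s x) := by
  have h := L.mk_conjSec s (τ x)
  rw [τ.involutive x] at h
  exact TotalSpace.mk_injective _ h

lemma σ_conjSec (s : ∀ x, L.Fiber x) (x : M) : L.σ x (L.conjSec s x) = s (τ x) := by
  have h := congrArg L.totalInv (L.mk_conjSec s x)
  rw [show L.totalInv (L.totalInv (TotalSpace.mk' ℂ (τ x) (s (τ x)))) = _ from
    L.σ_involutive _] at h
  exact TotalSpace.mk_injective _ h

lemma SmoothOn.conjSec {s : ∀ x, L.Fiber x} {W : Set M} (hs : L.SmoothOn s W) :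
    L.SmoothOn (L.conjSec s) (τ ⁻¹' W) := by
  have h : ContMDiffOn 𝓘(ℝ, E) (𝓘(ℝ, E).prod 𝓘(ℝ, ℂ)) ∞
      (fun x => L.totalInv (TotalSpace.mk' ℂ (τ x) (s (τ x)))) (τ ⁻¹' W) :=
    L.σ_smooth.comp_contMDiffOn (ContMDiffOn.comp hs τ.contMDiff.contMDiffOn fun _ h => h)
  exact h.congr fun x _ => L.mk_conjSec s x

lemma smoothOn_univ {s : ∀ x, L.Fiber x} : L.SmoothOn s Set.univ ↔ SmoothSection (E := E) s :=
  contMDiffOn_univ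

lemma herm_conjSec (s t : ∀ x, L.Fiber x) (x : M) :
    L.herm (τ x) (L.conjSec s (τ x)) (L.conjSec t (τ x)) = conj (L.herm x (s x) (t x)) := by
  rw [conjSec_apply_inv, conjSec_apply_inv, L.herm_σ]

end RealLineBundle

/-- Differentiating `τ ∘ τ = id` shows that the differential of `τ` at `τ x` is a right inverse of
the one at `x`. -/
lemma SmoothInvolution.surjective_mfderiv (τ : SmoothInvolution E M) (x : M)
    (w : TangentSpace 𝓘(ℝ, E) (τ x)) : ∃ w', mfderiv 𝓘(ℝ, E) 𝓘(ℝ, E) τ x w' = w := by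
  have hd : ∀ y, MDifferentiableAt 𝓘(ℝ, E) 𝓘(ℝ, E) τ y := fun y =>
    (τ.contMDiff y).mdifferentiableAt (by simp)
  have h := mfderiv_comp (τ x) (hd _) (hd (τ x))
  have h1 : (τ ∘ τ : M → M) = id := τ.involutive.comp_self
  rw [h1, mfderiv_id] at h
  let T : M → E →L[ℝ] E := fun y => mfderiv 𝓘(ℝ, E) 𝓘(ℝ, E) τ y
  refine ⟨T (τ x) w, ?_⟩
  have h2 : T (τ (τ x)) (T (τ x) w) = w := (congrArg (fun L : E →L[ℝ] E => L w) h).symm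
  rwa [τ.involutive x] at h2

end Local

/-! ### Local calculus of a Real connection -/

section Connection
variable {E : Type v} [NormedAddCommGroup E] [NormedSpace ℝ E] [FiniteDimensional ℝ E]
  {M : Type u} [TopologicalSpace M] [T2Space M] [ChartedSpace E M] [IsManifold 𝓘(ℝ, E) ∞ M]
  {τ : SmoothInvolution E M}

namespace RealLineBundle

variable {L : RealLineBundle τ}

lemma SmoothOn.exists_global {s : ∀ x, L.Fiber x} {W : Set M} (hW : IsOpen W)
    (hs : L.SmoothOn s W) {x : M} (hx : x ∈ W) :
    ∃ t : ∀ x, L.Fiber x, SmoothSection (E := E) t ∧ ∀ᶠ y in 𝓝 x, t y = s y :=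
  exists_contMDiff_section_eq hW hx hs

lemma SmoothOn.herm {s t : ∀ x, L.Fiber x} {W : Set M} (hW : IsOpen W) (hs : L.SmoothOn s W)
    (ht : L.SmoothOn t W) : ContMDiffOn 𝓘(ℝ, E) 𝓘(ℝ, ℂ) ∞ (fun x => L.herm x (s x) (t x)) W := by
  intro x hx
  obtain ⟨s', hs', hss⟩ := hs.exists_global hW hx
  obtain ⟨t', ht', htt⟩ := ht.exists_global hW hx
  refine ContMDiffAt.contMDiffWithinAt ((L.herm_smooth s' t' hs' ht' x).congr_of_eventuallyEq ?_)
  filter_upwards [hss, htt] with y h1 h2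
  rw [h1, h2]

end RealLineBundle

namespace RealConnection

variable {L : RealLineBundle τ} (D : RealConnection L) {W : Set M} (hW : IsOpen W)

/-- A covariant derivative depends only on the germ of the section. Together with `exists_global`
this carries the axioms of `RealConnection`, stated for global sections, over to sections on an open
set. -/
lemma cov_congr {s t : ∀ x, L.Fiber x} {x : M}
    (hs : MDifferentiableAt 𝓘(ℝ, E) (𝓘(ℝ, E).prod 𝓘(ℝ, ℂ)) (fun y => TotalSpace.mk' ℂ y (s y)) x)
    (h : ∀ᶠ y in 𝓝 x, s y = t y) : D.cov s x = D.cov t x := by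
  refine D.cov.isCovariantDerivativeOnUniv.congr_of_eventuallyEq hs ?_ Filter.univ_mem h
  refine hs.congr_of_eventuallyEq ?_
  filter_upwards [h] with y hy
  rw [hy]

include hW

lemma cov_const_smul (c : ℂ) {s : ∀ x, L.Fiber x} (hs : L.SmoothOn s W) {x : M} (hx : x ∈ W)
    (w : TangentSpace 𝓘(ℝ, E) x) : D.cov (fun y => c • s y) x w = c • D.cov s x w := by
  obtain ⟨t, ht, hts⟩ := hs.exists_global hW hx
  rw [← D.cov_congr ((ht x).mdifferentiableAt (by simp)) hts, ← D.map_smul c t ht x w]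
  refine congrArg (fun A : TangentSpace 𝓘(ℝ, E) x →L[ℝ] L.Fiber x => A w) ?_
  refine D.cov_congr ((hs.smul hW (a := fun _ => c) contMDiffOn_const).mdifferentiableAt hW hx) ?_
  filter_upwards [hts] with y hy
  change _ = c • t y
  rw [hy]

/-- The Leibniz rule of a covariant derivative has real coefficient functions. Writing `a = Re a + i
Im a` and pulling out the constant `i` by `cov_const_smul` gives the complex rule. -/
lemma cov_smul {a : M → ℂ} (ha : ContMDiffOn 𝓘(ℝ, E) 𝓘(ℝ, ℂ) ∞ a W) {s : ∀ x, L.Fiber x}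
    (hs : L.SmoothOn s W) {x : M} (hx : x ∈ W) (w : TangentSpace 𝓘(ℝ, E) x) :
    D.cov (fun y => a y • s y) x w = a x • D.cov s x w + dC E a x w • s x := by
  have hre : ContMDiffOn 𝓘(ℝ, E) 𝓘(ℝ, ℝ) ∞ (fun y => (a y).re) W :=
    Complex.reCLM.contDiff.contMDiff.comp_contMDiffOn ha
  have him : ContMDiffOn 𝓘(ℝ, E) 𝓘(ℝ, ℝ) ∞ (fun y => (a y).im) W :=
    Complex.imCLM.contDiff.contMDiff.comp_contMDiffOn ha
  have hofre : ContMDiffOn 𝓘(ℝ, E) 𝓘(ℝ, ℂ) ∞ (fun y => ((a y).re : ℂ)) W :=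
    Complex.ofRealCLM.contDiff.contMDiff.comp_contMDiffOn hre
  have hofim : ContMDiffOn 𝓘(ℝ, E) 𝓘(ℝ, ℂ) ∞ (fun y => ((a y).im : ℂ)) W :=
    Complex.ofRealCLM.contDiff.contMDiff.comp_contMDiffOn him
  have hIs : L.SmoothOn (fun y => Complex.I • s y) W :=
    hs.smul hW (a := fun _ => Complex.I) contMDiffOn_const
  have e1 : (fun y => a y • s y) = (((fun y => (a y).re) : M → ℝ) • s +
      ((fun y => (a y).im) : M → ℝ) • fun y => Complex.I • s y : ∀ y, L.Fiber y) := by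
    funext y
    change _ = ((a y).re : ℂ) • s y + ((a y).im : ℂ) • (Complex.I • s y)
    rw [smul_smul, ← add_smul, Complex.re_add_im]
  have d1 : MDifferentiableAt 𝓘(ℝ, E) (𝓘(ℝ, E).prod 𝓘(ℝ, ℂ)) (fun y => TotalSpace.mk' ℂ y
      ((((fun y => (a y).re) : M → ℝ) • s : ∀ y, L.Fiber y) y)) x :=
    (hs.smul hW hofre).mdifferentiableAt hW hx
  have d2 : MDifferentiableAt 𝓘(ℝ, E) (𝓘(ℝ, E).prod 𝓘(ℝ, ℂ)) (fun y => TotalSpace.mk' ℂ y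
      ((((fun y => (a y).im) : M → ℝ) • fun y => Complex.I • s y : ∀ y, L.Fiber y) y)) x :=
    (hIs.smul hW hofim).mdifferentiableAt hW hx
  have hm : MDifferentiableAt 𝓘(ℝ, E) 𝓘(ℝ, ℂ) a x :=
    (ha.contMDiffAt (hW.mem_nhds hx)).mdifferentiableAt (by simp)
  have hr' := (hre.contMDiffAt (hW.mem_nhds hx)).mdifferentiableAt (by simp)
  have hi' := (him.contMDiffAt (hW.mem_nhds hx)).mdifferentiableAt (by simp)
  have r1 : mvfderiv 𝓘(ℝ, E) (fun y => (a y).re) x w = (dC E a x w).re :=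
    congrArg (fun A : E →L[ℝ] ℝ => A w)
      (Complex.reCLM.hasFDerivAt.hasMFDerivAt.comp x hm.hasMFDerivAt).mfderiv
  have r2 : mvfderiv 𝓘(ℝ, E) (fun y => (a y).im) x w = (dC E a x w).im :=
    congrArg (fun A : E →L[ℝ] ℝ => A w)
      (Complex.imCLM.hasFDerivAt.hasMFDerivAt.comp x hm.hasMFDerivAt).mfderiv
  rw [e1, D.cov.isCovariantDerivativeOnUniv.add d1 d2,
    D.cov.isCovariantDerivativeOnUniv.leibniz (hs.mdifferentiableAt hW hx) hr',
    D.cov.isCovariantDerivativeOnUniv.leibniz (hIs.mdifferentiableAt hW hx) hi']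
  have hI := D.cov_const_smul hW Complex.I hs hx w
  change ((a x).re : ℂ) • D.cov s x w + ((mvfderiv 𝓘(ℝ, E) (fun y => (a y).re) x w : ℝ) : ℂ) • s x
    + (((a x).im : ℂ) • D.cov (fun y => Complex.I • s y) x w +
      ((mvfderiv 𝓘(ℝ, E) (fun y => (a y).im) x w : ℝ) : ℂ) • (Complex.I • s x)) = _
  rw [hI, r1, r2, smul_smul, smul_smul, add_add_add_comm, ← add_smul, ← add_smul,
    Complex.re_add_im, Complex.re_add_im]

lemma dC_herm {s t : ∀ x, L.Fiber x} (hs : L.SmoothOn s W) (ht : L.SmoothOn t W) {x : M}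
    (hx : x ∈ W) (w : TangentSpace 𝓘(ℝ, E) x) :
    dC E (fun y => L.herm y (s y) (t y)) x w =
      L.herm x (D.cov s x w) (t x) + L.herm x (s x) (D.cov t x w) := by
  obtain ⟨s', hs', hss⟩ := hs.exists_global hW hx
  obtain ⟨t', ht', htt⟩ := ht.exists_global hW hx
  have h := D.metric s' t' hs' ht' x w
  rw [D.cov_congr ((hs' x).mdifferentiableAt (by simp)) hss,
    D.cov_congr ((ht' x).mdifferentiableAt (by simp)) htt, hss.self_of_nhds,
    htt.self_of_nhds] at h
  rw [← h]
  have : (fun y => L.herm y (s y) (t y)) =ᶠ[𝓝 x] fun y => L.herm y (s' y) (t' y) := by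
    filter_upwards [hss, htt] with y h1 h2
    rw [h1, h2]
  rw [dC_congr this]
  rfl

lemma cov_conjSec {s : ∀ x, L.Fiber x} (hs : L.SmoothOn s W) {x : M} (hx : x ∈ W)
    (w : TangentSpace 𝓘(ℝ, E) x) :
    D.cov (L.conjSec s) (τ x) (mfderiv 𝓘(ℝ, E) 𝓘(ℝ, E) τ x w) = L.σ x (D.cov s x w) := by
  obtain ⟨t, ht, hts⟩ := hs.exists_global hW hx
  have hct : SmoothSection (E := E) (L.conjSec t) := by
    have := (RealLineBundle.smoothOn_univ.2 ht).conjSec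
    rw [Set.preimage_univ] at this
    exact RealLineBundle.smoothOn_univ.1 this
  rw [← D.cov_congr ((ht x).mdifferentiableAt (by simp)) hts,
    ← D.real t (L.conjSec t) ht hct (fun y => L.conjSec_apply_inv t y) x w]
  refine congrArg (fun A : TangentSpace 𝓘(ℝ, E) (τ x) →L[ℝ] L.Fiber (τ x) => A _) ?_
  refine (D.cov_congr ((hct (τ x)).mdifferentiableAt (by simp)) ?_).symm
  have hc : Filter.Tendsto τ (𝓝 (τ x)) (𝓝 x) := by
    have := τ.contMDiff.continuous.continuousAt (x := τ x)
    rwa [ContinuousAt, τ.involutive x] at this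
  filter_upwards [hc.eventually hts] with y hy
  simp only [RealLineBundle.conjSec, hy]

/-- Compatibility with `σ` controls the derivative only in directions in the image of the
differential of `τ`; by `surjective_mfderiv` these are all directions. -/
lemma cov_zero_of_eq_zero_conjSec {s : ∀ x, L.Fiber x} (hs : L.SmoothOn s W)
    (h0 : ∀ x ∈ W, D.cov s x = 0) {x : M} (hx : x ∈ W) : D.cov (L.conjSec s) (τ x) = 0 := by
  ext w
  obtain ⟨w', rfl⟩ := τ.surjective_mfderiv x w
  rw [D.cov_conjSec hW hs hx, h0 x hx]
  simp

end RealConnection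

namespace FlatRealLineBundle

variable (L : FlatRealLineBundle τ)

/-- `e` is a smooth flat section of length one over `W`. -/
structure IsFlatFrame (e : ∀ x, L.Fiber x) (W : Set M) : Prop where
  smooth : L.SmoothOn e W
  unit : ∀ x ∈ W, L.herm x (e x) (e x) = 1
  flat : ∀ x ∈ W, L.conn.cov e x = 0

variable {L}

namespace IsFlatFrame

variable {e e' : ∀ x, L.Fiber x} {W V : Set M}

omit [FiniteDimensional ℝ E] [T2Space M] in
lemma mono (h : L.IsFlatFrame e W) (hV : V ⊆ W) : L.IsFlatFrame e V :=
  ⟨h.smooth.mono hV, fun x hx => h.unit x (hV hx), fun x hx => h.flat x (hV hx)⟩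

lemma conjSec (h : L.IsFlatFrame e W) (hW : IsOpen W) :
    L.IsFlatFrame (L.conjSec e) (τ ⁻¹' W) where
  smooth := h.smooth.conjSec
  unit x hx := by
    have := L.herm_conjSec e e (τ x)
    rw [τ.involutive x, h.unit _ hx] at this
    simpa using this
  flat x hx := by
    have := L.conn.cov_zero_of_eq_zero_conjSec hW h.smooth h.flat hx
    rwa [τ.involutive x] at this

/-- The coefficient of one flat frame with respect to another is locally constant. -/
lemma eventually_herm_eq (h : L.IsFlatFrame e W) (h' : L.IsFlatFrame e' W) (hW : IsOpen W) {x : M}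
    (hx : x ∈ W) : ∀ᶠ y in 𝓝 x, L.herm y (e y) (e' y) = L.herm x (e x) (e' x) := by
  refine eventuallyEq_of_dC_eq_zero (E := E) hW (fun z hz =>
    ((h.smooth.herm hW h'.smooth).contMDiffAt (hW.mem_nhds hz)).mdifferentiableAt (by simp))
    (fun z hz => ?_) hx
  ext w
  rw [L.conn.dC_herm hW h.smooth h'.smooth hz, h.flat z hz, h'.flat z hz]
  simp

omit [FiniteDimensional ℝ E] [T2Space M] in
lemma norm_herm (h : L.IsFlatFrame e W) (h' : L.IsFlatFrame e' W) {x : M} (hx : x ∈ W) :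
    ‖L.herm x (e x) (e' x)‖ = 1 := by
  have h1 := h'.unit x hx
  rw [RealLineBundle.eq_herm_smul (h.unit x hx) (e' x)] at h1
  simp only [map_smulₛₗ, LinearMap.smul_apply, RingHom.id_apply, h.unit x hx, smul_eq_mul, mul_one] at h1
  rw [Complex.mul_conj'] at h1
  have h2 : ‖L.herm x (e x) (e' x)‖ ^ 2 = 1 := by exact_mod_cast h1
  exact (pow_eq_one_iff_of_nonneg (norm_nonneg _) two_ne_zero).1 h2

/-- A locally constant multiple of length one of a flat frame is a flat frame. -/
lemma smul (h : L.IsFlatFrame e W) (hW : IsOpen W) {a : M → ℂ}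
    (ha : ∀ x ∈ W, ∀ᶠ y in 𝓝 x, a y = a x) (hn : ∀ x ∈ W, ‖a x‖ = 1) :
    L.IsFlatFrame (fun x => a x • e x) W where
  smooth := h.smooth.smul hW fun x hx =>
    (contMDiffAt_const.congr_of_eventuallyEq (ha x hx)).contMDiffWithinAt
  unit x hx := by
    simp only [map_smulₛₗ, LinearMap.smul_apply, RingHom.id_apply, h.unit x hx, smul_eq_mul, mul_one]
    rw [Complex.mul_conj', hn x hx]
    simp
  flat x hx := by
    have hs : ContMDiffOn 𝓘(ℝ, E) 𝓘(ℝ, ℂ) ∞ a W := fun x hx =>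
      (contMDiffAt_const.congr_of_eventuallyEq (ha x hx)).contMDiffWithinAt
    ext w
    rw [L.conn.cov_smul hW hs h.smooth hx, h.flat x hx, dC_congr (ha x hx), dC_const]
    simp

/-- The covariant derivative in terms of a flat frame. -/
lemma cov_eq (h : L.IsFlatFrame e W) (hW : IsOpen W) {s : ∀ x, L.Fiber x} (hs : L.SmoothOn s W)
    {x : M} (hx : x ∈ W) (w : TangentSpace 𝓘(ℝ, E) x) :
    L.conn.cov s x w = dC E (fun y => L.herm y (e y) (s y)) x w • e x := by
  have ha := h.smooth.herm hW hs
  have h1 := L.conn.cov_smul hW ha h.smooth hx w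
  rw [h.flat x hx] at h1
  rw [show dC E (fun y => L.herm y (e y) (s y)) x w • e x = _ by simpa using h1.symm]
  refine congrArg (fun A : TangentSpace 𝓘(ℝ, E) x →L[ℝ] L.Fiber x => A w) ?_
  refine L.conn.cov_congr (hs.mdifferentiableAt hW hx) ?_
  filter_upwards [hW.mem_nhds hx] with y hy
  exact RealLineBundle.eq_herm_smul (h.unit y hy) (s y)

end IsFlatFrame

end FlatRealLineBundle
end Connection

/-! ### Existence of flat frames -/

section Frames
variable {E : Type v} [NormedAddCommGroup E] [NormedSpace ℝ E] [FiniteDimensional ℝ E]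
  {M : Type u} [TopologicalSpace M] [T2Space M] [ChartedSpace E M] [IsManifold 𝓘(ℝ, E) ∞ M]
  {τ : SmoothInvolution E M}

lemma contMDiffOn_cexp_comp {h : M → ℂ} {W : Set M} (hh : ContMDiffOn 𝓘(ℝ, E) 𝓘(ℝ, ℂ) ∞ h W) :
    ContMDiffOn 𝓘(ℝ, E) 𝓘(ℝ, ℂ) ∞ (fun x => Complex.exp (h x)) W :=
  (Complex.contDiff_exp (𝕜 := ℝ)).contMDiff.comp_contMDiffOn hh

lemma dC_cexp {h : M → ℂ} {x : M} (hh : MDifferentiableAt 𝓘(ℝ, E) 𝓘(ℝ, ℂ) h x)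
    (w : TangentSpace 𝓘(ℝ, E) x) :
    dC E (fun y => Complex.exp (h y)) x w = Complex.exp (h x) * dC E h x w := by
  rw [dC_comp (G := Complex.exp)
    ((Complex.hasDerivAt_exp (h x)).hasFDerivAt.restrictScalars ℝ) hh]
  simp [mul_comm]

namespace RealLineBundle

variable (L : RealLineBundle τ)

/-- Every point has a neighbourhood with a smooth section of length one. -/
lemma exists_unit_section (x : M) : ∃ (W : Set M) (s : ∀ x, L.Fiber x), IsOpen W ∧ x ∈ W ∧
    L.SmoothOn s W ∧ ∀ y ∈ W, L.herm y (s y) (s y) = 1 := by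
  set t := trivializationAt ℂ L.Fiber x
  have hx := FiberBundle.mem_baseSet_trivializationAt ℂ L.Fiber x
  have hc : ∀ y ∈ t.baseSet, L.coord x ⟨y, t.symm y 1⟩ = 1 := by
    intro y hy
    change (t ⟨y, t.symm y 1⟩).2 = 1
    rw [t.apply_mk_symm hy]
  have hs : L.SmoothOn (fun y => t.symm y 1) t.baseSet := by
    refine (t.contMDiffOn_section_baseSet_iff).2 ?_
    exact contMDiffOn_const.congr hc
  have h0 : ∀ y ∈ t.baseSet, t.symm y 1 ≠ 0 := by
    intro y hy h
    have h1 := hc y hy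
    have := coord_smul hy 0 (t.symm y 1)
    rw [zero_smul, zero_mul, ← h, h1] at this
    exact one_ne_zero this
  have hH := hs.herm t.open_baseSet hs
  have hpos : ∀ y ∈ t.baseSet, 0 < (L.herm y (t.symm y 1) (t.symm y 1)).re := fun y hy =>
    L.herm_pos y _ (h0 y hy)
  set N : M → ℝ := fun y => (Real.sqrt (L.herm y (t.symm y 1) (t.symm y 1)).re)⁻¹
  have hN : ContMDiffOn 𝓘(ℝ, E) 𝓘(ℝ, ℂ) ∞ (fun y => (N y : ℂ)) t.baseSet := by
    intro y hy
    have h1 : ContMDiffWithinAt 𝓘(ℝ, E) 𝓘(ℝ, ℝ) ∞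
        (fun y => (L.herm y (t.symm y 1) (t.symm y 1)).re) t.baseSet y :=
      Complex.reCLM.contDiff.contMDiff.contMDiffAt.comp_contMDiffWithinAt y (hH y hy)
    have h2 : ContDiffAt ℝ ∞ (fun r : ℝ => (((Real.sqrt r)⁻¹ : ℝ) : ℂ))
        (L.herm y (t.symm y 1) (t.symm y 1)).re :=
      Complex.ofRealCLM.contDiff.contDiffAt.comp _
        ((Real.contDiffAt_sqrt (hpos y hy).ne').inv (Real.sqrt_pos.2 (hpos y hy)).ne')
    exact h2.contMDiffAt.comp_contMDiffWithinAt y h1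
  refine ⟨t.baseSet, fun y => (N y : ℂ) • t.symm y 1, t.open_baseSet, hx,
    hs.smul t.open_baseSet hN, fun y hy => ?_⟩
  have him : L.herm y (t.symm y 1) (t.symm y 1) =
      ((L.herm y (t.symm y 1) (t.symm y 1)).re : ℂ) :=
    (Complex.conj_eq_iff_re.1 (L.herm_symm y _ _).symm).symm
  simp only [map_smulₛₗ, LinearMap.smul_apply, RingHom.id_apply, smul_eq_mul, Complex.conj_ofReal]
  have h2 := Real.mul_self_sqrt (hpos y hy).le
  have h3 := (Real.sqrt_pos.2 (hpos y hy)).ne'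
  rw [him, ← Complex.ofReal_mul, ← Complex.ofReal_mul, Complex.ofReal_eq_one]
  simp only [N]
  field_simp
  rw [sq, h2]

end RealLineBundle

namespace RealConnection

variable {L : RealLineBundle τ} (D : RealConnection L)

/-- The connection form with respect to the section `s`. -/
def form (s : ∀ x, L.Fiber x) (x : M) : TangentSpace 𝓘(ℝ, E) x →L[ℝ] ℂ :=
  let F : E →ₗ[ℝ] ℂ := ((L.herm x (s x)).restrictScalars ℝ).comp (D.cov s x).toLinearMap
  F.toContinuousLinearMap

omit [T2Space M] in
lemma form_apply (s : ∀ x, L.Fiber x) (x : M) (w : TangentSpace 𝓘(ℝ, E) x) :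
    D.form s x w = L.herm x (s x) (D.cov s x w) := rfl

lemma contMDiff_cov_apply {s : ∀ x, L.Fiber x} (hs : SmoothSection (E := E) s)
    {X : ∀ x : M, TangentSpace 𝓘(ℝ, E) x} (hX : SmoothField X) :
    SmoothSection (E := E) fun x => D.cov s x (X x) := by
  intro x
  have h := D.smooth.contMDiff.contMDiff (σ := s) (by
    rw [contMDiffOn_univ]
    exact hs)
  exact ((h x (Set.mem_univ x)).contMDiffAt Filter.univ_mem).clm_bundle_apply (hX x)

variable {W : Set M} (hW : IsOpen W) {s : ∀ x, L.Fiber x} (hs : L.SmoothOn s W)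
  (hu : ∀ y ∈ W, L.herm y (s y) (s y) = 1)

-- Differentiating `h(s, s) = 1` gives `a + conj a = 0` for every value `a` of the connection form.
include hW hs in
lemma re_form (hu : ∀ y ∈ W, L.herm y (s y) (s y) = 1) {x : M} (hx : x ∈ W)
    (w : TangentSpace 𝓘(ℝ, E) x) : (D.form s x w).re = 0 := by
  have h := D.dC_herm hW hs hs hx w
  have h1 : (fun y => L.herm y (s y) (s y)) =ᶠ[𝓝 x] fun _ => 1 := by
    filter_upwards [hW.mem_nhds hx] with y hy
    exact hu y hy
  rw [dC_congr h1, dC_const, L.herm_symm x (s x) (D.cov s x w), ← form_apply] at h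
  have := congrArg Complex.re h
  simp at this
  linarith

include hW hs in
/-- Local fields and sections may be replaced by global ones to compute second derivatives. -/
lemma exists_global_field {x : M} (hx : x ∈ W) {X : ∀ x : M, TangentSpace 𝓘(ℝ, E) x}
    (hX : ContMDiffOn 𝓘(ℝ, E) (𝓘(ℝ, E).prod 𝓘(ℝ, E)) ∞ (fun y => TotalSpace.mk' E y (X y)) W) :
    ∃ (t : ∀ x, L.Fiber x) (X' : ∀ x : M, TangentSpace 𝓘(ℝ, E) x), SmoothSection (E := E) t ∧
      SmoothField X' ∧ (∀ᶠ y in 𝓝 x, t y = s y) ∧ (∀ᶠ y in 𝓝 x, X' y = X y) ∧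
      ∀ᶠ y in 𝓝 x, D.cov t y (X' y) = D.cov s y (X y) := by
  obtain ⟨t, ht, hts⟩ := hs.exists_global hW hx
  obtain ⟨X', hX', hXX⟩ := exists_contMDiff_section_eq hW hx hX
  refine ⟨t, X', ht, hX', hts, hXX, ?_⟩
  filter_upwards [hts.eventually_nhds, hXX] with y h1 h2
  rw [D.cov_congr ((ht y).mdifferentiableAt (by simp)) h1, h2]

include hW hs in
lemma contMDiffOn_form_apply {X : ∀ x : M, TangentSpace 𝓘(ℝ, E) x}
    (hX : ContMDiffOn 𝓘(ℝ, E) (𝓘(ℝ, E).prod 𝓘(ℝ, E)) ∞ (fun y => TotalSpace.mk' E y (X y)) W) :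
    ContMDiffOn 𝓘(ℝ, E) 𝓘(ℝ, ℂ) ∞ (fun y => D.form s y (X y)) W := by
  intro x hx
  obtain ⟨t, X', ht, hX', hts, -, hc⟩ := D.exists_global_field hW hs hx hX
  refine ContMDiffAt.contMDiffWithinAt
    ((L.herm_smooth t _ ht (D.contMDiff_cov_apply ht hX') x).congr_of_eventuallyEq ?_)
  filter_upwards [hts, hc] with y h1 h2
  rw [form_apply, h1, h2]

include hW hs hu in
/-- The connection form of a flat connection is closed. -/
lemma dC_form_symm (hD : D.IsFlat) {X Y : ∀ x : M, TangentSpace 𝓘(ℝ, E) x}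
    (hX : ContMDiffOn 𝓘(ℝ, E) (𝓘(ℝ, E).prod 𝓘(ℝ, E)) ∞ (fun y => TotalSpace.mk' E y (X y)) W)
    (hY : ContMDiffOn 𝓘(ℝ, E) (𝓘(ℝ, E).prod 𝓘(ℝ, E)) ∞ (fun y => TotalSpace.mk' E y (Y y)) W)
    {x : M} (hx : x ∈ W) (hXY : VectorField.mlieBracket 𝓘(ℝ, E) X Y x = 0) :
    dC E (fun y => D.form s y (Y y)) x (X x) = dC E (fun y => D.form s y (X y)) x (Y x) := by
  obtain ⟨t, ht, hts⟩ := hs.exists_global hW hx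
  obtain ⟨X', hX', hXX⟩ := exists_contMDiff_section_eq hW hx hX
  obtain ⟨Y', hY', hYY⟩ := exists_contMDiff_section_eq hW hx hY
  have h := hD X' Y' hX' hY' t ht x
  -- In rank one, `∇_U ∇_Z s = (A(Z) A(U) + U(A(Z))) s`, where `A` is the connection form. The
  -- quadratic term is symmetric in `Z` and `U`, so for fields with vanishing bracket the curvature
  -- is the antisymmetrised derivative of `A`. The primed fields and `t` are global because flatness
  -- is stated for global objects.
  have key : ∀ (Z Z' U : ∀ x : M, TangentSpace 𝓘(ℝ, E) x), SmoothField Z' →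
      (∀ᶠ y in 𝓝 x, Z' y = Z y) →
      ContMDiffOn 𝓘(ℝ, E) (𝓘(ℝ, E).prod 𝓘(ℝ, E)) ∞ (fun y => TotalSpace.mk' E y (Z y)) W →
      D.cov (fun y => D.cov t y (Z' y)) x (U x) =
        (D.form s x (Z x) * D.form s x (U x) + dC E (fun y => D.form s y (Z y)) x (U x)) • s x := by
    intro Z Z' U hZ' hZZ hZ
    have e1 : ∀ᶠ y in 𝓝 x, D.cov t y (Z' y) = D.form s y (Z y) • s y := by
      filter_upwards [hts.eventually_nhds, hZZ, hW.mem_nhds hx] with y h1 h2 hy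
      rw [D.cov_congr ((ht y).mdifferentiableAt (by simp)) h1, h2, form_apply]
      exact RealLineBundle.eq_herm_smul (hu y hy) _
    rw [D.cov_congr ((D.contMDiff_cov_apply ht hZ' x).mdifferentiableAt (by simp)) e1,
      D.cov_smul hW (D.contMDiffOn_form_apply hW hs hZ) hs hx, add_smul, mul_smul]
    congr 2
    rw [form_apply]
    exact RealLineBundle.eq_herm_smul (hu x hx) _
  have hb : VectorField.mlieBracket 𝓘(ℝ, E) X' Y' x = 0 := by
    rw [Filter.EventuallyEq.mlieBracket_vectorField_eq hXX hYY, hXY]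
  rw [curvature, hb, map_zero, sub_zero, key Y Y' X' hY' hYY hY, key X X' Y' hX' hXX hX,
    hXX.self_of_nhds, hYY.self_of_nhds, ← sub_smul] at h
  have hne := RealLineBundle.ne_zero_of_herm_eq_one (hu x hx)
  have h0 := congrArg (L.herm x (s x)) h
  rw [LinearMap.map_smul, hu x hx, map_zero, smul_eq_mul, mul_one] at h0
  linear_combination h0

end RealConnection

namespace FlatRealLineBundle

variable (L : FlatRealLineBundle τ)

/-- Flat frames exist locally. -/
theorem exists_isFlatFrame (x : M) : ∃ (V : Set M) (e : ∀ x, L.Fiber x), IsOpen V ∧ x ∈ V ∧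
    L.IsFlatFrame e V := by
  have : CompleteSpace E := FiniteDimensional.complete ℝ E
  obtain ⟨W₀, s, hW₀, hx₀, hs₀, hu₀⟩ := L.exists_unit_section x
  set φ := chartAt E x with hφ
  set W := φ.source ∩ W₀
  have hW : IsOpen W := φ.open_source.inter hW₀
  have hx : x ∈ W := ⟨mem_chart_source E x, hx₀⟩
  have hs : L.SmoothOn s W := hs₀.mono Set.inter_subset_right
  have hu : ∀ y ∈ W, L.herm y (s y) (s y) = 1 := fun y hy => hu₀ y hy.2
  set S := φ.target ∩ φ.symm ⁻¹' W
  have hS : IsOpen S := φ.isOpen_inter_preimage_symm hW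
  have hX : ∀ v : E, ContMDiffOn 𝓘(ℝ, E) (𝓘(ℝ, E).prod 𝓘(ℝ, E)) ∞
      (fun y => TotalSpace.mk' E y (coordField x v y)) W := fun v =>
    (contMDiffOn_coordField x v).mono Set.inter_subset_left
  have ha := fun v => L.conn.contMDiffOn_form_apply hW hs (hX v)
  -- The connection form is known to be smooth only after evaluation on smooth fields. Evaluating it
  -- on the fields that are constant in the chart gives the coefficients of its chart expression,
  -- whose smoothness and symmetric derivative can be checked one vector at a time.
  have hform : ∀ v, ∀ y ∈ φ.target, chartOneForm (L.conn.form s) x y v =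
      ((fun z => L.conn.form s z (coordField x v z)) ∘ φ.symm) y := by
    intro v y hy
    have h := coordField_apply (φ.map_target hy) v
    rw [φ.right_inv hy] at h
    exact congrArg (L.conn.form s (φ.symm y)) h.symm
  have hsm : ContDiffOn ℝ ∞ (chartOneForm (L.conn.form s) x) S := by
    rw [contDiffOn_clm_apply]
    intro v
    have h1 : ContMDiffOn 𝓘(ℝ, E) 𝓘(ℝ, ℂ) ∞
        ((fun z => L.conn.form s z (coordField x v z)) ∘ φ.symm) S :=
      (ha v).comp (contMDiffOn_chart_symm.mono Set.inter_subset_left) fun y hy => hy.2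
    exact (contMDiffOn_iff_contDiffOn.1 h1).congr fun y hy => hform v y hy.1
  have hfd : ∀ y ∈ S, ∀ v w : E, fderiv ℝ (chartOneForm (L.conn.form s) x) y v w =
      dC E (fun z => L.conn.form s z (coordField x w z)) (φ.symm y)
        (coordField x v (φ.symm y)) := by
    intro y hy v w
    have hd := (hsm.contDiffAt (hS.mem_nhds hy)).differentiableAt (by simp)
    have h1 := (hd.hasFDerivAt.clm_apply (hasFDerivAt_const w y)).fderiv
    have h2 : (fun z => chartOneForm (L.conn.form s) x z w) =ᶠ[𝓝 y]
        (fun z => L.conn.form s z (coordField x w z)) ∘ φ.symm := by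
      filter_upwards [hS.mem_nhds hy] with z hz
      exact hform w z hz.1
    have hmd : MDifferentiableAt 𝓘(ℝ, E) 𝓘(ℝ, ℂ)
        (fun z => L.conn.form s z (coordField x w z)) (φ.symm y) :=
      ((ha w).contMDiffAt (hW.mem_nhds hy.2)).mdifferentiableAt (by simp)
    have h3 := hasFDerivAt_comp_symm (φ.map_target hy.1) hmd
    have h4 := coordField_apply (φ.map_target hy.1) v
    rw [φ.right_inv hy.1] at h3 h4
    rw [h2.fderiv_eq, h3.fderiv] at h1
    have h5 := congrArg (fun A : E →L[ℝ] ℂ => A v) h1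
    simp only [add_apply, ContinuousLinearMap.comp_apply,
      zero_apply, map_zero, ContinuousLinearMap.flip_apply, zero_add] at h5
    rw [← h5]
    exact congrArg (dC E (fun z => L.conn.form s z (coordField x w z)) (φ.symm y)) h4.symm
  obtain ⟨V, hV, hxV, hVW, h, hh, hre, hdh⟩ := exists_primitive hW hx hsm
    (fun y hy v w => by
      rw [hfd y hy, hfd y hy]
      exact L.conn.dC_form_symm hW hs hu L.flat (hX v) (hX w) hy.2
        (mlieBracket_coordField (φ.map_target hy.1) v w))
    (fun z hz w => L.conn.re_form hW hs hu hz w)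
  have hh' : ContMDiffOn 𝓘(ℝ, E) 𝓘(ℝ, ℂ) ∞ (fun y => -h y) V :=
    (contDiff_neg (𝕜 := ℝ)).contMDiff.comp_contMDiffOn hh
  have he := contMDiffOn_cexp_comp hh'
  -- Since `dh = A`, one has `∇(exp (-h) s) = exp (-h) (A - dh) s = 0`. The length remains one
  -- because `h` is imaginary.
  refine ⟨V, fun y => Complex.exp (-h y) • s y, hV, hxV, (hs.mono hVW).smul hV he, ?_, ?_⟩
  · intro y hy
    simp only [map_smulₛₗ, LinearMap.smul_apply, RingHom.id_apply, hu y (hVW hy), smul_eq_mul,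
      mul_one]
    rw [Complex.mul_conj', Complex.norm_exp]
    simp [hre y]
  · intro y hy
    ext w
    have hmd : MDifferentiableAt 𝓘(ℝ, E) 𝓘(ℝ, ℂ) h y :=
      (hh.contMDiffAt (hV.mem_nhds hy)).mdifferentiableAt (by simp)
    have hmd' : MDifferentiableAt 𝓘(ℝ, E) 𝓘(ℝ, ℂ) (fun y => -h y) y :=
      (hh'.contMDiffAt (hV.mem_nhds hy)).mdifferentiableAt (by simp)
    have hneg : dC E (fun y => -h y) y w = -dC E h y w := by
      have := dC_sub (f := fun _ => (0 : ℂ)) mdifferentiableAt_const hmd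
      simp only [zero_sub, dC_const] at this
      rw [this]
      rfl
    rw [L.conn.cov_smul hV he (hs.mono hVW) hy, dC_cexp hmd', hneg, hdh y hy,
      RealConnection.form_apply]
    have := RealLineBundle.eq_herm_smul (hu y (hVW hy)) (L.conn.cov s y w)
    rw [this, smul_smul, ← add_smul]
    simp [hu y (hVW hy)]

end FlatRealLineBundle
end Frames

/-! ### The Real line bundle of a cocycle -/

section Cocycles
variable {E : Type v} [NormedAddCommGroup E] [NormedSpace ℝ E]
  {M : Type u} [TopologicalSpace M] [ChartedSpace E M]
  {τ : SmoothInvolution E M}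

/-- A Real locally constant `U(1)`-valued Čech cocycle. -/
structure IsCocycle (𝒰 : EquivariantCover τ) (g : 𝒰.ι → 𝒰.ι → M → ℂ) : Prop where
  locConst : ∀ i j x, x ∈ 𝒰.U i → x ∈ 𝒰.U j → ∀ᶠ y in 𝓝 x, g i j y = g i j x
  norm : ∀ i j x, x ∈ 𝒰.U i → x ∈ 𝒰.U j → ‖g i j x‖ = 1
  mul : ∀ i j k x, x ∈ 𝒰.U i → x ∈ 𝒰.U j → x ∈ 𝒰.U k → g i j x * g j k x = g i k x
  map_inv : ∀ i j x, x ∈ 𝒰.U i → x ∈ 𝒰.U j →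
    g (𝒰.inv i) (𝒰.inv j) (τ x) = conj (g i j x)

namespace IsCocycle

variable {𝒰 : EquivariantCover τ} {g : 𝒰.ι → 𝒰.ι → M → ℂ} (hg : IsCocycle 𝒰 g)

include hg

lemma ne_zero {i j : 𝒰.ι} {x : M} (hi : x ∈ 𝒰.U i) (hj : x ∈ 𝒰.U j) : g i j x ≠ 0 := by
  intro h
  have := hg.norm i j x hi hj
  simp [h] at this

lemma self {i : 𝒰.ι} {x : M} (hi : x ∈ 𝒰.U i) : g i i x = 1 :=
  mul_left_cancel₀ (hg.ne_zero hi hi) (by rw [hg.mul i i i x hi hi hi, mul_one])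

lemma conj_mul {i j : 𝒰.ι} {x : M} (hi : x ∈ 𝒰.U i) (hj : x ∈ 𝒰.U j) :
    conj (g i j x) * g i j x = 1 := by
  rw [Complex.conj_mul', hg.norm i j x hi hj]
  simp

end IsCocycle

lemma EquivariantCover.inv_mem (𝒰 : EquivariantCover τ) {i : 𝒰.ι} {x : M} (hx : x ∈ 𝒰.U i) :
    τ x ∈ 𝒰.U (𝒰.inv i) := (𝒰.mem_inv i (τ x)).2 (by rwa [τ.involutive x])

lemma EquivariantCover.inter₂_mem_nhds (𝒰 : EquivariantCover τ) {i j : 𝒰.ι} {x : M}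
    (hi : x ∈ 𝒰.U i) (hj : x ∈ 𝒰.U j) : ∀ᶠ y in 𝓝 x, y ∈ 𝒰.U i ∧ y ∈ 𝒰.U j :=
  Filter.inter_mem ((𝒰.U i).isOpen.mem_nhds hi) ((𝒰.U j).isOpen.mem_nhds hj)

/-- A choice of a member of the cover around each point. -/
def EquivariantCover.indexAt (𝒰 : EquivariantCover τ) (x : M) : 𝒰.ι := (𝒰.covers x).choose

lemma EquivariantCover.mem_indexAt (𝒰 : EquivariantCover τ) (x : M) : x ∈ 𝒰.U (𝒰.indexAt x) :=
  (𝒰.covers x).choose_spec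

namespace Realisation

variable {𝒰 : EquivariantCover τ} {g : 𝒰.ι → 𝒰.ι → M → ℂ} (hg : IsCocycle 𝒰 g)

/-- The bundle core of a cocycle. -/
def core : VectorBundleCore ℝ M ℂ 𝒰.ι where
  baseSet i := 𝒰.U i
  isOpen_baseSet i := (𝒰.U i).isOpen
  indexAt := 𝒰.indexAt
  mem_baseSet_at := 𝒰.mem_indexAt
  -- The convention for frames is `e_j = g_ij e_i`, so coordinates pass from `i` to `j` through
  -- `g_ji`.
  coordChange i j x := (ContinuousLinearMap.mul ℝ ℂ) (g j i x)
  coordChange_self i x hx v := by simp [hg.self hx]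
  continuousOn_coordChange i j x hx := by
    refine ContinuousAt.continuousWithinAt ?_
    refine (continuousAt_const (y := (ContinuousLinearMap.mul ℝ ℂ) (g j i x))).congr ?_
    filter_upwards [hg.locConst j i x hx.2 hx.1] with y hy
    rw [hy]
  coordChange_comp i j k x hx v := by
    simp only [ContinuousLinearMap.mul_apply', ← mul_assoc]
    rw [hg.mul k j i x hx.2 hx.1.2 hx.1.1]

/-- The fibres of the line bundle of a cocycle. -/
abbrev Fib : M → Type := (core hg).Fiber

instance (x : M) : Module ℂ (Fib hg x) := inferInstanceAs (Module ℂ ℂ)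

instance (x : M) : IsTopologicalAddGroup (Fib hg x) := inferInstanceAs (IsTopologicalAddGroup ℂ)

instance contMDiff_core : (core hg).IsContMDiff 𝓘(ℝ, E) ∞ where
  contMDiffOn_coordChange i j x hx := by
    refine ContMDiffAt.contMDiffWithinAt ?_
    refine (contMDiffAt_const (c := (ContinuousLinearMap.mul ℝ ℂ) (g j i x))).congr_of_eventuallyEq ?_
    filter_upwards [hg.locConst j i x hx.2 hx.1] with y hy
    change (ContinuousLinearMap.mul ℝ ℂ) (g j i y) = _
    rw [hy]

instance isLinear_localTriv (i : 𝒰.ι) : ((core hg).localTriv i).IsLinear ℂ :=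
  ⟨fun x _ => ⟨fun a b => mul_add (g i (𝒰.indexAt x) x) (a : ℂ) (b : ℂ),
    fun c a => mul_left_comm (g i (𝒰.indexAt x) x) c (a : ℂ)⟩⟩

/-- The core is taken over `ℝ` because the smooth structure is real. Its coordinate changes multiply
by complex numbers, so they are `ℂ`-linear too, and local constancy of `g` makes them continuous as
`ℂ`-linear maps. -/
instance vectorBundle_complex : VectorBundle ℂ ℂ (Fib hg) where
  trivialization_linear' := by
    rintro _ ⟨i, rfl⟩
    exact isLinear_localTriv hg i
  continuousOn_coordChange' := by
    rintro _ _ ⟨i, rfl⟩ ⟨j, rfl⟩ x hx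
    have key : ∀ y, y ∈ 𝒰.U i ∧ y ∈ 𝒰.U j →
        (Bundle.Trivialization.coordChangeL ℂ ((core hg).localTriv i) ((core hg).localTriv j) y :
          ℂ →L[ℂ] ℂ) = (ContinuousLinearMap.mul ℂ ℂ) (g j i y) := by
      intro y hy
      refine ContinuousLinearMap.ext fun v => ?_
      exact (Bundle.Trivialization.coordChangeL_apply (R := ℂ) _ _ hy v).trans
        ((Bundle.Trivialization.coordChangeL_apply (R := ℝ) _ _ hy v).symm.trans
          ((core hg).localTriv_coordChange_eq i j hy v))
    refine ContinuousAt.continuousWithinAt ?_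
    refine (continuousAt_const (y := (ContinuousLinearMap.mul ℂ ℂ) (g j i x))).congr ?_
    filter_upwards [hg.locConst j i x hx.2 hx.1, 𝒰.inter₂_mem_nhds hx.1 hx.2] with y hy hy'
    rw [← hy]
    exact (key y hy').symm

/-- The coordinate of a vector with respect to the frame over `U_i`. -/
def coord (i : 𝒰.ι) (p : TotalSpace ℂ (Fib hg)) : ℂ :=
  g i (𝒰.indexAt p.1) p.1 * (show ℂ from p.2)

section
variable {N EN HN : Type*} [NormedAddCommGroup EN] [NormedSpace ℝ EN] [TopologicalSpace HN]
  {IN : ModelWithCorners ℝ EN HN} [TopologicalSpace N] [ChartedSpace HN N]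

/-- All trivializations of the core belong to the atlas, so smoothness may be tested in the frame of
any index whose set contains the point, not only the preferred one. -/
lemma contMDiffAt_iff {f : N → TotalSpace ℂ (Fib hg)} {n : N} {i : 𝒰.ι}
    (hi : (f n).proj ∈ 𝒰.U i) :
    ContMDiffAt IN (𝓘(ℝ, E).prod 𝓘(ℝ, ℂ)) ∞ f n ↔
      ContMDiffAt IN 𝓘(ℝ, E) ∞ (fun y => (f y).proj) n ∧
        ContMDiffAt IN 𝓘(ℝ, ℂ) ∞ (fun y => coord hg i (f y)) n :=
  haveI : MemTrivializationAtlas ((core hg).localTriv i) := ⟨⟨i, rfl⟩⟩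
  ((core hg).localTriv i).contMDiffAt_iff hi

end


/-- A complex number, as the vector with this coordinate with respect to the preferred frame. -/
def ofC (x : M) (c : ℂ) : Fib hg x := c

lemma coord_mul {i j : 𝒰.ι} {p : TotalSpace ℂ (Fib hg)} (hi : p.1 ∈ 𝒰.U i) (hj : p.1 ∈ 𝒰.U j) :
    coord hg i p = g i j p.1 * coord hg j p := by
  rw [coord, coord, ← mul_assoc, hg.mul i j _ _ hi hj (𝒰.mem_indexAt _)]

lemma coord_indexAt (x : M) (u : Fib hg x) : coord hg (𝒰.indexAt x) ⟨x, u⟩ = u := by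
  change g (𝒰.indexAt x) (𝒰.indexAt x) x * (show ℂ from u) = u
  rw [hg.self (𝒰.mem_indexAt x), one_mul]

lemma contMDiff_section_iff {s : ∀ x, Fib hg x} :
    SmoothSection (E := E) s ↔ ∀ i, ∀ x ∈ 𝒰.U i,
      ContMDiffAt 𝓘(ℝ, E) 𝓘(ℝ, ℂ) ∞ (fun y => coord hg i ⟨y, s y⟩) x :=
  ⟨fun h i x hx => ((contMDiffAt_iff hg (f := fun x => TotalSpace.mk' ℂ x (s x)) hx).1 (h x)).2,
    fun h x => (contMDiffAt_iff hg (f := fun x => TotalSpace.mk' ℂ x (s x)) (𝒰.mem_indexAt x)).2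
      ⟨contMDiffAt_id, h _ x (𝒰.mem_indexAt x)⟩⟩

/-- The metric for which the frames have length one. -/
def hermForm : ℂ →ₗ⋆[ℂ] ℂ →ₗ[ℂ] ℂ :=
  LinearMap.mk₂'ₛₗ (starRingEnd ℂ) (RingHom.id ℂ) (fun u w => conj u * w)
    (fun a b c => by simp [add_mul]) (fun c a b => by simp [mul_assoc])
    (fun a b c => by simp [mul_add]) (fun c a b => by simp [mul_left_comm])

/-- A change of index multiplies both coordinates by the same number of modulus one, so the metric
has the same expression in every frame. -/
lemma hermForm_coord {i : 𝒰.ι} {x : M} (hi : x ∈ 𝒰.U i) (u w : Fib hg x) :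
    conj (coord hg i ⟨x, u⟩) * coord hg i ⟨x, w⟩ = hermForm u w := by
  change conj (g i (𝒰.indexAt x) x * (show ℂ from u)) * (g i (𝒰.indexAt x) x * (show ℂ from w)) =
    conj (show ℂ from u) * (show ℂ from w)
  have := hg.conj_mul hi (𝒰.mem_indexAt x)
  rw [map_mul]
  linear_combination (conj (show ℂ from u) * (show ℂ from w)) * this

/-- The Real structure for which the frames over `U_i` and `U_{inv i}` correspond. -/
def sigma (x : M) : ℂ →ₗ⋆[ℂ] ℂ where
  toFun u := g (𝒰.indexAt (τ x)) (𝒰.inv (𝒰.indexAt x)) (τ x) * conj u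
  map_add' a b := by simp [mul_add]
  map_smul' c a := by simp [mul_left_comm]

/-- The equivariance `map_inv` of the cocycle enters here: it makes the Real structure plain
conjugation in every pair of frames, although it is defined through the preferred ones. -/
lemma coord_sigma {i : 𝒰.ι} {x : M} (hi : x ∈ 𝒰.U i) (u : Fib hg x) :
    coord hg (𝒰.inv i) ⟨τ x, ofC hg _ (sigma (g := g) x u)⟩ = conj (coord hg i ⟨x, u⟩) := by
  change g (𝒰.inv i) (𝒰.indexAt (τ x)) (τ x) *
    (g (𝒰.indexAt (τ x)) (𝒰.inv (𝒰.indexAt x)) (τ x) * conj (show ℂ from u)) =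
    conj (g i (𝒰.indexAt x) x * (show ℂ from u))
  rw [← mul_assoc, hg.mul _ _ _ _ (𝒰.inv_mem hi) (𝒰.mem_indexAt _)
    (𝒰.inv_mem (𝒰.mem_indexAt x)), hg.map_inv _ _ _ hi (𝒰.mem_indexAt x), map_mul]

lemma eq_of_coord_eq {p q : TotalSpace ℂ (Fib hg)} {i : 𝒰.ι} (h : p.1 = q.1) (hi : p.1 ∈ 𝒰.U i)
    (hc : coord hg i p = coord hg i q) : p = q := by
  obtain ⟨x, u⟩ := p
  obtain ⟨y, w⟩ := q
  obtain rfl : x = y := h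
  congr 1
  exact mul_left_cancel₀ (M₀ := ℂ) (hg.ne_zero hi (𝒰.mem_indexAt x)) hc

/-- The Real line bundle of a cocycle. -/
def bundle : RealLineBundle τ where
  Fiber := Fib hg
  continuousSMul _ := (inferInstance : ContinuousSMul ℝ ℂ)
  realVectorBundle := (core hg).vectorBundle
  smoothVectorBundle := (core hg).instContMDiffVectorBundle
  herm x := hermForm
  herm_symm x u w := by
    change conj (show ℂ from w) * (show ℂ from u) = conj (conj (show ℂ from u) * (show ℂ from w))
    rw [map_mul, Complex.conj_conj, mul_comm]
  herm_pos x u hu := by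
    change 0 < (conj (show ℂ from u) * (show ℂ from u)).re
    rw [← Complex.normSq_eq_conj_mul_self, Complex.ofReal_re]
    exact Complex.normSq_pos.2 hu
  herm_smooth s t hs ht x := by
    have h1 := (contMDiff_section_iff hg).1 hs _ x (𝒰.mem_indexAt x)
    have h2 := (contMDiff_section_iff hg).1 ht _ x (𝒰.mem_indexAt x)
    refine (contMDiffAt_complex_mul (Complex.conjCLE.contDiff.contMDiff.contMDiffAt.comp x h1)
      h2).congr_of_eventuallyEq ?_
    filter_upwards [(𝒰.U _).isOpen.mem_nhds (𝒰.mem_indexAt x)] with y hy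
    exact (hermForm_coord hg hy _ _).symm
  σ x := sigma (g := g) x
  σ_smooth p := by
    have h0 : ContMDiffAt (𝓘(ℝ, E).prod 𝓘(ℝ, ℂ)) (𝓘(ℝ, E).prod 𝓘(ℝ, ℂ)) ∞
      (fun q : TotalSpace ℂ (Fib hg) => q) p := contMDiffAt_id
    have h1 := (contMDiffAt_iff hg (𝒰.mem_indexAt p.1)).1 h0
    refine (contMDiffAt_iff hg (f := fun e : TotalSpace ℂ (Fib hg) =>
      TotalSpace.mk' ℂ (τ e.proj) (ofC hg _ (sigma (g := g) e.proj e.snd)))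
      (𝒰.inv_mem (𝒰.mem_indexAt p.1))).2
      ⟨τ.contMDiff.contMDiffAt.comp p h1.1, ?_⟩
    refine (Complex.conjCLE.contDiff.contMDiff.contMDiffAt.comp p h1.2).congr_of_eventuallyEq ?_
    filter_upwards [h1.1.continuousAt.preimage_mem_nhds
      ((𝒰.U _).isOpen.mem_nhds (𝒰.mem_indexAt p.1))] with q hq
    exact coord_sigma hg hq q.2
  σ_involutive p := by
    refine eq_of_coord_eq hg (i := 𝒰.inv (𝒰.inv (𝒰.indexAt p.1))) (τ.involutive p.1)
      (𝒰.inv_mem (𝒰.inv_mem (𝒰.mem_indexAt p.1))) ?_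
    refine (coord_sigma hg (𝒰.inv_mem (𝒰.mem_indexAt p.1)) _).trans ?_
    refine (congrArg conj (coord_sigma hg (𝒰.mem_indexAt p.1) p.2)).trans ?_
    rw [Complex.conj_conj, 𝒰.inv_involutive]
  herm_σ x u w := by
    refine (hermForm_coord hg (𝒰.inv_mem (𝒰.mem_indexAt x)) (ofC hg _ (sigma (g := g) x u))
      (ofC hg _ (sigma (g := g) x w))).symm.trans ?_
    rw [coord_sigma hg (𝒰.mem_indexAt x), coord_sigma hg (𝒰.mem_indexAt x), ← map_mul,
      hermForm_coord hg (𝒰.mem_indexAt x)]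
    rfl

end Realisation
end Cocycles

/-! ### The flat Real connection of a cocycle -/

section Realise
variable {E : Type v} [NormedAddCommGroup E] [NormedSpace ℝ E]
  {M : Type u} [TopologicalSpace M] [ChartedSpace E M]
  {τ : SmoothInvolution E M}

lemma dC_mul_apply {f g : M → ℂ} {x : M} (hf : MDifferentiableAt 𝓘(ℝ, E) 𝓘(ℝ, ℂ) f x)
    (hg : MDifferentiableAt 𝓘(ℝ, E) 𝓘(ℝ, ℂ) g x) (w : TangentSpace 𝓘(ℝ, E) x) :
    dC E (fun y => f y * g y) x w = f x * dC E g x w + g x * dC E f x w :=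
  congrArg (fun A : E →L[ℝ] ℂ => A w) (dC_mul hf hg)

lemma dC_const_mul (c : ℂ) {f : M → ℂ} {x : M} (hf : MDifferentiableAt 𝓘(ℝ, E) 𝓘(ℝ, ℂ) f x)
    (w : TangentSpace 𝓘(ℝ, E) x) : dC E (fun y => c * f y) x w = c * dC E f x w := by
  rw [dC_mul_apply mdifferentiableAt_const hf, dC_const]
  exact add_eq_left.2 (mul_zero (f x))

lemma dC_conj {f : M → ℂ} {x : M} (hf : MDifferentiableAt 𝓘(ℝ, E) 𝓘(ℝ, ℂ) f x)
    (w : TangentSpace 𝓘(ℝ, E) x) : dC E (fun y => conj (f y)) x w = conj (dC E f x w) :=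
  congrArg (fun A : E →L[ℝ] ℂ => A w)
    (dC_comp (G := fun z => conj z) Complex.conjCLE.hasFDerivAt hf)

namespace Realisation

variable {𝒰 : EquivariantCover τ} {g : 𝒰.ι → 𝒰.ι → M → ℂ} (hg : IsCocycle 𝒰 g)

/-- The coordinate of a section with respect to the frame over `U_i`. -/
def coordFun (i : 𝒰.ι) (s : ∀ x, (bundle hg).Fiber x) (x : M) : ℂ := coord hg i ⟨x, s x⟩

lemma coordFun_add (i : 𝒰.ι) (s t : ∀ x, (bundle hg).Fiber x) (x : M) :
    coordFun hg i (s + t) x = coordFun hg i s x + coordFun hg i t x :=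
  mul_add (g i (𝒰.indexAt x) x) (s x : ℂ) (t x : ℂ)

lemma coordFun_smul (i : 𝒰.ι) (a : M → ℂ) (s : ∀ x, (bundle hg).Fiber x) (x : M) :
    coordFun hg i (fun y => a y • s y) x = a x * coordFun hg i s x :=
  mul_left_comm (g i (𝒰.indexAt x) x) (a x) (s x : ℂ)

lemma mdifferentiableAt_coordFun {i : 𝒰.ι} {x : M} (hi : x ∈ 𝒰.U i)
    {s : ∀ x, (bundle hg).Fiber x} (hs : MDifferentiableAt 𝓘(ℝ, E) (𝓘(ℝ, E).prod 𝓘(ℝ, ℂ))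
      (fun y => TotalSpace.mk' ℂ y (s y)) x) :
    MDifferentiableAt 𝓘(ℝ, E) 𝓘(ℝ, ℂ) (coordFun hg i s) x :=
  haveI : MemTrivializationAtlas ((core hg).localTriv i) := ⟨⟨i, rfl⟩⟩
  ((Bundle.Trivialization.mdifferentiableAt_totalSpace_iff 𝓘(ℝ, E) ((core hg).localTriv i)
    (fun y => (TotalSpace.mk' ℂ y (s y) : TotalSpace ℂ (Fib hg))) hi).1 hs).2

/-- The connection for which the frames are flat. -/
def cov (s : ∀ x, (bundle hg).Fiber x) (x : M) :
    TangentSpace 𝓘(ℝ, E) x →L[ℝ] (bundle hg).Fiber x :=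
  (dC E (coordFun hg (𝒰.indexAt x) s) x : E →L[ℝ] ℂ)

/-- Near `x` a change of index multiplies the coordinate function by a constant, because `g` is
locally constant. Hence differentiating coordinates commutes with changing frames and no connection
form appears. -/
lemma coord_cov {i : 𝒰.ι} {x : M} (hi : x ∈ 𝒰.U i) {s : ∀ x, (bundle hg).Fiber x}
    (hs : MDifferentiableAt 𝓘(ℝ, E) (𝓘(ℝ, E).prod 𝓘(ℝ, ℂ)) (fun y => TotalSpace.mk' ℂ y (s y)) x)
    (w : TangentSpace 𝓘(ℝ, E) x) :
    coord hg i ⟨x, cov hg s x w⟩ = dC E (coordFun hg i s) x w := by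
  have h1 : coordFun hg i s =ᶠ[𝓝 x]
      fun y => g i (𝒰.indexAt x) x * coordFun hg (𝒰.indexAt x) s y := by
    filter_upwards [hg.locConst i _ x hi (𝒰.mem_indexAt x),
      𝒰.inter₂_mem_nhds hi (𝒰.mem_indexAt x)] with y hy hy'
    rw [← hy]
    exact coord_mul hg hy'.1 hy'.2
  rw [dC_congr h1, dC_const_mul _ (mdifferentiableAt_coordFun hg (𝒰.mem_indexAt x) hs)]
  rfl

variable [FiniteDimensional ℝ E] [IsManifold 𝓘(ℝ, E) ∞ M]

/-- The covariant derivative for which the frames are flat. -/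
def covDeriv : CovariantDerivative 𝓘(ℝ, E) ℂ (bundle hg).Fiber where
  toFun := cov hg
  isCovariantDerivativeOnUniv :=
    { add := fun {s t x} hs ht _ => by
        have h : coordFun hg (𝒰.indexAt x) (s + t) = fun y =>
            coordFun hg (𝒰.indexAt x) s y + coordFun hg (𝒰.indexAt x) t y :=
          funext fun y => coordFun_add hg _ s t y
        have h2 := dC_add (mdifferentiableAt_coordFun hg (𝒰.mem_indexAt x) hs)
          (mdifferentiableAt_coordFun hg (𝒰.mem_indexAt x) ht)
        rw [← h] at h2
        exact h2
      leibniz := fun {s f x} hs hf _ => by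
        have h : coordFun hg (𝒰.indexAt x) (f • s) = fun y =>
            (f y : ℂ) * coordFun hg (𝒰.indexAt x) s y :=
          funext fun y => coordFun_smul hg _ (fun y => (f y : ℂ)) s y
        have hf' : HasMFDerivAt 𝓘(ℝ, E) 𝓘(ℝ, ℂ) (fun y => (f y : ℂ)) x
            (Complex.ofRealCLM ∘L (mfderiv 𝓘(ℝ, E) 𝓘(ℝ, ℝ) f x : E →L[ℝ] ℝ)) :=
          Complex.ofRealCLM.hasFDerivAt.hasMFDerivAt.comp x hf.hasMFDerivAt
        ext w
        have h2 := dC_mul_apply hf'.mdifferentiableAt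
          (mdifferentiableAt_coordFun hg (𝒰.mem_indexAt x) hs) w
        rw [← h, HasMFDerivAt.dC_eq hf', show coordFun hg (𝒰.indexAt x) s x = s x from
          coord_indexAt hg x (s x), mul_comm (show ℂ from s x)] at h2
        exact h2 }

lemma contMDiff_covDeriv : (covDeriv hg).ContMDiffCovariantDerivative ∞ where
  contMDiff :=
    { contMDiff := fun {s} hs => by
        rw [contMDiffOn_univ] at hs ⊢
        intro x
        have hs' : ContMDiff 𝓘(ℝ, E) (𝓘(ℝ, E).prod 𝓘(ℝ, ℂ)) ∞
          (fun y => TotalSpace.mk' ℂ y (s y)) := hs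
        have h1 := (contMDiff_section_iff hg).1 hs' _ x (𝒰.mem_indexAt x)
        rw [contMDiffAt_hom_bundle]
        refine ⟨contMDiffAt_id, ?_⟩
        -- In a fixed frame the covariant derivative is the differential of the coordinate function,
        -- so it inherits the smoothness of that differential. What remains is to match the two
        -- descriptions in bundle coordinates.
        have h2 := h1.mfderiv_const (m := ∞) (by simp)
        refine h2.congr_of_eventuallyEq ?_
        filter_upwards [(𝒰.U _).isOpen.mem_nhds (𝒰.mem_indexAt x)] with y hy
        ext v
        have hA : ∀ (A : E →L[ℝ] ℂ) (a : ℂ) (b : ℂ), (ContinuousLinearMap.inCoordinates E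
            (TangentSpace 𝓘(ℝ, E)) ℂ (TangentSpace 𝓘(ℝ, ℂ)) x y a b A : E →L[ℝ] ℂ) v =
            A ((trivializationAt E (TangentSpace 𝓘(ℝ, E)) x).symmL ℝ y v) := by
          intro A a b
          simp [ContinuousLinearMap.inCoordinates]
          rfl
        have hB : (ContinuousLinearMap.inCoordinates E (TangentSpace 𝓘(ℝ, E)) ℂ
            (bundle hg).Fiber x y x y (cov hg s y) : E →L[ℝ] ℂ) v =
            coord hg (𝒰.indexAt x) ⟨y, cov hg s y
              ((trivializationAt E (TangentSpace 𝓘(ℝ, E)) x).symmL ℝ y v)⟩ := by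
          simp only [ContinuousLinearMap.inCoordinates, ContinuousLinearMap.comp_apply]
          exact congrFun (Bundle.Trivialization.coe_linearMapAt_of_mem (R := ℝ)
            ((core hg).localTriv (𝒰.indexAt x)) hy) _
        exact hB.trans ((coord_cov hg hy ((hs' y).mdifferentiableAt (by simp)) _).trans
          (hA _ _ _).symm) }


omit [FiniteDimensional ℝ E] [IsManifold 𝓘(ℝ, E) ∞ M] in
lemma herm_eq_coordFun {i : 𝒰.ι} {x : M} (hi : x ∈ 𝒰.U i) (s t : ∀ x, (bundle hg).Fiber x) :
    (bundle hg).herm x (s x) (t x) = conj (coordFun hg i s x) * coordFun hg i t x :=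
  (hermForm_coord hg hi (s x) (t x)).symm

omit [FiniteDimensional ℝ E] [IsManifold 𝓘(ℝ, E) ∞ M] in
lemma coord_inv_σ {i : 𝒰.ι} {x : M} (hi : x ∈ 𝒰.U i) (u : (bundle hg).Fiber x) :
    coord hg (𝒰.inv i) ⟨τ x, (bundle hg).σ x u⟩ = conj (coord hg i ⟨x, u⟩) :=
  coord_sigma hg hi u

omit [FiniteDimensional ℝ E] [IsManifold 𝓘(ℝ, E) ∞ M] in
lemma fiber_ext {i : 𝒰.ι} {x : M} (hi : x ∈ 𝒰.U i) {u w : (bundle hg).Fiber x}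
    (h : coord hg i ⟨x, u⟩ = coord hg i ⟨x, w⟩) : u = w :=
  mul_left_cancel₀ (M₀ := ℂ) (hg.ne_zero hi (𝒰.mem_indexAt x)) h

/-- The Real connection for which the frames are flat. -/
def connection : RealConnection (bundle hg) where
  cov := covDeriv hg
  smooth := contMDiff_covDeriv hg
  map_smul c s hs x w := by
    have h : coordFun hg (𝒰.indexAt x) (c • s) = fun y => c * coordFun hg (𝒰.indexAt x) s y :=
      funext fun y => coordFun_smul hg _ (fun _ => c) s y
    have h2 := dC_const_mul c (mdifferentiableAt_coordFun hg (𝒰.mem_indexAt x)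
      ((hs x).mdifferentiableAt (by simp))) w
    rw [← h] at h2
    exact h2
  metric s t hs ht x w := by
    have hs' := mdifferentiableAt_coordFun hg (𝒰.mem_indexAt x)
      ((hs x).mdifferentiableAt (by simp))
    have ht' := mdifferentiableAt_coordFun hg (𝒰.mem_indexAt x)
      ((ht x).mdifferentiableAt (by simp))
    have h : (fun y => (bundle hg).herm y (s y) (t y)) =ᶠ[𝓝 x] fun y =>
        conj (coordFun hg (𝒰.indexAt x) s y) * coordFun hg (𝒰.indexAt x) t y := by
      filter_upwards [(𝒰.U _).isOpen.mem_nhds (𝒰.mem_indexAt x)] with y hy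
      exact herm_eq_coordFun hg hy s t
    have hc : MDifferentiableAt 𝓘(ℝ, E) 𝓘(ℝ, ℂ)
        (fun y => conj (coordFun hg (𝒰.indexAt x) s y)) x :=
      (Complex.conjCLE.hasFDerivAt.hasMFDerivAt.comp x hs'.hasMFDerivAt).mdifferentiableAt
    have h2 := dC_mul_apply hc ht' w
    rw [← dC_congr h, dC_conj hs'] at h2
    refine h2.trans ?_
    rw [show coordFun hg (𝒰.indexAt x) s x = s x from coord_indexAt hg x (s x),
      show coordFun hg (𝒰.indexAt x) t x = t x from coord_indexAt hg x (t x),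
      add_comm, mul_comm (show ℂ from t x)]
    rfl
  real s t hs ht hst x w := by
    have hs' := mdifferentiableAt_coordFun hg (𝒰.mem_indexAt x)
      ((hs x).mdifferentiableAt (by simp))
    have hi := 𝒰.mem_indexAt x
    have ht' := (ht (τ x)).mdifferentiableAt (n := ∞) (by simp)
    -- The comparison is made in the frame over `inv i`, where the coordinate of `σ u` is the
    -- conjugate of the coordinate of `u` over `i`.
    refine fiber_ext hg (𝒰.inv_mem hi) ?_
    refine (coord_cov hg (𝒰.inv_mem hi) ht' _).trans (Eq.trans ?_ (coord_inv_σ hg hi _).symm)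
    refine Eq.trans ?_ (congrArg conj (coord_cov hg hi
      ((hs x).mdifferentiableAt (by simp)) w)).symm
    rw [← dC_comp_map (mdifferentiableAt_coordFun hg (𝒰.inv_mem hi) ht')
      ((τ.contMDiff x).mdifferentiableAt (by simp)), ← dC_conj hs']
    refine congrArg (fun A : E →L[ℝ] ℂ => A w) (dC_congr ?_)
    filter_upwards [(𝒰.U _).isOpen.mem_nhds hi] with y hy
    refine Eq.trans ?_ (coord_inv_σ hg hy _)
    rw [← hst]
    rfl

/-- The flat Real line bundle of a cocycle. -/
def flatBundle : FlatRealLineBundle τ where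
  toRealLineBundle := bundle hg
  conn := connection hg
  flat X Y hX hY s hs x := by
    have : CompleteSpace E := FiniteDimensional.complete ℝ E
    have hi := 𝒰.mem_indexAt x
    have hco : ContMDiffOn 𝓘(ℝ, E) 𝓘(ℝ, ℂ) ∞ (coordFun hg (𝒰.indexAt x) s)
        (𝒰.U (𝒰.indexAt x)) := fun y hy =>
      ((contMDiff_section_iff hg).1 hs _ y hy).contMDiffWithinAt
    -- In a flat frame the curvature is `X(Y f) - Y(X f) - [X, Y] f` for the coordinate function
    -- `f`.
    have h := dC_mlieBracket (𝒰.U _).isOpen hco hi ((hX x).mdifferentiableAt (by simp))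
      ((hY x).mdifferentiableAt (by simp))
    have key : ∀ Z : ∀ x : M, TangentSpace 𝓘(ℝ, E) x,
        coordFun hg (𝒰.indexAt x) (fun y => cov hg s y (Z y)) =ᶠ[𝓝 x]
          fun y => dC E (coordFun hg (𝒰.indexAt x) s) y (Z y) := by
      intro Z
      filter_upwards [(𝒰.U _).isOpen.mem_nhds hi] with y hy
      exact coord_cov hg hy ((hs y).mdifferentiableAt (by simp)) _
    rw [← dC_congr (key X), ← dC_congr (key Y)] at h
    exact sub_eq_zero.2 h

end Realisation
end Realise

/-! ### Transition functions of Real flat frames -/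

section CocycleFrames
variable {E : Type v} [NormedAddCommGroup E] [NormedSpace ℝ E] [FiniteDimensional ℝ E]
  {M : Type u} [TopologicalSpace M] [T2Space M] [ChartedSpace E M] [IsManifold 𝓘(ℝ, E) ∞ M]
  {τ : SmoothInvolution E M}

namespace FlatRealLineBundle

/-- Real flat frames of `L` over the members of a cover, with transition functions `g`. -/
structure IsCocycleFrame (L : FlatRealLineBundle τ) (𝒰 : EquivariantCover τ)
    (g : 𝒰.ι → 𝒰.ι → M → ℂ) (e : 𝒰.ι → ∀ x, L.Fiber x) : Prop where
  isFlatFrame : ∀ i, L.IsFlatFrame (e i) (𝒰.U i)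
  map_σ : ∀ i x, x ∈ 𝒰.U i → L.σ x (e i x) = e (𝒰.inv i) (τ x)
  eq_smul : ∀ i j x, x ∈ 𝒰.U i → x ∈ 𝒰.U j → e j x = g i j x • e i x

/-- `L` is represented by the cocycle `g`. -/
def HasCocycle (L : FlatRealLineBundle τ) (𝒰 : EquivariantCover τ)
    (g : 𝒰.ι → 𝒰.ι → M → ℂ) : Prop :=
  ∃ e, L.IsCocycleFrame 𝒰 g e

variable {L : FlatRealLineBundle τ} {𝒰 : EquivariantCover τ} {g : 𝒰.ι → 𝒰.ι → M → ℂ}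

namespace IsCocycleFrame

variable {e : 𝒰.ι → ∀ x, L.Fiber x} (he : L.IsCocycleFrame 𝒰 g e)

include he

omit [FiniteDimensional ℝ E] [T2Space M] in
lemma herm_eq {i j : 𝒰.ι} {x : M} (hi : x ∈ 𝒰.U i) (hj : x ∈ 𝒰.U j) :
    L.herm x (e i x) (e j x) = g i j x := by
  rw [he.eq_smul i j x hi hj, LinearMap.map_smul, (he.isFlatFrame i).unit x hi, smul_eq_mul,
    mul_one]

/-- Everything follows from `g_ij = h(e_i, e_j)`: flatness gives local constancy, unit length gives
modulus one, comparison of three frames gives the product rule, and `herm_σ` gives equivariance. -/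
lemma isCocycle : IsCocycle 𝒰 g where
  locConst i j x hi hj := by
    have hW : IsOpen ((𝒰.U i : Set M) ∩ 𝒰.U j) := (𝒰.U i).isOpen.inter (𝒰.U j).isOpen
    filter_upwards [((he.isFlatFrame i).mono Set.inter_subset_left).eventually_herm_eq
      ((he.isFlatFrame j).mono Set.inter_subset_right) hW ⟨hi, hj⟩,
      𝒰.inter₂_mem_nhds hi hj] with y hy hy'
    rwa [he.herm_eq hi hj, he.herm_eq hy'.1 hy'.2] at hy
  norm i j x hi hj := by
    rw [← he.herm_eq hi hj]
    exact ((he.isFlatFrame i).mono Set.inter_subset_left).norm_herm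
      ((he.isFlatFrame j).mono Set.inter_subset_right) ⟨hi, hj⟩
  mul i j k x hi hj hk := by
    rw [← he.herm_eq hi hk, he.eq_smul j k x hj hk, LinearMap.map_smul, he.herm_eq hi hj,
      smul_eq_mul, mul_comm]
  map_inv i j x hi hj := by
    rw [← he.herm_eq hi hj, ← he.herm_eq (𝒰.inv_mem hi) (𝒰.inv_mem hj), ← he.map_σ i x hi,
      ← he.map_σ j x hj, L.herm_σ]

end IsCocycleFrame

lemma HasCocycle.isCocycle (h : L.HasCocycle 𝒰 g) : IsCocycle 𝒰 g := h.choose_spec.isCocycle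

/-- Only the values of a cocycle on the intersections of the cover matter. -/
lemma HasCocycle.congr (h : L.HasCocycle 𝒰 g) {g' : 𝒰.ι → 𝒰.ι → M → ℂ}
    (hg : ∀ i j x, x ∈ 𝒰.U i → x ∈ 𝒰.U j → g' i j x = g i j x) : L.HasCocycle 𝒰 g' := by
  obtain ⟨e, he⟩ := h
  exact ⟨e, he.isFlatFrame, he.map_σ, fun i j x hi hj => by rw [he.eq_smul i j x hi hj, hg i j x hi hj]⟩

end FlatRealLineBundle

omit [T2Space M] in
/-- Every cocycle is the cocycle of a flat Real line bundle. -/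
theorem IsCocycle.hasCocycle_flatBundle {𝒰 : EquivariantCover τ} {g : 𝒰.ι → 𝒰.ι → M → ℂ}
    (hg : IsCocycle 𝒰 g) : (Realisation.flatBundle hg).HasCocycle 𝒰 g := by
  -- The frame over `U_i` has the preferred coordinate `g_{indexAt x, i}`, and by the product rule
  -- its coordinate over `U_j` is `g_ji`, in particular `1` over `U_i`.
  have hc : ∀ i j x, x ∈ 𝒰.U i → x ∈ 𝒰.U j →
      Realisation.coordFun hg j (fun x => Realisation.ofC hg x (g (𝒰.indexAt x) i x)) x = g j i x :=
    fun i j x hi hj => hg.mul j _ i x hj (𝒰.mem_indexAt x) hi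
  refine ⟨fun i x => Realisation.ofC hg x (g (𝒰.indexAt x) i x), fun i => ⟨?_, ?_, ?_⟩, ?_, ?_⟩
  · intro x hx
    refine ContMDiffAt.contMDiffWithinAt ((Realisation.contMDiffAt_iff hg (f := fun x =>
      TotalSpace.mk' ℂ x (Realisation.ofC hg x (g (𝒰.indexAt x) i x))) hx).2 ⟨contMDiffAt_id, ?_⟩)
    refine (contMDiffAt_const (c := (1 : ℂ))).congr_of_eventuallyEq ?_
    filter_upwards [(𝒰.U i).isOpen.mem_nhds hx] with y hy
    exact (hc i i y hy hy).trans (hg.self hy)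
  · intro x hx
    exact hg.conj_mul (𝒰.mem_indexAt x) hx
  · intro x hx
    have h : Realisation.coordFun hg (𝒰.indexAt x)
        (fun x => Realisation.ofC hg x (g (𝒰.indexAt x) i x)) =ᶠ[𝓝 x]
        fun _ => g (𝒰.indexAt x) i x := by
      filter_upwards [hg.locConst _ i x (𝒰.mem_indexAt x) hx,
        𝒰.inter₂_mem_nhds (𝒰.mem_indexAt x) hx] with y hy hy'
      rw [hc i _ y hy'.2 hy'.1, hy]
    exact (dC_congr h).trans (dC_const _ x)
  · intro i x hx
    change g (𝒰.indexAt (τ x)) (𝒰.inv (𝒰.indexAt x)) (τ x) * conj (g (𝒰.indexAt x) i x) =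
      g (𝒰.indexAt (τ x)) (𝒰.inv i) (τ x)
    rw [← hg.map_inv _ _ _ (𝒰.mem_indexAt x) hx, hg.mul _ _ _ _ (𝒰.mem_indexAt _)
      (𝒰.inv_mem (𝒰.mem_indexAt x)) (𝒰.inv_mem hx)]
  · intro i j x hi hj
    change g (𝒰.indexAt x) j x = g i j x * g (𝒰.indexAt x) i x
    rw [mul_comm, hg.mul _ _ _ _ (𝒰.mem_indexAt x) hi hj]

end CocycleFrames

/-! ### Equivariant covers and common refinements -/

section Covers
variable {E : Type v} [NormedAddCommGroup E] [NormedSpace ℝ E]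
  {M : Type u} [TopologicalSpace M] [ChartedSpace E M]
  {τ : SmoothInvolution E M}

namespace EquivariantCover

/-- The equivariant cover by the sets `V x` and their translates. -/
def double (τ : SmoothInvolution E M) (V : M → Opens M) (hV : ∀ x, x ∈ V x) :
    EquivariantCover τ where
  -- The Boolean factor keeps the involution of the indices free even where `τ` has fixed points.
  ι := M × Bool
  U i := if i.2 then ⟨τ ⁻¹' V i.1, (V i.1).isOpen.preimage τ.contMDiff.continuous⟩ else V i.1
  covers x := ⟨(x, false), hV x⟩
  inv i := (i.1, !i.2)
  inv_involutive i := by simp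
  inv_ne i h := by simpa using congrArg Prod.snd h
  mem_inv i x := by
    obtain ⟨a, b⟩ := i
    cases b
    · exact Iff.rfl
    · change x ∈ V a ↔ τ (τ x) ∈ V a
      rw [τ.involutive x]

/-- The common refinement of two covers. -/
def inf (𝒰 𝒱 : EquivariantCover τ) : EquivariantCover τ where
  ι := 𝒰.ι × 𝒱.ι
  U i := 𝒰.U i.1 ⊓ 𝒱.U i.2
  covers x := ⟨(𝒰.indexAt x, 𝒱.indexAt x), 𝒰.mem_indexAt x, 𝒱.mem_indexAt x⟩
  inv i := (𝒰.inv i.1, 𝒱.inv i.2)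
  inv_involutive i := Prod.ext (𝒰.inv_involutive _) (𝒱.inv_involutive _)
  inv_ne i h := 𝒰.inv_ne i.1 (congrArg Prod.fst h)
  mem_inv i x := and_congr (𝒰.mem_inv i.1 x) (𝒱.mem_inv i.2 x)

/-- The projection of a common refinement to the first cover. -/
def infFst (𝒰 𝒱 : EquivariantCover τ) : Refinement (inf 𝒰 𝒱) 𝒰 where
  toFun := Prod.fst
  map_inv _ := rfl
  le _ := inf_le_left

/-- The projection of a common refinement to the second cover. -/
def infSnd (𝒰 𝒱 : EquivariantCover τ) : Refinement (inf 𝒰 𝒱) 𝒱 where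
  toFun := Prod.snd
  map_inv _ := rfl
  le _ := inf_le_right

/-- The composition of refinement maps. -/
def Refinement.comp {𝒰 𝒱 𝒲 : EquivariantCover τ} (φ : Refinement 𝒱 𝒰) (ψ : Refinement 𝒲 𝒱) :
    Refinement 𝒲 𝒰 where
  toFun := φ.toFun ∘ ψ.toFun
  map_inv i := by
    change φ.toFun (ψ.toFun (𝒲.inv i)) = 𝒰.inv (φ.toFun (ψ.toFun i))
    rw [ψ.map_inv, φ.map_inv]
  le i := (ψ.le i).trans (φ.le _)

/-- The identity refinement. -/
def Refinement.id (𝒰 : EquivariantCover τ) : Refinement 𝒰 𝒰 where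
  toFun i := i
  map_inv _ := rfl
  le _ := le_rfl

end EquivariantCover

/-- A Real locally constant `U(1)`-valued zero-cochain. -/
structure IsGauge (𝒰 : EquivariantCover τ) (c : 𝒰.ι → M → ℂ) : Prop where
  locConst : ∀ i x, x ∈ 𝒰.U i → ∀ᶠ y in 𝓝 x, c i y = c i x
  norm : ∀ i x, x ∈ 𝒰.U i → ‖c i x‖ = 1
  map_inv : ∀ i x, x ∈ 𝒰.U i → c (𝒰.inv i) (τ x) = conj (c i x)

end Covers

/-! ### Comparing flat Real line bundles through their cocycles -/

section Frames
variable {E : Type v} [NormedAddCommGroup E] [NormedSpace ℝ E] [FiniteDimensional ℝ E]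
  {M : Type u} [TopologicalSpace M] [T2Space M] [ChartedSpace E M] [IsManifold 𝓘(ℝ, E) ∞ M]
  {τ : SmoothInvolution E M}

namespace FlatRealLineBundle

variable {L L' N : FlatRealLineBundle τ} {𝒰 𝒱 : EquivariantCover τ} {g g' : 𝒰.ι → 𝒰.ι → M → ℂ}

omit [FiniteDimensional ℝ E] [T2Space M] in
lemma hasCocycle_of_frames {e : 𝒰.ι → ∀ x, L.Fiber x} (he : ∀ i, L.IsFlatFrame (e i) (𝒰.U i))
    (hσ : ∀ i x, x ∈ 𝒰.U i → L.σ x (e i x) = e (𝒰.inv i) (τ x)) :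
    L.HasCocycle 𝒰 fun i j x => L.herm x (e i x) (e j x) :=
  ⟨e, he, hσ, fun i _ x hi _ => RealLineBundle.eq_herm_smul ((he i).unit x hi) _⟩

/-- Every flat Real line bundle is represented by a cocycle of some cover. -/
theorem exists_hasCocycle (L : FlatRealLineBundle τ) :
    ∃ (𝒰 : EquivariantCover τ) (g : 𝒰.ι → 𝒰.ι → M → ℂ), L.HasCocycle 𝒰 g := by
  choose V e hV hx he using L.exists_isFlatFrame
  let 𝒰 := EquivariantCover.double τ (fun x => ⟨V x, hV x⟩) hx
  -- The translated set carries the conjugate section as its frame. The two sets of a pair have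
  -- distinct indices, so the first frame need not satisfy any reality condition, even when the sets
  -- coincide.
  refine ⟨𝒰, _, hasCocycle_of_frames (𝒰 := 𝒰)
    (e := fun i => if i.2 then L.conjSec (e i.1) else e i.1) ?_ ?_⟩
  · rintro ⟨a, _ | _⟩
    · exact he a
    · exact (he a).conjSec (hV a)
  · rintro ⟨a, _ | _⟩ x -
    · exact (L.conjSec_apply_inv (e a) x).symm
    · exact L.σ_conjSec (e a) x

omit [FiniteDimensional ℝ E] [T2Space M] in
lemma HasCocycle.pullback (h : L.HasCocycle 𝒰 g) (φ : EquivariantCover.Refinement 𝒱 𝒰) :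
    L.HasCocycle 𝒱 fun a b => g (φ.toFun a) (φ.toFun b) := by
  obtain ⟨e, he⟩ := h
  refine ⟨fun a => e (φ.toFun a), fun a => (he.isFlatFrame _).mono (φ.le a), fun a x hx => ?_,
    fun a b x ha hb => he.eq_smul _ _ x (φ.le a ha) (φ.le b hb)⟩
  rw [he.map_σ _ x (φ.le a hx), φ.map_inv]

/-- Rescale the frames to `c_i e_i`: then `c_j e_j = g_ij c_j e_i = g'_ij (c_i e_i)`. -/
lemma HasCocycle.gauge (h : L.HasCocycle 𝒰 g) {c : 𝒰.ι → M → ℂ} (hc : IsGauge 𝒰 c)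
    (hg : ∀ i j x, x ∈ 𝒰.U i → x ∈ 𝒰.U j → g' i j x * c i x = g i j x * c j x) :
    L.HasCocycle 𝒰 g' := by
  obtain ⟨e, he⟩ := h
  refine ⟨fun i x => c i x • e i x, fun i => (he.isFlatFrame i).smul (𝒰.U i).isOpen
    (fun x hx => hc.locConst i x hx) (fun x hx => hc.norm i x hx), fun i x hx => ?_,
    fun i j x hi hj => ?_⟩
  · rw [LinearMap.map_smulₛₗ, he.map_σ i x hx, hc.map_inv i x hx]
  · rw [he.eq_smul i j x hi hj, smul_smul, smul_smul, hg i j x hi hj, mul_comm]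

/-- The converse of `gauge`. The gauge is the ratio `c_i = h(e_i, e'_i)` of the two flat frames, and
the relation comes from expanding `h(e_i, e'_j)` in two ways. -/
lemma HasCocycle.exists_gauge (h : L.HasCocycle 𝒰 g) (h' : L.HasCocycle 𝒰 g') :
    ∃ c, IsGauge 𝒰 c ∧
      ∀ i j x, x ∈ 𝒰.U i → x ∈ 𝒰.U j → g' i j x * c i x = g i j x * c j x := by
  obtain ⟨e, he⟩ := h
  obtain ⟨e', he'⟩ := h'
  refine ⟨fun i x => L.herm x (e i x) (e' i x), ⟨fun i x hx => ?_, fun i x hx => ?_,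
    fun i x hx => ?_⟩, fun i j x hi hj => ?_⟩
  · exact (he.isFlatFrame i).eventually_herm_eq (he'.isFlatFrame i) (𝒰.U i).isOpen hx
  · exact (he.isFlatFrame i).norm_herm (he'.isFlatFrame i) hx
  · rw [← L.herm_σ, he.map_σ i x hx, he'.map_σ i x hx]
  · have h1 : L.herm x (e i x) (e' j x) = g' i j x * L.herm x (e i x) (e' i x) := by
      rw [he'.eq_smul i j x hi hj, LinearMap.map_smul, smul_eq_mul]
    have h2 : L.herm x (e i x) (e' j x) = L.herm x (e j x) (e' j x) * g i j x := by
      conv_lhs => rw [RealLineBundle.eq_herm_smul ((he.isFlatFrame j).unit x hj) (e' j x)]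
      rw [LinearMap.map_smul, smul_eq_mul, he.herm_eq hi hj]
    rw [← h1, h2, mul_comm]

lemma HasCocycle.of_iso (h : L.HasCocycle 𝒰 g) (f : Iso L L') : L'.HasCocycle 𝒰 g := by
  obtain ⟨e, he⟩ := h
  refine ⟨fun i x => f.map x (e i x), fun i => ⟨?_, fun x hx => ?_, fun x hx => ?_⟩,
    fun i x hx => ?_, fun i j x hi hj => ?_⟩
  · exact f.smooth.comp_contMDiffOn (he.isFlatFrame i).smooth
  · rw [f.map_herm, (he.isFlatFrame i).unit x hx]
  · obtain ⟨t, ht, hte⟩ := (he.isFlatFrame i).smooth.exists_global (𝒰.U i).isOpen hx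
    ext w
    have h1 := f.map_conn t ht x w
    rw [L.conn.cov_congr ((ht x).mdifferentiableAt (by simp)) hte,
      (he.isFlatFrame i).flat x hx] at h1
    have h2 : SmoothSection (E := E) fun y => f.map y (t y) := f.smooth.comp ht
    rw [L'.conn.cov_congr ((h2 x).mdifferentiableAt (by simp))
      (t := fun y => f.map y (e i y)) (hte.mono fun y hy => by rw [hy])] at h1
    rw [h1]
    exact map_zero (f.map x)
  · rw [← f.map_σ, he.map_σ i x hx]
  · rw [he.eq_smul i j x hi hj, LinearEquiv.map_smul]

/-- The map between line bundles which sends the frame `e` to the frame `e'`. -/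
def frameMap (e : ∀ x, L.Fiber x) (e' : ∀ x, L'.Fiber x) (x : M) : L.Fiber x →ₗ[ℂ] L'.Fiber x :=
  (L.herm x (e x)).smulRight (e' x)

section

variable {e : 𝒰.ι → ∀ x, L.Fiber x} {e' : 𝒰.ι → ∀ x, L'.Fiber x}
  (he : L.IsCocycleFrame 𝒰 g e) (he' : L'.IsCocycleFrame 𝒰 g e')

-- Both families of frames change by the same `g_ij`, which comes out conjugated from the metric and
-- unconjugated from `e'`. As `conj g_ij * g_ij = 1`, the local maps glue.
include he he' in
lemma frameMap_eq {i j : 𝒰.ι} {x : M} (hi : x ∈ 𝒰.U i) (hj : x ∈ 𝒰.U j) (u : L.Fiber x) :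
    frameMap (e i) (e' i) x u = frameMap (e j) (e' j) x u := by
  have h := he.isCocycle.conj_mul hi hj
  change L.herm x (e i x) u • e' i x = L.herm x (e j x) u • e' j x
  rw [he.eq_smul i j x hi hj, he'.eq_smul i j x hi hj]
  simp only [LinearMap.map_smulₛₗ, LinearMap.smul_apply, smul_smul, smul_eq_mul]
  congr 1
  linear_combination (-L.herm x (e i x) u) * h

include he he' in
lemma frameMap_frameMap {i : 𝒰.ι} {x : M} (hi : x ∈ 𝒰.U i) (u : L.Fiber x) :
    frameMap (e' i) (e i) x (frameMap (e i) (e' i) x u) = u := by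
  change L'.herm x (e' i x) (L.herm x (e i x) u • e' i x) • e i x = u
  rw [LinearMap.map_smul, (he'.isFlatFrame i).unit x hi, smul_eq_mul, mul_one]
  exact (RealLineBundle.eq_herm_smul ((he.isFlatFrame i).unit x hi) u).symm

include he he' in
lemma contMDiff_frameMap : ContMDiff (𝓘(ℝ, E).prod 𝓘(ℝ, ℂ)) (𝓘(ℝ, E).prod 𝓘(ℝ, ℂ)) ∞
    fun p : TotalSpace ℂ L.Fiber => TotalSpace.mk' ℂ p.proj
      (frameMap (e (𝒰.indexAt p.proj)) (e' (𝒰.indexAt p.proj)) p.proj p.snd) := by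
  intro p
  have hi := 𝒰.mem_indexAt p.proj
  have h1 := RealLineBundle.contMDiffAt_coeff (𝒰.U _).isOpen
    (he.isFlatFrame (𝒰.indexAt p.proj)).smooth (he.isFlatFrame _).unit
    (contMDiffAt_id (I := 𝓘(ℝ, E).prod 𝓘(ℝ, ℂ)) (x := p)) hi
  have h2 := RealLineBundle.contMDiffAt_smul_section (Bundle.contMDiffAt_proj L.Fiber (p := p)) h1
    ((he'.isFlatFrame _).smooth.contMDiffAt (𝒰.U _).isOpen hi)
  refine h2.congr_of_eventuallyEq ?_
  filter_upwards [(Bundle.contMDiffAt_proj (n := ∞) (IB := 𝓘(ℝ, E)) L.Fiber (p := p)).continuousAt.preimage_mem_nhds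
    ((𝒰.U _).isOpen.mem_nhds hi)] with q hq
  exact congrArg (TotalSpace.mk' ℂ q.proj) (frameMap_eq he he' (𝒰.mem_indexAt _) hq q.snd)

/-- Bundles with the same cocycle are isomorphic. -/
def isoOfFrames : Iso L L' where
  map x := LinearEquiv.ofLinearMap (frameMap (e (𝒰.indexAt x)) (e' (𝒰.indexAt x)) x)
    (frameMap (e' (𝒰.indexAt x)) (e (𝒰.indexAt x)) x)
    (LinearMap.ext fun u => frameMap_frameMap he' he (𝒰.mem_indexAt x) u)
    (LinearMap.ext fun u => frameMap_frameMap he he' (𝒰.mem_indexAt x) u)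
  smooth := contMDiff_frameMap he he'
  smooth_symm := contMDiff_frameMap he' he
  map_herm x u w := by
    have hi := 𝒰.mem_indexAt x
    change L'.herm x (L.herm x (e (𝒰.indexAt x) x) u • e' (𝒰.indexAt x) x)
      (L.herm x (e (𝒰.indexAt x) x) w • e' (𝒰.indexAt x) x) = _
    have hu := RealLineBundle.eq_herm_smul ((he.isFlatFrame (𝒰.indexAt x)).unit x hi)
    refine Eq.trans ?_ (congrArg₂ (fun u w => L.herm x u w) (hu u) (hu w)).symm
    simp only [LinearMap.map_smulₛₗ, LinearMap.smul_apply,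
      (he.isFlatFrame _).unit x hi, (he'.isFlatFrame _).unit x hi]
  map_σ x u := by
    have hi := 𝒰.mem_indexAt x
    change frameMap (e (𝒰.indexAt (τ x))) (e' (𝒰.indexAt (τ x))) (τ x) (L.σ x u) =
      L'.σ x (L.herm x (e (𝒰.indexAt x) x) u • e' (𝒰.indexAt x) x)
    rw [frameMap_eq he he' (𝒰.mem_indexAt _) (𝒰.inv_mem hi), LinearMap.map_smulₛₗ,
      he'.map_σ _ x hi]
    change L.herm (τ x) (e _ (τ x)) (L.σ x u) • e' (𝒰.inv (𝒰.indexAt x)) (τ x) = _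
    rw [← he.map_σ _ x hi, L.herm_σ]
  map_conn s hs x w := by
    have hi := 𝒰.mem_indexAt x
    have hW := (𝒰.U (𝒰.indexAt x)).isOpen
    have hf := he'.isFlatFrame (𝒰.indexAt x)
    have hs' : L.SmoothOn s (𝒰.U (𝒰.indexAt x)) := (RealLineBundle.smoothOn_univ.2 hs).mono
      (Set.subset_univ _)
    have h1 : SmoothSection (E := E) fun y => frameMap (e (𝒰.indexAt y)) (e' (𝒰.indexAt y)) y (s y) :=
      (contMDiff_frameMap he he').comp hs
    refine (hf.cov_eq hW ((RealLineBundle.smoothOn_univ.2 h1).mono (Set.subset_univ _)) hi w).trans ?_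
    change _ = L.herm x (e (𝒰.indexAt x) x) (L.conn.cov s x w) • e' (𝒰.indexAt x) x
    rw [(he.isFlatFrame (𝒰.indexAt x)).cov_eq hW hs' hi w, LinearMap.map_smul,
      (he.isFlatFrame _).unit x hi, smul_eq_mul, mul_one]
    congr 1
    refine congrArg (fun A : E →L[ℝ] ℂ => A w) (dC_congr ?_)
    filter_upwards [hW.mem_nhds hi] with y hy
    rw [frameMap_eq he he' (𝒰.mem_indexAt y) hy]
    change L'.herm y _ (L.herm y (e (𝒰.indexAt x) y) (s y) • e' (𝒰.indexAt x) y) = _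
    rw [LinearMap.map_smul, hf.unit y hy, smul_eq_mul, mul_one]

end

lemma HasCocycle.nonempty_iso (h : L.HasCocycle 𝒰 g) (h' : L'.HasCocycle 𝒰 g) :
    Nonempty (Iso L L') := by
  obtain ⟨e, he⟩ := h
  obtain ⟨e', he'⟩ := h'
  exact ⟨isoOfFrames he he'⟩

end FlatRealLineBundle
end Frames

/-! ### Products and inverses of cocycles -/

section CocycleOps
variable {E : Type v} [NormedAddCommGroup E] [NormedSpace ℝ E]
  {M : Type u} [TopologicalSpace M] [ChartedSpace E M]
  {τ : SmoothInvolution E M} {𝒰 : EquivariantCover τ} {g g' : 𝒰.ι → 𝒰.ι → M → ℂ}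

lemma IsCocycle.prod (hg : IsCocycle 𝒰 g) (hg' : IsCocycle 𝒰 g') :
    IsCocycle 𝒰 fun i j x => g i j x * g' i j x where
  locConst i j x hi hj := by
    filter_upwards [hg.locConst i j x hi hj, hg'.locConst i j x hi hj] with y h1 h2
    rw [h1, h2]
  norm i j x hi hj := by rw [norm_mul, hg.norm i j x hi hj, hg'.norm i j x hi hj, mul_one]
  mul i j k x hi hj hk := by
    rw [mul_mul_mul_comm, hg.mul i j k x hi hj hk, hg'.mul i j k x hi hj hk]
  map_inv i j x hi hj := by rw [hg.map_inv i j x hi hj, hg'.map_inv i j x hi hj, map_mul]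

/-- For numbers of modulus one the conjugate is the inverse. -/
lemma IsCocycle.inverse (hg : IsCocycle 𝒰 g) : IsCocycle 𝒰 fun i j x => conj (g i j x) where
  locConst i j x hi hj := by
    filter_upwards [hg.locConst i j x hi hj] with y h1
    rw [h1]
  norm i j x hi hj := by rw [Complex.norm_conj, hg.norm i j x hi hj]
  mul i j k x hi hj hk := by rw [← map_mul, hg.mul i j k x hi hj hk]
  map_inv i j x hi hj := by rw [hg.map_inv i j x hi hj]

lemma IsCocycle.one (𝒰 : EquivariantCover τ) : IsCocycle 𝒰 fun _ _ _ => (1 : ℂ) where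
  locConst _ _ _ _ _ := Filter.Eventually.of_forall fun _ => rfl
  norm _ _ _ _ _ := norm_one
  mul _ _ _ _ _ _ _ := mul_one 1
  map_inv _ _ _ _ _ := (map_one _).symm

end CocycleOps

/-! ### Tensor products and the group of isomorphism classes -/

section Tensor
variable {E : Type v} [NormedAddCommGroup E] [NormedSpace ℝ E] [FiniteDimensional ℝ E]
  {M : Type u} [TopologicalSpace M] [T2Space M] [ChartedSpace E M] [IsManifold 𝓘(ℝ, E) ∞ M]
  {τ : SmoothInvolution E M}

namespace FlatRealLineBundle

variable {L L' N : FlatRealLineBundle τ} {𝒰 : EquivariantCover τ} {g g' : 𝒰.ι → 𝒰.ι → M → ℂ}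

/-- A tensor product is represented by the product of the cocycles. -/
lemma HasCocycle.tensor (h : L.HasCocycle 𝒰 g) (h' : L'.HasCocycle 𝒰 g')
    (T : TensorStructure L L' N) : N.HasCocycle 𝒰 fun i j x => g i j x * g' i j x := by
  obtain ⟨e, he⟩ := h
  obtain ⟨e', he'⟩ := h'
  -- The axioms of a tensor structure concern global sections, so both frames are replaced near `x`
  -- by global sections with the same germs.
  have key : ∀ i, ∀ x ∈ 𝒰.U i, ∃ (t : ∀ x, L.Fiber x) (t' : ∀ x, L'.Fiber x),
      SmoothSection (E := E) t ∧ SmoothSection (E := E) t' ∧ (∀ᶠ y in 𝓝 x, t y = e i y) ∧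
      (∀ᶠ y in 𝓝 x, t' y = e' i y) ∧
      ∀ᶠ y in 𝓝 x, T.pair y (t y) (t' y) = T.pair y (e i y) (e' i y) := by
    intro i x hx
    obtain ⟨t, ht, hte⟩ := (he.isFlatFrame i).smooth.exists_global (𝒰.U i).isOpen hx
    obtain ⟨t', ht', hte'⟩ := (he'.isFlatFrame i).smooth.exists_global (𝒰.U i).isOpen hx
    refine ⟨t, t', ht, ht', hte, hte', ?_⟩
    filter_upwards [hte, hte'] with y h1 h2
    rw [h1, h2]
  refine ⟨fun i x => T.pair x (e i x) (e' i x), fun i => ⟨fun x hx => ?_, fun x hx => ?_,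
    fun x hx => ?_⟩, fun i x hx => ?_, fun i j x hi hj => ?_⟩
  · obtain ⟨t, t', ht, ht', -, -, hp⟩ := key i x hx
    refine ContMDiffAt.contMDiffWithinAt ((T.smooth t t' ht ht' x).congr_of_eventuallyEq ?_)
    filter_upwards [hp] with y hy
    rw [hy]
  · rw [T.herm, (he.isFlatFrame i).unit x hx, (he'.isFlatFrame i).unit x hx, mul_one]
  · obtain ⟨t, t', ht, ht', h1, h2, hp⟩ := key i x hx
    rw [← N.conn.cov_congr ((T.smooth t t' ht ht' x).mdifferentiableAt (by simp)) hp]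
    ext w
    rw [T.conn t t' ht ht', L.conn.cov_congr ((ht x).mdifferentiableAt (by simp)) h1,
      L'.conn.cov_congr ((ht' x).mdifferentiableAt (by simp)) h2,
      (he.isFlatFrame i).flat x hx, (he'.isFlatFrame i).flat x hx]
    change T.pair x 0 (t' x) + T.pair x (t x) 0 = 0
    simp
  · rw [T.σ, he.map_σ i x hx, he'.map_σ i x hx]
  · rw [he.eq_smul i j x hi hj, he'.eq_smul i j x hi hj]
    simp [smul_smul, mul_comm]

section

variable (e : ∀ x, L.Fiber x) (e' : ∀ x, L'.Fiber x) (n : ∀ x, N.Fiber x)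

/-- The pairing which sends the frames `e` and `e'` to the frame `n`. -/
def framePair (x : M) : L.Fiber x →ₗ[ℂ] L'.Fiber x →ₗ[ℂ] N.Fiber x :=
  (L.herm x (e x)).smulRight ((L'.herm x (e' x)).smulRight (n x))

omit [FiniteDimensional ℝ E] [T2Space M] in
lemma framePair_apply (x : M) (u : L.Fiber x) (u' : L'.Fiber x) :
    framePair e e' n x u u' = (L.herm x (e x) u * L'.herm x (e' x) u') • n x := by
  change L.herm x (e x) u • (L'.herm x (e' x) u' • n x) = _
  rw [smul_smul]

variable {e e' n}

-- Both sides are lines: `e ⊗ e'` spans the tensor product, and the linear map induced by the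
-- pairing sends it to the nonzero vector `n`.
open scoped TensorProduct in
omit [FiniteDimensional ℝ E] [T2Space M] in
lemma isTensorProduct_framePair {x : M} (he : L.herm x (e x) (e x) = 1)
    (he' : L'.herm x (e' x) (e' x) = 1) (hn : N.herm x (n x) (n x) = 1) :
    IsTensorProduct (framePair e e' n x) := by
  have hspan : ∀ z : L.Fiber x ⊗[ℂ] L'.Fiber x, ∃ c : ℂ, z = c • (e x ⊗ₜ e' x) := by
    intro z
    induction z with
    | zero => exact ⟨0, by simp⟩
    | tmul u u' =>
      refine ⟨L.herm x (e x) u * L'.herm x (e' x) u', ?_⟩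
      conv_lhs => rw [RealLineBundle.eq_herm_smul he u, RealLineBundle.eq_herm_smul he' u']
      rw [TensorProduct.smul_tmul_smul]
    | add a b ha hb =>
      obtain ⟨c, rfl⟩ := ha
      obtain ⟨d, rfl⟩ := hb
      exact ⟨c + d, (add_smul _ _ _).symm⟩
  have hl : ∀ c : ℂ, TensorProduct.lift (framePair e e' n x) (c • (e x ⊗ₜ e' x)) = c • n x := by
    intro c
    rw [LinearMap.map_smul, TensorProduct.lift.tmul, framePair_apply, he, he', mul_one, one_smul]
  have hn0 := RealLineBundle.ne_zero_of_herm_eq_one hn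
  refine ⟨fun a b hab => ?_, fun w => ?_⟩
  · obtain ⟨c, rfl⟩ := hspan a
    obtain ⟨d, rfl⟩ := hspan b
    rw [hl, hl] at hab
    have := congrArg (N.herm x (n x)) hab
    simp only [LinearMap.map_smul, hn, smul_eq_mul, mul_one] at this
    rw [this]
  · exact ⟨_, (hl _).trans (RealLineBundle.eq_herm_smul hn w).symm⟩

end

section

variable {e : 𝒰.ι → ∀ x, L.Fiber x} {e' : 𝒰.ι → ∀ x, L'.Fiber x} {n : 𝒰.ι → ∀ x, N.Fiber x}
  (he : L.IsCocycleFrame 𝒰 g e) (he' : L'.IsCocycleFrame 𝒰 g' e')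
  (hn : N.IsCocycleFrame 𝒰 (fun i j x => g i j x * g' i j x) n)

-- The conjugates of `g_ij` and `g'_ij` that come out of the two metrics cancel against the
-- transition function `g_ij g'_ij` of `n`, so the local pairings glue.
include he he' hn in
lemma framePair_eq {i j : 𝒰.ι} {x : M} (hi : x ∈ 𝒰.U i) (hj : x ∈ 𝒰.U j) (u : L.Fiber x)
    (u' : L'.Fiber x) :
    framePair (e i) (e' i) (n i) x u u' = framePair (e j) (e' j) (n j) x u u' := by
  have h := he.isCocycle.conj_mul hi hj
  have h' := he'.isCocycle.conj_mul hi hj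
  rw [framePair_apply, framePair_apply, he.eq_smul i j x hi hj, he'.eq_smul i j x hi hj,
    hn.eq_smul i j x hi hj]
  simp only [LinearMap.map_smulₛₗ, LinearMap.smul_apply, smul_smul, smul_eq_mul]
  congr 1
  linear_combination (-L.herm x (e i x) u * L'.herm x (e' i x) u') * h -
    (L.herm x (e i x) u * L'.herm x (e' i x) u') * (conj (g i j x) * g i j x) * h'

/-- The product of the cocycles of two bundles represents a tensor product. -/
def tensorStructureOfFrames : TensorStructure L L' N where
  pair x := framePair (e (𝒰.indexAt x)) (e' (𝒰.indexAt x)) (n (𝒰.indexAt x)) x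
  isTensorProduct x := isTensorProduct_framePair
    ((he.isFlatFrame _).unit x (𝒰.mem_indexAt x)) ((he'.isFlatFrame _).unit x (𝒰.mem_indexAt x))
    ((hn.isFlatFrame _).unit x (𝒰.mem_indexAt x))
  smooth s s' hs hs' x := by
    have hi := 𝒰.mem_indexAt x
    have hW := (𝒰.U (𝒰.indexAt x)).isOpen
    have h1 := (he.isFlatFrame (𝒰.indexAt x)).smooth.herm hW
      ((RealLineBundle.smoothOn_univ.2 hs).mono (Set.subset_univ _))
    have h2 := (he'.isFlatFrame (𝒰.indexAt x)).smooth.herm hW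
      ((RealLineBundle.smoothOn_univ.2 hs').mono (Set.subset_univ _))
    refine (RealLineBundle.contMDiffAt_smul_section contMDiffAt_id (contMDiffAt_complex_mul
      (h1.contMDiffAt (hW.mem_nhds hi)) (h2.contMDiffAt (hW.mem_nhds hi)))
      ((hn.isFlatFrame (𝒰.indexAt x)).smooth.contMDiffAt hW hi)).congr_of_eventuallyEq ?_
    filter_upwards [hW.mem_nhds hi] with y hy
    rw [framePair_eq he he' hn (𝒰.mem_indexAt y) hy, framePair_apply]
    rfl
  herm x u w u' w' := by
    have hi := 𝒰.mem_indexAt x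
    have hu := RealLineBundle.eq_herm_smul ((he.isFlatFrame (𝒰.indexAt x)).unit x hi)
    have hu' := RealLineBundle.eq_herm_smul ((he'.isFlatFrame (𝒰.indexAt x)).unit x hi)
    rw [framePair_apply, framePair_apply]
    refine Eq.trans ?_ (congrArg₂ (fun a b => a * b)
      (congrArg₂ (fun u w => L.herm x u w) (hu u) (hu w))
      (congrArg₂ (fun u w => L'.herm x u w) (hu' u') (hu' w'))).symm
    simp only [LinearMap.map_smulₛₗ, LinearMap.smul_apply, (he.isFlatFrame _).unit x hi,
      (he'.isFlatFrame _).unit x hi, (hn.isFlatFrame _).unit x hi, smul_eq_mul, map_mul,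
      RingHom.id_apply]
    ring
  σ x u u' := by
    have hi := 𝒰.mem_indexAt x
    rw [framePair_eq he he' hn (𝒰.mem_indexAt (τ x)) (𝒰.inv_mem hi), framePair_apply,
      framePair_apply, LinearMap.map_smulₛₗ, hn.map_σ _ x hi, ← he.map_σ _ x hi,
      ← he'.map_σ _ x hi, L.herm_σ, L'.herm_σ, map_mul]
  conn s s' hs hs' x w := by
    have hi := 𝒰.mem_indexAt x
    have hW := (𝒰.U (𝒰.indexAt x)).isOpen
    have hsW : L.SmoothOn s (𝒰.U (𝒰.indexAt x)) :=
      (RealLineBundle.smoothOn_univ.2 hs).mono (Set.subset_univ _)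
    have hsW' : L'.SmoothOn s' (𝒰.U (𝒰.indexAt x)) :=
      (RealLineBundle.smoothOn_univ.2 hs').mono (Set.subset_univ _)
    have h1 := (he.isFlatFrame (𝒰.indexAt x)).smooth.herm hW hsW
    have h2 := (he'.isFlatFrame (𝒰.indexAt x)).smooth.herm hW hsW'
    have h3 : ContMDiffOn 𝓘(ℝ, E) 𝓘(ℝ, ℂ) ∞ (fun y => L.herm y (e (𝒰.indexAt x) y) (s y) *
        L'.herm y (e' (𝒰.indexAt x) y) (s' y)) (𝒰.U (𝒰.indexAt x)) := fun y hy =>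
      (contMDiffAt_complex_mul (h1.contMDiffAt (hW.mem_nhds hy))
        (h2.contMDiffAt (hW.mem_nhds hy))).contMDiffWithinAt
    have hm1 := (h1.contMDiffAt (hW.mem_nhds hi)).mdifferentiableAt (by simp)
    have hm2 := (h2.contMDiffAt (hW.mem_nhds hi)).mdifferentiableAt (by simp)
    have hnf := hn.isFlatFrame (𝒰.indexAt x)
    have hsm := hnf.smooth.smul hW h3
    have hev : ∀ᶠ y in 𝓝 x, (L.herm y (e (𝒰.indexAt x) y) (s y) *
        L'.herm y (e' (𝒰.indexAt x) y) (s' y)) • n (𝒰.indexAt x) y =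
        framePair (e (𝒰.indexAt y)) (e' (𝒰.indexAt y)) (n (𝒰.indexAt y)) y (s y) (s' y) := by
      filter_upwards [hW.mem_nhds hi] with y hy
      rw [framePair_eq he he' hn (𝒰.mem_indexAt y) hy, framePair_apply]
    rw [← N.conn.cov_congr (hsm.mdifferentiableAt hW hi) hev, N.conn.cov_smul hW h3 hnf.smooth hi,
      hnf.flat x hi, dC_mul_apply hm1 hm2, framePair_apply, framePair_apply,
      (he.isFlatFrame (𝒰.indexAt x)).cov_eq hW hsW hi,
      (he'.isFlatFrame (𝒰.indexAt x)).cov_eq hW hsW' hi]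
    simp only [LinearMap.map_smul, (he.isFlatFrame _).unit x hi, (he'.isFlatFrame _).unit x hi,
      smul_eq_mul, mul_one, ← add_smul]
    rw [show (0 : TangentSpace 𝓘(ℝ, E) x →L[ℝ] N.Fiber x) w = 0 from rfl, smul_zero, zero_add]
    congr 1
    ring

end

lemma exists_common_cover (L L' : FlatRealLineBundle τ) :
    ∃ (𝒰 : EquivariantCover τ) (g g' : 𝒰.ι → 𝒰.ι → M → ℂ),
      L.HasCocycle 𝒰 g ∧ L'.HasCocycle 𝒰 g' := by
  obtain ⟨𝒰, g, h⟩ := L.exists_hasCocycle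
  obtain ⟨𝒱, g', h'⟩ := L'.exists_hasCocycle
  exact ⟨𝒰.inf 𝒱, _, _, h.pullback (𝒰.infFst 𝒱), h'.pullback (𝒰.infSnd 𝒱)⟩

/-- Tensor products exist. -/
theorem exists_tensor (L L' : FlatRealLineBundle τ) :
    ∃ N : FlatRealLineBundle τ, Nonempty (TensorStructure L L' N) := by
  obtain ⟨𝒰, g, g', ⟨e, he⟩, ⟨e', he'⟩⟩ := exists_common_cover L L'
  obtain ⟨n, hn⟩ := (he.isCocycle.prod he'.isCocycle).hasCocycle_flatBundle
  exact ⟨_, ⟨tensorStructureOfFrames he he' hn⟩⟩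

namespace IsoClass

/-- An isomorphism class is represented by the cocycle `g`. -/
def HasCocycle (a : IsoClass τ) (𝒰 : EquivariantCover τ) (g : 𝒰.ι → 𝒰.ι → M → ℂ) : Prop :=
  FlatRealLineBundle.HasCocycle (Quotient.out a) 𝒰 g

omit [FiniteDimensional ℝ E] [T2Space M] in
lemma isoClass_out (a : IsoClass τ) : isoClass (Quotient.out a) = a := Quotient.out_eq a

/-- A cocycle of a class is tested on a chosen representative; by `of_iso` every other
representative gives the same answer. -/
lemma hasCocycle_isoClass {L : FlatRealLineBundle τ} :
    (isoClass L).HasCocycle 𝒰 g ↔ L.HasCocycle 𝒰 g := by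
  obtain ⟨f⟩ : Nonempty (Iso (Quotient.out (isoClass L)) L) := Quotient.exact (isoClass_out _)
  exact ⟨fun h => FlatRealLineBundle.HasCocycle.of_iso h f,
    fun h => FlatRealLineBundle.HasCocycle.of_iso h f.symm⟩

lemma HasCocycle.isCocycle {a : IsoClass τ} (h : a.HasCocycle 𝒰 g) : IsCocycle 𝒰 g :=
  FlatRealLineBundle.HasCocycle.isCocycle h

lemma HasCocycle.congr {a : IsoClass τ} (h : a.HasCocycle 𝒰 g)
    (hg : ∀ i j x, x ∈ 𝒰.U i → x ∈ 𝒰.U j → g' i j x = g i j x) : a.HasCocycle 𝒰 g' :=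
  FlatRealLineBundle.HasCocycle.congr h hg

omit [FiniteDimensional ℝ E] [T2Space M] in
lemma HasCocycle.pullback {a : IsoClass τ} (h : a.HasCocycle 𝒰 g) {𝒱 : EquivariantCover τ}
    (φ : EquivariantCover.Refinement 𝒱 𝒰) :
    a.HasCocycle 𝒱 fun i j => g (φ.toFun i) (φ.toFun j) :=
  FlatRealLineBundle.HasCocycle.pullback h φ

lemma HasCocycle.gauge {a : IsoClass τ} (h : a.HasCocycle 𝒰 g) {c : 𝒰.ι → M → ℂ}
    (hc : IsGauge 𝒰 c)
    (hg : ∀ i j x, x ∈ 𝒰.U i → x ∈ 𝒰.U j → g' i j x * c i x = g i j x * c j x) :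
    a.HasCocycle 𝒰 g' :=
  FlatRealLineBundle.HasCocycle.gauge h hc hg

lemma HasCocycle.exists_gauge {a : IsoClass τ} (h : a.HasCocycle 𝒰 g) (h' : a.HasCocycle 𝒰 g') :
    ∃ c, IsGauge 𝒰 c ∧
      ∀ i j x, x ∈ 𝒰.U i → x ∈ 𝒰.U j → g' i j x * c i x = g i j x * c j x :=
  FlatRealLineBundle.HasCocycle.exists_gauge h h'

/-- Bundles with equal cocycles are isomorphic. This reduces an identity between classes to an
identity between cocycles on a common refinement. -/
lemma HasCocycle.unique {a b : IsoClass τ} (ha : a.HasCocycle 𝒰 g) (hb : b.HasCocycle 𝒰 g) :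
    a = b := by
  rw [← isoClass_out a, ← isoClass_out b]
  exact Quotient.sound (FlatRealLineBundle.HasCocycle.nonempty_iso ha hb)

lemma exists_hasCocycle (a : IsoClass τ) :
    ∃ (𝒰 : EquivariantCover τ) (g : 𝒰.ι → 𝒰.ι → M → ℂ), a.HasCocycle 𝒰 g :=
  FlatRealLineBundle.exists_hasCocycle _

lemma _root_.RealDeligne.IsCocycle.exists_isoClass (hg : IsCocycle 𝒰 g) :
    ∃ a : IsoClass τ, a.HasCocycle 𝒰 g :=
  ⟨_, hasCocycle_isoClass.2 hg.hasCocycle_flatBundle⟩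

/-- The tensor product of isomorphism classes. -/
scoped instance instMul : Mul (IsoClass τ) :=
  ⟨fun a b => isoClass (exists_tensor (Quotient.out a) (Quotient.out b)).choose⟩

lemma HasCocycle.mul {a b : IsoClass τ} (ha : a.HasCocycle 𝒰 g) (hb : b.HasCocycle 𝒰 g') :
    (a * b).HasCocycle 𝒰 fun i j x => g i j x * g' i j x :=
  hasCocycle_isoClass.2 (FlatRealLineBundle.HasCocycle.tensor ha hb
    (exists_tensor (Quotient.out a) (Quotient.out b)).choose_spec.some)

/-- The class of the trivial bundle. -/
scoped instance instOne : One (IsoClass τ) :=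
  ⟨isoClass (Realisation.flatBundle (IsCocycle.one
    (EquivariantCover.double τ (fun _ => ⊤) fun _ => trivial)))⟩

/-- The unit is built from one particular cover. The trivial bundle of `𝒰` has the same trivial
cocycle on the common refinement, hence the same class. -/
lemma hasCocycle_one (𝒰 : EquivariantCover τ) : (1 : IsoClass τ).HasCocycle 𝒰 fun _ _ _ => 1 := by
  have h : (1 : IsoClass τ).HasCocycle (EquivariantCover.double τ (fun _ => ⊤) fun _ => trivial)
    fun _ _ _ => 1 := hasCocycle_isoClass.2 (IsCocycle.one _).hasCocycle_flatBundle
  obtain ⟨a, ha⟩ := (IsCocycle.one 𝒰).exists_isoClass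
  rwa [(h.pullback (𝒰.infSnd _)).unique (ha.pullback (𝒰.infFst _))]

lemma exists_inverse (a : IsoClass τ) : ∃ b : IsoClass τ, b * a = 1 := by
  obtain ⟨𝒰, g, h⟩ := a.exists_hasCocycle
  obtain ⟨b, hb⟩ := h.isCocycle.inverse.exists_isoClass
  refine ⟨b, HasCocycle.unique ((hb.mul h).congr fun i j x hi hj => ?_) (hasCocycle_one 𝒰)⟩
  exact (h.isCocycle.conj_mul hi hj).symm

/-- The group of isomorphism classes. -/
scoped instance instCommGroup : CommGroup (IsoClass τ) where
  mul_assoc a b c := by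
    obtain ⟨𝒰, g, ha⟩ := a.exists_hasCocycle
    obtain ⟨𝒱, g', hb⟩ := b.exists_hasCocycle
    obtain ⟨𝒲, g'', hc⟩ := c.exists_hasCocycle
    have ha' := ha.pullback ((𝒰.infFst 𝒱).comp ((𝒰.inf 𝒱).infFst 𝒲))
    have hb' := hb.pullback ((𝒰.infSnd 𝒱).comp ((𝒰.inf 𝒱).infFst 𝒲))
    have hc' := hc.pullback ((𝒰.inf 𝒱).infSnd 𝒲)
    exact ((ha'.mul hb').mul hc').unique
      ((ha'.mul (hb'.mul hc')).congr fun i j x _ _ => mul_assoc _ _ _)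
  one_mul a := by
    obtain ⟨𝒰, g, ha⟩ := a.exists_hasCocycle
    exact (((hasCocycle_one 𝒰).mul ha).congr fun i j x _ _ => (one_mul _).symm).unique ha
  mul_one a := by
    obtain ⟨𝒰, g, ha⟩ := a.exists_hasCocycle
    exact ((ha.mul (hasCocycle_one 𝒰)).congr fun i j x _ _ => (mul_one _).symm).unique ha
  inv a := (exists_inverse a).choose
  inv_mul_cancel a := (exists_inverse a).choose_spec
  mul_comm a b := by
    obtain ⟨𝒰, g, ha⟩ := a.exists_hasCocycle
    obtain ⟨𝒱, g', hb⟩ := b.exists_hasCocycle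
    have ha' := ha.pullback (𝒰.infFst 𝒱)
    have hb' := hb.pullback (𝒰.infSnd 𝒱)
    exact (ha'.mul hb').unique ((hb'.mul ha').congr fun i j x _ _ => mul_comm _ _)

end IsoClass

open scoped IsoClass in
/-- The group law on isomorphism classes is the tensor product. -/
theorem isTensorGroupLaw : IsTensorGroupLaw (IsoClass.instCommGroup (τ := τ)) := by
  refine fun L L' => ⟨exists_tensor L L', fun N ⟨T⟩ => ?_⟩
  obtain ⟨𝒰, g, g', h, h'⟩ := exists_common_cover L L'
  exact ((IsoClass.hasCocycle_isoClass.2 h).mul (IsoClass.hasCocycle_isoClass.2 h')).unique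
    (IsoClass.hasCocycle_isoClass.2 (h.tensor h' T))

end FlatRealLineBundle
end Tensor

/-! ### The exponential with kernel `iℤ` -/

section Exponential

/-- The exponential `z ↦ exp (2 π z)`, with kernel `iℤ`. -/
def uexp (z : ℂ) : ℂ := Complex.exp (2 * Real.pi * z)

/-- A right inverse of `uexp`. -/
def ulog (z : ℂ) : ℂ := Complex.log z / (2 * Real.pi)

lemma two_pi_ne_zero' : (2 * Real.pi : ℂ) ≠ 0 := by
  exact_mod_cast Real.two_pi_pos.ne'

lemma uexp_add (z w : ℂ) : uexp (z + w) = uexp z * uexp w := by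
  rw [uexp, mul_add, Complex.exp_add]
  rfl

lemma uexp_eq_one_iff {z : ℂ} : uexp z = 1 ↔ ∃ n : ℤ, z = n * Complex.I := by
  rw [uexp, Complex.exp_eq_one_iff]
  refine exists_congr fun n => ⟨fun h => mul_left_cancel₀ two_pi_ne_zero' ?_, fun h => ?_⟩
  · rw [h]; ring
  · rw [h]; ring

lemma uexp_eq_of_sub {z w : ℂ} (h : ∃ n : ℤ, z - w = n * Complex.I) : uexp z = uexp w := by
  have h1 := uexp_add (z - w) w
  rwa [uexp_eq_one_iff.2 h, one_mul, sub_add_cancel] at h1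

lemma norm_uexp {z : ℂ} (hz : z.re = 0) : ‖uexp z‖ = 1 := by
  rw [uexp, Complex.norm_exp]
  simp [hz]

lemma conj_uexp (z : ℂ) : conj (uexp z) = uexp (conj z) := by
  rw [uexp, uexp, ← Complex.exp_conj, map_mul, map_mul, Complex.conj_ofReal, map_ofNat]

lemma uexp_ulog {z : ℂ} (hz : ‖z‖ = 1) : uexp (ulog z) = z := by
  rw [uexp, ulog, mul_div_cancel₀ _ two_pi_ne_zero', Complex.exp_log]
  rintro rfl
  simp at hz

lemma re_ulog {z : ℂ} (hz : ‖z‖ = 1) : (ulog z).re = 0 := by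
  have h : (2 * Real.pi : ℂ) = ((2 * Real.pi : ℝ) : ℂ) := by push_cast; rfl
  rw [ulog, h, Complex.div_ofReal_re, Complex.log_re, hz, Real.log_one, zero_div]

end Exponential

/-! ### From Deligne data to isomorphism classes -/

section DeligneData
variable {E : Type v} [NormedAddCommGroup E] [NormedSpace ℝ E] [FiniteDimensional ℝ E]
  {M : Type u} [TopologicalSpace M] [T2Space M] [ChartedSpace E M] [IsManifold 𝓘(ℝ, E) ∞ M]
  {τ : SmoothInvolution E M}

open scoped FlatRealLineBundle.IsoClass
open EquivariantCover (Refinement)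

/-- The functions and one-forms underlying a Real Deligne cocycle of degree two. -/
structure DeligneData (𝒰 : EquivariantCover τ) (f : 𝒰.ι → 𝒰.ι → M → ℂ)
    (A : 𝒰.ι → ∀ x : M, FormAt E 1 x) : Prop where
  smooth_fun : ∀ i j x, x ∈ 𝒰.U i → x ∈ 𝒰.U j → ContMDiffAt 𝓘(ℝ, E) 𝓘(ℝ, ℂ) ∞ (f i j) x
  re_fun : ∀ i j x, x ∈ 𝒰.U i → x ∈ 𝒰.U j → (f i j x).re = 0
  int_fun : ∀ i j k x, x ∈ 𝒰.U i → x ∈ 𝒰.U j → x ∈ 𝒰.U k →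
    ∃ n : ℤ, f i j x + f j k x - f i k x = n * Complex.I
  inv_fun : ∀ i j x, x ∈ 𝒰.U i → x ∈ 𝒰.U j →
    f (𝒰.inv i) (𝒰.inv j) (τ x) = conj (f i j x)
  dC_fun : ∀ i j x, x ∈ 𝒰.U i → x ∈ 𝒰.U j →
    dC E (f i j) x = oneForm (A j x) - oneForm (A i x)
  smooth_form : ∀ i, SmoothFormOn (A i) (𝒰.U i)
  re_form : ∀ i x, x ∈ 𝒰.U i → ∀ w, (A i x w).re = 0
  closed_form : ∀ i x, x ∈ 𝒰.U i → extD (A i) x = 0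
  inv_form : ∀ i x, x ∈ 𝒰.U i → ∀ w : TangentSpace 𝓘(ℝ, E) x,
    oneForm (A (𝒰.inv i) (τ x)) (mfderiv 𝓘(ℝ, E) 𝓘(ℝ, E) τ x w) = conj (oneForm (A i x) w)

/-- Real primitives of the one-forms `A` on a refinement of the cover. -/
structure IsPrimitive {𝒰 𝒱 : EquivariantCover τ} (φ : Refinement 𝒱 𝒰)
    (A : 𝒰.ι → ∀ x : M, FormAt E 1 x) (h : 𝒱.ι → M → ℂ) : Prop where
  smooth : ∀ a x, x ∈ 𝒱.U a → ContMDiffAt 𝓘(ℝ, E) 𝓘(ℝ, ℂ) ∞ (h a) x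
  re : ∀ a x, x ∈ 𝒱.U a → (h a x).re = 0
  map_inv : ∀ a x, x ∈ 𝒱.U a → h (𝒱.inv a) (τ x) = conj (h a x)
  dC_eq : ∀ a x, x ∈ 𝒱.U a → dC E (h a) x = oneForm (A (φ.toFun a) x)

/-- The cocycle of Deligne data with respect to primitives. -/
def expCocycle {𝒰 𝒱 : EquivariantCover τ} (φ : Refinement 𝒱 𝒰) (f : 𝒰.ι → 𝒰.ι → M → ℂ)
    (h : 𝒱.ι → M → ℂ) (a b : 𝒱.ι) (x : M) : ℂ :=
  uexp (f (φ.toFun a) (φ.toFun b) x - h b x + h a x)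

variable {𝒰 𝒱 : EquivariantCover τ} {f f' : 𝒰.ι → 𝒰.ι → M → ℂ}
  {A A' : 𝒰.ι → ∀ x : M, FormAt E 1 x} {φ : Refinement 𝒱 𝒰} {h h' : 𝒱.ι → M → ℂ}

omit [FiniteDimensional ℝ E] [T2Space M] [IsManifold 𝓘(ℝ, E) ∞ M] in
lemma mdiff {k : M → ℂ} {x : M} (hk : ContMDiffAt 𝓘(ℝ, E) 𝓘(ℝ, ℂ) ∞ k x) :
    MDifferentiableAt 𝓘(ℝ, E) 𝓘(ℝ, ℂ) k x := hk.mdifferentiableAt (by simp)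

omit [FiniteDimensional ℝ E] [T2Space M] in
lemma eventually_of_dC {k : M → ℂ} {W : Set M} (hW : IsOpen W)
    (hk : ∀ x ∈ W, ContMDiffAt 𝓘(ℝ, E) 𝓘(ℝ, ℂ) ∞ k x) (h0 : ∀ x ∈ W, dC E k x = 0) {x : M}
    (hx : x ∈ W) : ∀ᶠ y in 𝓝 x, k y = k x :=
  eventuallyEq_of_dC_eq_zero hW (fun y hy => mdiff (hk y hy)) h0 hx

omit [FiniteDimensional ℝ E] [T2Space M] in
/-- The combination `f - b + a` is locally constant when the differential of `f` is the difference
of those of `b` and `a`. -/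
lemma eventually_sub_add {k a b : M → ℂ} {W : Set M} (hW : IsOpen W)
    (hk : ∀ x ∈ W, ContMDiffAt 𝓘(ℝ, E) 𝓘(ℝ, ℂ) ∞ k x)
    (ha : ∀ x ∈ W, ContMDiffAt 𝓘(ℝ, E) 𝓘(ℝ, ℂ) ∞ a x)
    (hb : ∀ x ∈ W, ContMDiffAt 𝓘(ℝ, E) 𝓘(ℝ, ℂ) ∞ b x)
    (h0 : ∀ x ∈ W, dC E k x = dC E b x - dC E a x) {x : M} (hx : x ∈ W) :
    ∀ᶠ y in 𝓝 x, k y - b y + a y = k x - b x + a x := by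
  refine eventually_of_dC (E := E) (k := fun y => k y - b y + a y) hW
    (fun y hy => ((hk y hy).sub (hb y hy)).add (ha y hy)) (fun y hy => ?_) hx
  have h1 := dC_add (f := fun y => k y - b y) (mdiff ((hk y hy).sub (hb y hy))) (mdiff (ha y hy))
  have h2 := dC_sub (mdiff (hk y hy)) (mdiff (hb y hy))
  rw [h2, h0 y hy] at h1
  rw [h1]
  abel

namespace DeligneData

/-- The differential of the function with indices `φ a`, `φ b` is `A_{φ b} - A_{φ a}`, which is
exactly the differential of `h b - h a`. -/
lemma eventually_expCocycle (hD : DeligneData 𝒰 f A) (hh : IsPrimitive φ A h) {a b : 𝒱.ι} {x : M}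
    (ha : x ∈ 𝒱.U a) (hb : x ∈ 𝒱.U b) :
    ∀ᶠ y in 𝓝 x, f (φ.toFun a) (φ.toFun b) y - h b y + h a y =
      f (φ.toFun a) (φ.toFun b) x - h b x + h a x := by
  refine eventually_sub_add (E := E) ((𝒱.U a).isOpen.inter (𝒱.U b).isOpen)
    (fun y hy => hD.smooth_fun _ _ y (φ.le _ hy.1) (φ.le _ hy.2)) (fun y hy => hh.smooth a y hy.1)
    (fun y hy => hh.smooth b y hy.2) (fun y hy => ?_) ⟨ha, hb⟩
  rw [hD.dC_fun _ _ y (φ.le _ hy.1) (φ.le _ hy.2), hh.dC_eq a y hy.1, hh.dC_eq b y hy.2]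

/-- In the product rule the primitives cancel and only the integral defect of `f` remains, which
`uexp` kills. -/
lemma isCocycle (hD : DeligneData 𝒰 f A) (hh : IsPrimitive φ A h) :
    IsCocycle 𝒱 (expCocycle φ f h) where
  locConst a b x ha hb := by
    filter_upwards [hD.eventually_expCocycle hh ha hb] with y hy
    rw [expCocycle, hy, expCocycle]
  norm a b x ha hb := norm_uexp (by
    simp [hD.re_fun _ _ x (φ.le _ ha) (φ.le _ hb), hh.re a x ha, hh.re b x hb])
  mul a b c x ha hb hc := by
    rw [expCocycle, expCocycle, ← uexp_add]
    obtain ⟨n, hn⟩ := hD.int_fun _ _ _ x (φ.le _ ha) (φ.le _ hb) (φ.le _ hc)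
    exact uexp_eq_of_sub ⟨n, by rw [← hn]; ring⟩
  map_inv a b x ha hb := by
    rw [expCocycle, expCocycle, conj_uexp, φ.map_inv, φ.map_inv,
      hD.inv_fun _ _ x (φ.le _ ha) (φ.le _ hb), hh.map_inv a x ha, hh.map_inv b x hb]
    simp

omit [FiniteDimensional ℝ E] [T2Space M] [IsManifold 𝓘(ℝ, E) ∞ M] in
lemma _root_.RealDeligne.IsPrimitive.pullback {𝒲 : EquivariantCover τ} (hh : IsPrimitive φ A h)
    (ψ : Refinement 𝒲 𝒱) : IsPrimitive (φ.comp ψ) A fun a => h (ψ.toFun a) where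
  smooth a x hx := hh.smooth _ x (ψ.le a hx)
  re a x hx := hh.re _ x (ψ.le a hx)
  map_inv a x hx := by rw [ψ.map_inv, hh.map_inv _ x (ψ.le a hx)]
  dC_eq a x hx := hh.dC_eq _ x (ψ.le a hx)

omit [FiniteDimensional ℝ E] [T2Space M] in
/-- Primitives exist on a refinement. -/
theorem exists_isPrimitive (hD : DeligneData 𝒰 f A) :
    ∃ (𝒱 : EquivariantCover τ) (φ : Refinement 𝒱 𝒰) (h : 𝒱.ι → M → ℂ), IsPrimitive φ A h := by
  have key := fun x => exists_primitive_of_extD_eq_zero (𝒰.U (𝒰.indexAt x)).isOpen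
    (𝒰.mem_indexAt x) (hD.smooth_form _) (hD.closed_form _) (hD.re_form _)
  choose V hV hxV hVU h hh hre hdh using key
  have hsm : ∀ x, ∀ y ∈ V x, ContMDiffAt 𝓘(ℝ, E) 𝓘(ℝ, ℂ) ∞ (h x) y := fun x y hy =>
    (hh x).contMDiffAt ((hV x).mem_nhds hy)
  let 𝒱 := EquivariantCover.double τ (fun x => ⟨V x, hV x⟩) hxV
  let φ : Refinement 𝒱 𝒰 :=
    { toFun := fun i => if i.2 then 𝒰.inv (𝒰.indexAt i.1) else 𝒰.indexAt i.1
      map_inv := by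
        rintro ⟨x, _ | _⟩
        · rfl
        · exact (𝒰.inv_involutive _).symm
      le := by
        rintro ⟨x, _ | _⟩ y hy
        · exact hVU x hy
        · exact (𝒰.mem_inv _ y).2 (hVU x hy) }
  -- Equivariance forces the primitive on the translated sets; `inv_form` shows that it is a
  -- primitive of the one-form with index `inv`.
  refine ⟨𝒱, φ, fun i => if i.2 then fun y => conj (h i.1 (τ y)) else h i.1, ?_, ?_, ?_, ?_⟩
  · rintro ⟨x, _ | _⟩ y hy
    · exact hsm x y hy
    · exact Complex.conjCLE.contDiff.contMDiff.contMDiffAt.comp y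
        ((hsm x (τ y) hy).comp y (τ.contMDiff y))
  · rintro ⟨x, _ | _⟩ y hy
    · exact hre x y
    · exact hre x (τ y)
  · rintro ⟨x, _ | _⟩ y hy
    · change conj (h x (τ (τ y))) = conj (h x y)
      rw [τ.involutive y]
    · exact (Complex.conj_conj _).symm
  · rintro ⟨x, _ | _⟩ y hy
    · exact hdh x y hy
    · ext w
      have hy' : τ y ∈ V x := hy
      have hi : y ∈ 𝒰.U (𝒰.inv (𝒰.indexAt x)) := (𝒰.mem_inv _ y).2 (hVU x hy')
      change dC E (fun y => conj (h x (τ y))) y w = oneForm (A (𝒰.inv (𝒰.indexAt x)) y) w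
      have h1 := hD.inv_form _ y hi w
      rw [𝒰.inv_involutive] at h1
      rw [dC_conj (f := fun y => h x (τ y)) (mdiff ((hsm x (τ y) hy').comp y (τ.contMDiff y))),
        dC_comp_map (mdiff (hsm x (τ y) hy')) ((τ.contMDiff y).mdifferentiableAt (by simp)),
        hdh x (τ y) hy', h1, Complex.conj_conj]

/-- The Deligne data `(f, A)` represents the class `a`. -/
def Represents (𝒰 : EquivariantCover τ) (f : 𝒰.ι → 𝒰.ι → M → ℂ)
    (A : 𝒰.ι → ∀ x : M, FormAt E 1 x) (a : FlatRealLineBundle.IsoClass τ) : Prop :=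
  ∃ (𝒱 : EquivariantCover τ) (φ : Refinement 𝒱 𝒰) (h : 𝒱.ι → M → ℂ), IsPrimitive φ A h ∧
    a.HasCocycle 𝒱 (expCocycle φ f h)

theorem exists_represents (hD : DeligneData 𝒰 f A) : ∃ a, Represents 𝒰 f A a := by
  obtain ⟨𝒱, φ, h, hh⟩ := hD.exists_isPrimitive
  obtain ⟨a, ha⟩ := (hD.isCocycle hh).exists_isoClass
  exact ⟨a, 𝒱, φ, h, hh, ha⟩

/-- On the common refinement, with indices `i = (i.1, i.2)`, the two cocycles differ by the gauge
`uexp (f (φ i.1) (φ' i.2) - h' i.2 + h i.1)`. It is locally constant for the same reason as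
`expCocycle`, and the relation between the cocycles holds up to integers by two instances of
`int_fun`. So neither the refinement map nor the primitives matter. -/
theorem Represents.unique (hD : DeligneData 𝒰 f A) {a b : FlatRealLineBundle.IsoClass τ}
    (ha : Represents 𝒰 f A a) (hb : Represents 𝒰 f A b) : a = b := by
  obtain ⟨𝒱, φ, h, hh, ha⟩ := ha
  obtain ⟨𝒱', φ', h', hh', hb⟩ := hb
  refine FlatRealLineBundle.IsoClass.HasCocycle.unique ((ha.pullback (𝒱.infFst 𝒱')).gauge
    (c := fun i x => uexp (f (φ.toFun i.1) (φ'.toFun i.2) x - h' i.2 x + h i.1 x))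
    ⟨fun i x hi => ?_, fun i x hi => norm_uexp ?_, fun i x hi => ?_⟩ fun i j x hi hj => ?_)
    (hb.pullback (𝒱.infSnd 𝒱'))
  · have h1 := eventually_sub_add (E := E) ((𝒱.inf 𝒱').U i).isOpen
      (k := f (φ.toFun i.1) (φ'.toFun i.2)) (b := h' i.2) (a := h i.1)
      (fun y hy => hD.smooth_fun _ _ y (φ.le _ hy.1) (φ'.le _ hy.2))
      (fun y hy => hh.smooth _ y hy.1) (fun y hy => hh'.smooth _ y hy.2) (fun y hy => by
        rw [hD.dC_fun _ _ y (φ.le _ hy.1) (φ'.le _ hy.2), hh.dC_eq _ y hy.1, hh'.dC_eq _ y hy.2]) hi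
    filter_upwards [h1] with y hy
    rw [hy]
  · simp [hD.re_fun _ _ x (φ.le _ hi.1) (φ'.le _ hi.2), hh.re _ x hi.1, hh'.re _ x hi.2]
  · have e1 : φ.toFun ((𝒱.inf 𝒱').inv i).1 = 𝒰.inv (φ.toFun i.1) := φ.map_inv _
    have e2 : φ'.toFun ((𝒱.inf 𝒱').inv i).2 = 𝒰.inv (φ'.toFun i.2) := φ'.map_inv _
    rw [conj_uexp, e1, e2, hD.inv_fun _ _ x (φ.le _ hi.1) (φ'.le _ hi.2)]
    change uexp (_ - h' (𝒱'.inv i.2) (τ x) + h (𝒱.inv i.1) (τ x)) = _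
    rw [hh.map_inv _ x hi.1, hh'.map_inv _ x hi.2]
    simp
  · obtain ⟨n, hn⟩ := hD.int_fun _ _ _ x (φ.le _ hi.1) (φ'.le _ hi.2) (φ'.le _ hj.2)
    obtain ⟨m, hm⟩ := hD.int_fun _ _ _ x (φ.le _ hi.1) (φ.le _ hj.1) (φ'.le _ hj.2)
    change uexp (f (φ'.toFun i.2) (φ'.toFun j.2) x - h' j.2 x + h' i.2 x) * uexp _ =
      uexp (f (φ.toFun i.1) (φ.toFun j.1) x - h j.1 x + h i.1 x) * uexp _
    rw [← uexp_add, ← uexp_add]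
    refine uexp_eq_of_sub ⟨n - m, ?_⟩
    push_cast
    linear_combination hn - hm

/-- By uniqueness the class can be computed with any primitives on any refinement. -/
lemma Represents.hasCocycle (hD : DeligneData 𝒰 f A) {a : FlatRealLineBundle.IsoClass τ}
    (ha : Represents 𝒰 f A a) (hh : IsPrimitive φ A h) : a.HasCocycle 𝒱 (expCocycle φ f h) := by
  obtain ⟨b, hb⟩ := (hD.isCocycle hh).exists_isoClass
  rwa [ha.unique hD ⟨𝒱, φ, h, hh, hb⟩]

-- Primitives along a refinement map `φ` into `𝒱` are primitives along `ψ.comp φ` into `𝒰`, with the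
-- same cocycle. This is what makes the class invariant under pullback.
omit [FiniteDimensional ℝ E] [T2Space M] in
lemma Represents.of_pullback {ψ : Refinement 𝒱 𝒰} {a : FlatRealLineBundle.IsoClass τ}
    (ha : Represents 𝒱 (fun i j => f (ψ.toFun i) (ψ.toFun j)) (fun i => A (ψ.toFun i)) a) :
    Represents 𝒰 f A a := by
  obtain ⟨𝒲, φ, h, hh, ha⟩ := ha
  exact ⟨𝒲, ψ.comp φ, h, ⟨hh.smooth, hh.re, hh.map_inv, hh.dC_eq⟩, ha⟩

omit [FiniteDimensional ℝ E] [T2Space M] in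
/-- Two Deligne data have primitives along a common refinement map. -/
lemma exists_isPrimitive_add (hD : DeligneData 𝒰 f A) (hD' : DeligneData 𝒰 f' A') :
    ∃ (𝒱 : EquivariantCover τ) (φ : Refinement 𝒱 𝒰) (h h' : 𝒱.ι → M → ℂ), IsPrimitive φ A h ∧
      IsPrimitive φ A' h' := by
  obtain ⟨𝒱, φ, h, hh⟩ := hD.exists_isPrimitive
  obtain ⟨𝒱', φ', h', hh'⟩ := hD'.exists_isPrimitive
  -- The two families of primitives belong to different refinement maps. The function `f'` with
  -- indices `φ i.1`, `φ' i.2` has differential `A'_{φ' i.2} - A'_{φ i.1}`, so subtracting it turns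
  -- a primitive along `φ'` into one along `φ`.
  refine ⟨𝒱.inf 𝒱', φ.comp (𝒱.infFst 𝒱'), _, fun i x => h' i.2 x -
    f' (φ.toFun i.1) (φ'.toFun i.2) x, hh.pullback (𝒱.infFst 𝒱'), ?_, ?_, ?_, ?_⟩
  · exact fun i x hx => (hh'.smooth _ x hx.2).sub
      (hD'.smooth_fun _ _ x (φ.le _ hx.1) (φ'.le _ hx.2))
  · intro i x hx
    simp [hD'.re_fun _ _ x (φ.le _ hx.1) (φ'.le _ hx.2), hh'.re _ x hx.2]
  · intro i x hx
    have e1 : φ.toFun ((𝒱.inf 𝒱').inv i).1 = 𝒰.inv (φ.toFun i.1) := φ.map_inv _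
    have e2 : φ'.toFun ((𝒱.inf 𝒱').inv i).2 = 𝒰.inv (φ'.toFun i.2) := φ'.map_inv _
    rw [e1, e2, hD'.inv_fun _ _ x (φ.le _ hx.1) (φ'.le _ hx.2), map_sub, ← hh'.map_inv _ x hx.2]
    rfl
  · intro i x hx
    rw [dC_sub (mdiff (hh'.smooth _ x hx.2))
      (mdiff (hD'.smooth_fun _ _ x (φ.le _ hx.1) (φ'.le _ hx.2))), hh'.dC_eq _ x hx.2,
      hD'.dC_fun _ _ x (φ.le _ hx.1) (φ'.le _ hx.2), sub_sub_cancel]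
    rfl

/-- With primitives along one refinement map, `h + h'` is a primitive of `A + A'`, and `uexp` turns
the sum of the exponents into the product of the cocycles. -/
lemma Represents.add (hD : DeligneData 𝒰 f A) (hD' : DeligneData 𝒰 f' A')
    {a a' : FlatRealLineBundle.IsoClass τ} (ha : Represents 𝒰 f A a)
    (ha' : Represents 𝒰 f' A' a') : Represents 𝒰 (f + f') (A + A') (a * a') := by
  obtain ⟨𝒱, φ, h, h', hh, hh'⟩ := exists_isPrimitive_add hD hD'
  refine ⟨𝒱, φ, h + h', ⟨fun i x hx => (hh.smooth i x hx).add (hh'.smooth i x hx), fun i x hx => ?_,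
    fun i x hx => ?_, fun i x hx => ?_⟩,
    ((ha.hasCocycle hD hh).mul (ha'.hasCocycle hD' hh')).congr fun i j x hi hj => ?_⟩
  · simp [hh.re i x hx, hh'.re i x hx]
  · simp [hh.map_inv i x hx, hh'.map_inv i x hx]
  · rw [Pi.add_apply, show h i + h' i = fun y => h i y + h' i y from rfl,
      dC_add (mdiff (hh.smooth i x hx)) (mdiff (hh'.smooth i x hx)), hh.dC_eq i x hx, hh'.dC_eq i x hx]
    exact (oneForm_add _ _).symm
  · rw [expCocycle, expCocycle, expCocycle, ← uexp_add]
    congr 1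
    simp only [Pi.add_apply]
    ring

/-- Data with integral `f - δb` and `A = d b` represents the trivial class. -/
lemma represents_one {b : 𝒰.ι → M → ℂ} (hb : IsPrimitive (Refinement.id 𝒰) A b)
    (hf : ∀ i j x, x ∈ 𝒰.U i → x ∈ 𝒰.U j →
      ∃ n : ℤ, f i j x - b j x + b i x = n * Complex.I) : Represents 𝒰 f A 1 :=
  ⟨𝒰, Refinement.id 𝒰, b, hb, (FlatRealLineBundle.IsoClass.hasCocycle_one 𝒰).congr
    fun i j x hi hj => uexp_eq_one_iff.2 (hf i j x hi hj)⟩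

end DeligneData

omit [FiniteDimensional ℝ E] [T2Space M] [IsManifold 𝓘(ℝ, E) ∞ M] in
/-- An orientation of the index set: a choice of one index in each orbit of the involution. -/
lemma EquivariantCover.exists_orientation (𝒰 : EquivariantCover τ) :
    ∃ o : 𝒰.ι → Bool, ∀ i, o (𝒰.inv i) = !o i := by
  classical
  -- In a well-ordering of the indices, the smaller member of each orbit is the chosen one; freeness
  -- of the involution excludes equality.
  let r : LinearOrder 𝒰.ι := linearOrderOfSTO WellOrderingRel
  refine ⟨fun i => decide (i < 𝒰.inv i), fun i => ?_⟩
  simp only [𝒰.inv_involutive i]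
  rcases lt_trichotomy i (𝒰.inv i) with h | h | h
  · simp [h, h.le]
  · exact absurd h.symm (𝒰.inv_ne i)
  · simp [h, h.le]

end DeligneData

/-! ### Cochains and differentials in terms of values -/

section Values
variable {E : Type v} [NormedAddCommGroup E] [NormedSpace ℝ E]
  {M : Type u} [TopologicalSpace M] [ChartedSpace E M] {τ : SmoothInvolution E M}

/-- A complex number as a `0`-form. -/
def zeroForm (x : M) : ℂ →+ FormAt E 0 x where
  toFun c := ContinuousAlternatingMap.constOfIsEmpty ℝ (TangentSpace 𝓘(ℝ, E) x) (Fin 0) c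
  map_zero' := rfl
  map_add' _ _ := rfl

lemma zeroForm_apply {x : M} (c : ℂ) (w : Fin 0 → TangentSpace 𝓘(ℝ, E) x) :
    zeroForm x c w = c := rfl

lemma zeroForm_ext {x : M} {η θ : FormAt E 0 x} (h : η ![] = θ ![]) : η = θ := by
  ext w
  rw [Subsingleton.elim w ![]]
  exact h

lemma conjPullAt_zero_apply (x : M) (η : FormAt E 0 (τ x)) :
    conjPullAt τ x η ![] = conj (η ![]) :=
  congrArg (fun w => conj (η w)) (Subsingleton.elim _ _)

lemma oneForm_conjPullAt (x : M) (η : FormAt E 1 (τ x)) (w : TangentSpace 𝓘(ℝ, E) x) :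
    oneForm (conjPullAt τ x η) w = conj (oneForm η (mfderiv 𝓘(ℝ, E) 𝓘(ℝ, E) τ x w)) := rfl

lemma smoothFormOn_zeroForm [IsManifold 𝓘(ℝ, E) ∞ M] {f : M → ℂ} {W : Set M}
    (hf : ∀ x ∈ W, ContMDiffAt 𝓘(ℝ, E) 𝓘(ℝ, ℂ) ∞ f x) :
    SmoothFormOn (fun x => zeroForm (E := E) x (f x)) W := by
  intro x₀ y hy
  have h1 : ContMDiffAt 𝓘(ℝ, E) 𝓘(ℝ, ℂ) ∞ (fun z => f ((chartAt E x₀).symm z)) y :=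
    (hf _ hy.2).comp y (contMDiffOn_chart_symm.contMDiffAt
      ((chartAt E x₀).open_target.mem_nhds hy.1))
  have h2 := h1.contDiffAt
  exact ((ContinuousAlternatingMap.constOfIsEmptyLIE ℝ E ℂ (Fin 0)).contDiff.contDiffAt.comp y
    h2).contDiffWithinAt

variable {𝒰 𝒱 : EquivariantCover τ} {p : ℕ}

open EquivariantCover (Refinement mem_inter)

/-- The values of a cochain, extended by zero. -/
def val {q j : ℕ} (c : cochains 𝒰 p q j) (s : Fin (q + 1) → 𝒰.ι) (x : M) :
    FormAt E (formDegree j) x :=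
  zeroExt (𝒰.inter s) (c.1 s) x

section

variable {q j : ℕ}

lemma val_of_mem (c : cochains 𝒰 p q j) {s : Fin (q + 1) → 𝒰.ι} {x : M} (hx : x ∈ 𝒰.inter s) :
    val c s x = c.1 s ⟨x, hx⟩ := zeroExt_of_mem _ hx

lemma cochain_ext {c c' : cochains 𝒰 p q j}
    (h : ∀ s x, x ∈ 𝒰.inter s → val c s x = val c' s x) : c = c' := by
  apply Subtype.ext
  funext s x
  have := h s x x.2
  rwa [val_of_mem c x.2, val_of_mem c' x.2] at this

lemma val_add (c c' : cochains 𝒰 p q j) (s : Fin (q + 1) → 𝒰.ι) (x : M) :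
    val (c + c') s x = val c s x + val c' s x :=
  congrFun (zeroExt_add (𝒰.inter s) (c.1 s) (c'.1 s)) x

lemma val_neg (c : cochains 𝒰 p q j) (s : Fin (q + 1) → 𝒰.ι) (x : M) :
    val (-c) s x = -val c s x :=
  congrFun (zeroExt_neg (𝒰.inter s) (c.1 s)) x

lemma val_zero (s : Fin (q + 1) → 𝒰.ι) (x : M) : val (0 : cochains 𝒰 p q j) s x = 0 :=
  congrFun (zeroExt_zero (𝒰.inter s)) x

lemma val_inv (c : cochains 𝒰 p q j) {s : Fin (q + 1) → 𝒰.ι} {x : M} (hx : x ∈ 𝒰.inter s) :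
    conjPullAt τ x (val c (𝒰.inv ∘ s) (τ x)) = val c s x := by
  rw [val_of_mem c hx, val_of_mem c (𝒰.inter_inv s hx)]
  exact c.2.2 s ⟨x, hx⟩

lemma val_cechDiff (c : cochains 𝒰 p q j) {s : Fin (q + 2) → 𝒰.ι} {x : M} (hx : x ∈ 𝒰.inter s) :
    val (cechDiff 𝒰 p q j c) s x =
      ∑ a : Fin (q + 2), (-1 : ℤ) ^ (a : ℕ) • val c (s ∘ a.succAbove) x := by
  rw [val_of_mem _ hx]
  exact Finset.sum_congr (M := FormAt E (formDegree j) x) (s₁ := Finset.univ) rfl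
    fun (a : Fin (q + 2)) _ => congrArg ((-1 : ℤ) ^ (a : ℕ) • ·) (val_of_mem c (𝒰.inter_face s a hx)).symm

lemma val_cochainPullback (φ : Refinement 𝒱 𝒰) (c : cochains 𝒰 p q j) {s : Fin (q + 1) → 𝒱.ι}
    {x : M} (hx : x ∈ 𝒱.inter s) : val (cochainPullback p φ q j c) s x = val c (φ.toFun ∘ s) x := by
  rw [val_of_mem _ hx, val_of_mem c (φ.inter_le s hx)]
  rfl

variable [IsManifold 𝓘(ℝ, E) ∞ M]

lemma val_formDiff_zero (hp : 0 < p) (c : cochains 𝒰 p q 0) (s : Fin (q + 1) → 𝒰.ι) (x : M) :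
    val (formDiff 𝒰 p q 0 c) s x = val c s x := by
  change zeroExt _ (sheafDiff p 0 _ (c.1 s)) x = zeroExt _ (c.1 s) x
  rw [sheafDiff, if_pos hp]
  rfl

/-- Below the truncation the sheaf differential is the exterior derivative. On one-forms, `j = 1`,
the bound reads `2 < p`. -/
lemma val_formDiff_succ (hp : j + 1 < p) (c : cochains 𝒰 p q (j + 1)) {s : Fin (q + 1) → 𝒰.ι}
    {x : M} (hx : x ∈ 𝒰.inter s) :
    val (formDiff 𝒰 p q (j + 1) c) s x = extD (val c s) x := by
  rw [val_of_mem _ hx]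
  change sheafDiff p (j + 1) _ (c.1 s) ⟨x, hx⟩ = _
  rw [sheafDiff, if_pos hp]
  rfl

omit [IsManifold 𝓘(ℝ, E) ∞ M] in
lemma mem_imagForms (hp : j < p) (c : cochains 𝒰 p q (j + 1)) (s : Fin (q + 1) → 𝒰.ι) :
    c.1 s ∈ imagForms j (𝒰.inter s) := by
  have h := c.2.1 s
  simp only [deligneSections, hp, if_true] at h
  exact h

omit [IsManifold 𝓘(ℝ, E) ∞ M] in
lemma smoothFormOn_val (hp : j < p) (c : cochains 𝒰 p q (j + 1)) (s : Fin (q + 1) → 𝒰.ι) :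
    SmoothFormOn (val c s) (𝒰.inter s) := (mem_imagForms hp c s).1

omit [IsManifold 𝓘(ℝ, E) ∞ M] in
lemma re_val (hp : j < p) (c : cochains 𝒰 p q (j + 1)) {s : Fin (q + 1) → 𝒰.ι} {x : M}
    (hx : x ∈ 𝒰.inter s) (w : Fin j → TangentSpace 𝓘(ℝ, E) x) : (val c s x w).re = 0 := by
  rw [val_of_mem c hx]
  exact (mem_imagForms hp c s).2 ⟨x, hx⟩ w

/-- A cochain of forms from its values. -/
def mkForms (hp : j < p) (G : (Fin (q + 1) → 𝒰.ι) → ∀ x : M, FormAt E j x)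
    (hs : ∀ s, SmoothFormOn (G s) (𝒰.inter s))
    (hre : ∀ s, ∀ x ∈ 𝒰.inter s, ∀ w, (G s x w).re = 0)
    (hinv : ∀ s, ∀ x ∈ 𝒰.inter s, conjPullAt τ x (G (𝒰.inv ∘ s) (τ x)) = G s x) :
    cochains 𝒰 p q (j + 1) :=
  ⟨fun s x => G s x, fun s => by
    simp only [deligneSections, hp, if_true]
    exact ⟨(hs s).congr fun x hx => zeroExt_of_mem _ hx, fun x w => hre s x x.2 w⟩,
    fun s x => hinv s x x.2⟩

/-- A cochain of functions from its values. -/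
def mkFunctions (hp : 0 < p) (F : (Fin (q + 1) → 𝒰.ι) → M → ℂ)
    (hs : ∀ s, ∀ x ∈ 𝒰.inter s, ContMDiffAt 𝓘(ℝ, E) 𝓘(ℝ, ℂ) ∞ (F s) x)
    (hre : ∀ s, ∀ x ∈ 𝒰.inter s, (F s x).re = 0)
    (hinv : ∀ s, ∀ x ∈ 𝒰.inter s, F (𝒰.inv ∘ s) (τ x) = conj (F s x)) : cochains 𝒰 p q 1 :=
  mkForms hp (fun s x => zeroForm x (F s x)) (fun s => smoothFormOn_zeroForm (hs s))
    (fun s x hx _ => hre s x hx) fun s x hx => zeroForm_ext <| by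
      rw [conjPullAt_zero_apply, zeroForm_apply, zeroForm_apply, hinv s x hx, Complex.conj_conj]

lemma val_mkFunctions {hp : 0 < p} {F : (Fin (q + 1) → 𝒰.ι) → M → ℂ}
    {hs : ∀ s, ∀ x ∈ 𝒰.inter s, ContMDiffAt 𝓘(ℝ, E) 𝓘(ℝ, ℂ) ∞ (F s) x}
    {hre : ∀ s, ∀ x ∈ 𝒰.inter s, (F s x).re = 0}
    {hinv : ∀ s, ∀ x ∈ 𝒰.inter s, F (𝒰.inv ∘ s) (τ x) = conj (F s x)}
    {s : Fin (q + 1) → 𝒰.ι} {x : M} (hx : x ∈ 𝒰.inter s) :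
    val (mkFunctions hp F hs hre hinv) s x = zeroForm x (F s x) := val_of_mem _ hx

omit [IsManifold 𝓘(ℝ, E) ∞ M] in
/-- Locally constant integral functions are sections of `iℤ`. -/
lemma mkInts_mem {W : Opens M} {F : M → ℂ} (hc : ∀ x ∈ W, ∀ᶠ y in 𝓝 x, F y = F x)
    (hn : ∀ x ∈ W, ∃ n : ℤ, F x = n * Complex.I) :
    (fun x : W => zeroForm (E := E) (x : M) (F x)) ∈ imagInts W := by
  refine ⟨(IsLocallyConstant.iff_eventually_eq _).2 fun x => ?_, fun x => hn x x.2⟩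
  exact continuous_subtype_val.continuousAt.eventually (hc x x.2)

/-- A cochain with values in `iℤ` from its values. -/
def mkInts (F : (Fin (q + 1) → 𝒰.ι) → M → ℂ)
    (hc : ∀ s, ∀ x ∈ 𝒰.inter s, ∀ᶠ y in 𝓝 x, F s y = F s x)
    (hn : ∀ s, ∀ x ∈ 𝒰.inter s, ∃ n : ℤ, F s x = n * Complex.I)
    (hinv : ∀ s, ∀ x ∈ 𝒰.inter s, F (𝒰.inv ∘ s) (τ x) = conj (F s x)) : cochains 𝒰 p q 0 :=
  ⟨fun s x => zeroForm (x : M) (F s x), fun s => mkInts_mem (hc s) (hn s),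
    fun s x => zeroForm_ext <| by
      rw [conjPullAt_zero_apply, zeroForm_apply, zeroForm_apply, hinv s x x.2, Complex.conj_conj]⟩

omit [IsManifold 𝓘(ℝ, E) ∞ M] in
lemma val_mkInts {F : (Fin (q + 1) → 𝒰.ι) → M → ℂ}
    {hc : ∀ s, ∀ x ∈ 𝒰.inter s, ∀ᶠ y in 𝓝 x, F s y = F s x}
    {hn : ∀ s, ∀ x ∈ 𝒰.inter s, ∃ n : ℤ, F s x = n * Complex.I}
    {hinv : ∀ s, ∀ x ∈ 𝒰.inter s, F (𝒰.inv ∘ s) (τ x) = conj (F s x)}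
    {s : Fin (q + 1) → 𝒰.ι} {x : M} (hx : x ∈ 𝒰.inter s) :
    val (mkInts (p := p) F hc hn hinv) s x = zeroForm x (F s x) := val_of_mem _ hx

end

section Total

variable [IsManifold 𝓘(ℝ, E) ∞ M]

lemma totalDiff_mem {n : ℕ} {c : BiCochains 𝒰 p} (hc : c ∈ totalDegree 𝒰 p n) :
    totalDiff 𝒰 p c ∈ totalDegree 𝒰 p (n + 1) := by
  intro q j h
  match q, j with
  | 0, 0 => rfl
  | q + 1, 0 =>
    change cechDiff 𝒰 p q 0 (c q 0) = 0
    rw [hc q 0 (by omega), map_zero]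
  | 0, j + 1 =>
    change formDiff 𝒰 p 0 j (c 0 j) = 0
    rw [hc 0 j (by omega), map_zero]
  | q + 1, j + 1 =>
    change cechDiff 𝒰 p q (j + 1) (c q (j + 1)) +
      (-1 : ℤ) ^ (q + 1) • formDiff 𝒰 p (q + 1) j (c (q + 1) j) = 0
    rw [hc q (j + 1) (by omega), hc (q + 1) j (by omega), map_zero, map_zero, smul_zero, add_zero]

end Total

lemma EquivariantCover.mem_inter₁ {i : 𝒰.ι} {x : M} : x ∈ 𝒰.inter ![i] ↔ x ∈ 𝒰.U i := by
  simp [mem_inter]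

lemma EquivariantCover.mem_inter₂ {i j : 𝒰.ι} {x : M} :
    x ∈ 𝒰.inter ![i, j] ↔ x ∈ 𝒰.U i ∧ x ∈ 𝒰.U j := by
  simp [mem_inter, Fin.forall_fin_two]

lemma EquivariantCover.mem_inter₃ {i j k : 𝒰.ι} {x : M} :
    x ∈ 𝒰.inter ![i, j, k] ↔ x ∈ 𝒰.U i ∧ x ∈ 𝒰.U j ∧ x ∈ 𝒰.U k := by
  simp [mem_inter, Fin.forall_fin_succ]

lemma eq_vec₁ {ι : Type*} (s : Fin 1 → ι) : s = ![s 0] := by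
  funext a; fin_cases a; rfl

lemma eq_vec₂ {ι : Type*} (s : Fin 2 → ι) : s = ![s 0, s 1] := by
  funext a; fin_cases a <;> rfl

lemma eq_vec₃ {ι : Type*} (s : Fin 3 → ι) : s = ![s 0, s 1, s 2] := by
  funext a; fin_cases a <;> rfl

lemma val_cechDiff₀ {d : ℕ} (c : cochains 𝒰 p 0 d) {i j : 𝒰.ι} {x : M} (hi : x ∈ 𝒰.U i)
    (hj : x ∈ 𝒰.U j) : val (cechDiff 𝒰 p 0 d c) ![i, j] x = val c ![j] x - val c ![i] x := by
  have h0 : ![i, j] ∘ (0 : Fin 2).succAbove = ![j] := by funext a; fin_cases a; rfl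
  have h1 : ![i, j] ∘ (1 : Fin 2).succAbove = ![i] := by funext a; fin_cases a; rfl
  rw [val_cechDiff c (EquivariantCover.mem_inter₂.2 ⟨hi, hj⟩), Fin.sum_univ_two, h0, h1]
  simp [sub_eq_add_neg]

lemma val_cechDiff₁ {d : ℕ} (c : cochains 𝒰 p 1 d) {i j k : 𝒰.ι} {x : M} (hi : x ∈ 𝒰.U i)
    (hj : x ∈ 𝒰.U j) (hk : x ∈ 𝒰.U k) : val (cechDiff 𝒰 p 1 d c) ![i, j, k] x =
      val c ![j, k] x - val c ![i, k] x + val c ![i, j] x := by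
  have h0 : ![i, j, k] ∘ (0 : Fin 3).succAbove = ![j, k] := by funext a; fin_cases a <;> rfl
  have h1 : ![i, j, k] ∘ (1 : Fin 3).succAbove = ![i, k] := by funext a; fin_cases a <;> rfl
  have h2 : ![i, j, k] ∘ (2 : Fin 3).succAbove = ![i, j] := by funext a; fin_cases a <;> rfl
  rw [val_cechDiff c (EquivariantCover.mem_inter₃.2 ⟨hi, hj, hk⟩), Fin.sum_univ_three, h0, h1, h2]
  simp [sub_eq_add_neg]

end Values

/-! ### Deligne cocycles of degree two -/

section CocycleData
variable {E : Type v} [NormedAddCommGroup E] [NormedSpace ℝ E]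
  {M : Type u} [TopologicalSpace M] [ChartedSpace E M] [IsManifold 𝓘(ℝ, E) ∞ M]
  {τ : SmoothInvolution E M} {𝒰 𝒱 : EquivariantCover τ} {p : ℕ}

open EquivariantCover (Refinement mem_inter₁ mem_inter₂ mem_inter₃)

/-- For a cocycle this component says that `δf = -n` with `n` integral. -/
lemma val_totalDiff₂₁ (hp : 0 < p) (c : BiCochains 𝒰 p) {i j k : 𝒰.ι} {x : M} (hi : x ∈ 𝒰.U i)
    (hj : x ∈ 𝒰.U j) (hk : x ∈ 𝒰.U k) : val (totalDiff 𝒰 p c 2 1) ![i, j, k] x =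
      val (c 1 1) ![j, k] x - val (c 1 1) ![i, k] x + val (c 1 1) ![i, j] x +
        val (c 2 0) ![i, j, k] x := by
  change val (cechDiff 𝒰 p 1 1 (c 1 1) + (-1 : ℤ) ^ 2 • formDiff 𝒰 p 2 0 (c 2 0)) _ x = _
  rw [val_add, val_cechDiff₁ _ hi hj hk, neg_one_sq, one_smul, val_formDiff_zero hp]

/-- The minus sign comes from Čech degree one. For a cocycle this component says that `df = δA`. -/
lemma val_totalDiff₁₂ (hp : 1 < p) (c : BiCochains 𝒰 p) {i j : 𝒰.ι} {x : M} (hi : x ∈ 𝒰.U i)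
    (hj : x ∈ 𝒰.U j) : val (totalDiff 𝒰 p c 1 2) ![i, j] x =
      val (c 0 2) ![j] x - val (c 0 2) ![i] x - extD (val (c 1 1) ![i, j]) x := by
  change val (cechDiff 𝒰 p 0 2 (c 0 2) + (-1 : ℤ) ^ 1 • formDiff 𝒰 p 1 1 (c 1 1)) _ x = _
  rw [val_add, val_cechDiff₀ _ hi hj, pow_one, neg_one_smul, val_neg,
    val_formDiff_succ hp _ (mem_inter₂.2 ⟨hi, hj⟩), sub_eq_add_neg _ (extD _ x)]

/-- This is the function part `δb - n` of the coboundary of a cochain `(n, b)` of degree one. -/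
lemma val_totalDiff₁₁ (hp : 0 < p) (c : BiCochains 𝒰 p) {i j : 𝒰.ι} {x : M} (hi : x ∈ 𝒰.U i)
    (hj : x ∈ 𝒰.U j) : val (totalDiff 𝒰 p c 1 1) ![i, j] x =
      val (c 0 1) ![j] x - val (c 0 1) ![i] x - val (c 1 0) ![i, j] x := by
  change val (cechDiff 𝒰 p 0 1 (c 0 1) + (-1 : ℤ) ^ 1 • formDiff 𝒰 p 1 0 (c 1 0)) _ x = _
  rw [val_add, val_cechDiff₀ _ hi hj, pow_one, neg_one_smul, val_neg,
    val_formDiff_zero hp, sub_eq_add_neg _ (val _ _ x)]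
  rfl

omit [IsManifold 𝓘(ℝ, E) ∞ M] in
lemma exists_int_val {q : ℕ} (c : cochains 𝒰 p q 0) {s : Fin (q + 1) → 𝒰.ι} {x : M}
    (hx : x ∈ 𝒰.inter s) : ∃ n : ℤ, val c s x ![] = n * Complex.I := by
  rw [val_of_mem c hx]
  exact (c.2.1 s).2 ⟨x, hx⟩

/-- The functions on double intersections of a bicochain. -/
def transition (c : BiCochains 𝒰 p) (i j : 𝒰.ι) (x : M) : ℂ := val (c 1 1) ![i, j] x ![]

/-- The one-forms of a bicochain. -/
def potential (c : BiCochains 𝒰 p) (i : 𝒰.ι) (x : M) : FormAt E 1 x := val (c 0 2) ![i] x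

variable {c : BiCochains 𝒰 p}

lemma contMDiffAt_val {q : ℕ} (hp : 0 < p) (c : cochains 𝒰 p q 1) {s : Fin (q + 1) → 𝒰.ι} {x : M}
    (hx : x ∈ 𝒰.inter s) : ContMDiffAt 𝓘(ℝ, E) 𝓘(ℝ, ℂ) ∞ (fun y => val c s y ![]) x :=
  mdifferentiableAt_of_chartRep
    ((smoothFormOn_val hp c s).contDiffAt (𝒰.inter s).isOpen (mem_chart_source E x) hx)

lemma oneForm_extD_val {q : ℕ} (hp : 0 < p) (c : cochains 𝒰 p q 1) {s : Fin (q + 1) → 𝒰.ι} {x : M}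
    (hx : x ∈ 𝒰.inter s) : oneForm (extD (val c s) x) = dC E (fun y => val c s y ![]) x :=
  oneForm_extD
    ((smoothFormOn_val hp c s).contDiffAt (𝒰.inter s).isOpen (mem_chart_source E x) hx)

omit [IsManifold 𝓘(ℝ, E) ∞ M] in
lemma val_inv_apply {q : ℕ} (c : cochains 𝒰 p q 1) {s : Fin (q + 1) → 𝒰.ι} {x : M}
    (hx : x ∈ 𝒰.inter s) : val c (𝒰.inv ∘ s) (τ x) ![] = conj (val c s x ![]) := by
  rw [← val_inv c hx]
  exact ((congrArg conj (conjPullAt_zero_apply x _)).trans (Complex.conj_conj _)).symm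

omit [IsManifold 𝓘(ℝ, E) ∞ M] in
lemma vec_inv₁ (i : 𝒰.ι) : ![𝒰.inv i] = 𝒰.inv ∘ ![i] := by funext a; fin_cases a; rfl

omit [IsManifold 𝓘(ℝ, E) ∞ M] in
lemma vec_inv₂ (i j : 𝒰.ι) : ![𝒰.inv i, 𝒰.inv j] = 𝒰.inv ∘ ![i, j] := by
  funext a; fin_cases a <;> rfl

/-- The Deligne data of a cocycle of degree two. -/
theorem deligneData (hp : 2 < p) (hc : totalDiff 𝒰 p c = 0) :
    DeligneData 𝒰 (transition c) (potential c) where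
  smooth_fun i j x hi hj := contMDiffAt_val (by omega) _ (mem_inter₂.2 ⟨hi, hj⟩)
  re_fun i j x hi hj := re_val (j := 0) (by omega) _ (mem_inter₂.2 ⟨hi, hj⟩) _
  int_fun i j k x hi hj hk := by
    obtain ⟨n, hn⟩ := exists_int_val (c 2 0) (mem_inter₃.2 ⟨hi, hj, hk⟩)
    have h := val_totalDiff₂₁ (by omega) c hi hj hk
    rw [hc] at h
    have h' : 0 = val (c 1 1) ![j, k] x ![] - val (c 1 1) ![i, k] x ![] + val (c 1 1) ![i, j] x ![] +
      val (c 2 0) ![i, j, k] x ![] := by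
      refine Eq.trans ?_ (congrArg (fun η : FormAt E 0 x => η ![]) h)
      exact (congrArg (fun η : FormAt E 0 x => η ![]) (val_zero (p := p) (q := 2) (j := 1) _ x)).symm
    refine ⟨-n, ?_⟩
    simp only [transition]
    push_cast
    linear_combination -h' - hn
  inv_fun i j x hi hj := by
    rw [transition, vec_inv₂]
    exact val_inv_apply (c 1 1) (mem_inter₂.2 ⟨hi, hj⟩)
  dC_fun i j x hi hj := by
    have h := val_totalDiff₁₂ (by omega) c hi hj
    rw [hc, show val ((0 : BiCochains 𝒰 p) 1 2) ![i, j] x = 0 from val_zero _ x] at h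
    rw [← oneForm_sub]
    exact (oneForm_extD_val (by omega) (c 1 1) (mem_inter₂.2 ⟨hi, hj⟩)).symm.trans
      (congrArg oneForm (sub_eq_zero.1 h.symm).symm)
  smooth_form i := (smoothFormOn_val (j := 1) (by omega) (c 0 2) ![i]).mono
    fun x hx => mem_inter₁.2 hx
  re_form i x hi w := re_val (j := 1) (by omega) (c 0 2) (mem_inter₁.2 hi) w
  closed_form i x hi := by
    -- Here `2 < p` is essential: the complex contains the differential from one-forms to two-forms,
    -- so the one-forms of a cocycle are closed.
    have h := val_formDiff_succ (j := 1) (by omega) (c 0 2) (mem_inter₁.2 hi)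
    refine h.symm.trans ?_
    have h' : formDiff 𝒰 p 0 2 (c 0 2) = 0 := congrFun (congrFun hc 0) 3
    rw [h']
    exact val_zero _ x
  inv_form i x hi w := by
    rw [potential, vec_inv₁]
    have h := val_inv (c 0 2) (mem_inter₁.2 hi)
    have h' := oneForm_conjPullAt x (val (c 0 2) (𝒰.inv ∘ ![i]) (τ x)) w
    rw [h] at h'
    rw [potential, h', Complex.conj_conj]

omit [IsManifold 𝓘(ℝ, E) ∞ M] in
lemma transition_add (c c' : BiCochains 𝒰 p) :
    transition (c + c') = transition c + transition c' := by
  funext i j x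
  exact congrArg (fun η : FormAt E 0 x => η ![]) (val_add (c 1 1) (c' 1 1) _ x)

omit [IsManifold 𝓘(ℝ, E) ∞ M] in
lemma potential_add (c c' : BiCochains 𝒰 p) :
    potential (c + c') = potential c + potential c' := by
  funext i x
  exact val_add (c 0 2) (c' 0 2) _ x

omit [IsManifold 𝓘(ℝ, E) ∞ M] in
lemma transition_biPullback (φ : Refinement 𝒱 𝒰) {i j : 𝒱.ι} {x : M} (hi : x ∈ 𝒱.U i)
    (hj : x ∈ 𝒱.U j) :
    transition (biPullback p φ c) i j x = transition c (φ.toFun i) (φ.toFun j) x := by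
  have h : φ.toFun ∘ ![i, j] = ![φ.toFun i, φ.toFun j] := by funext a; fin_cases a <;> rfl
  have h' := val_cochainPullback φ (c 1 1) (mem_inter₂.2 ⟨hi, hj⟩)
  rw [h] at h'
  exact congrArg (fun η : FormAt E 0 x => η ![]) h'

omit [IsManifold 𝓘(ℝ, E) ∞ M] in
lemma potential_biPullback (φ : Refinement 𝒱 𝒰) {i : 𝒱.ι} {x : M} (hi : x ∈ 𝒱.U i) :
    potential (biPullback p φ c) i x = potential c (φ.toFun i) x := by
  have h : φ.toFun ∘ ![i] = ![φ.toFun i] := by funext a; fin_cases a; rfl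
  have h' := val_cochainPullback φ (c 0 2) (mem_inter₁.2 hi)
  rw [h] at h'
  exact h'

/-- The zero-cochain of functions of a cochain of degree one is a primitive of its coboundary. -/
lemma isPrimitive_totalDiff (hp : 1 < p) (b : BiCochains 𝒰 p) :
    IsPrimitive (Refinement.id 𝒰) (potential (totalDiff 𝒰 p b))
      fun i x => val (b 0 1) ![i] x ![] where
  smooth i x hi := contMDiffAt_val (by omega) _ (mem_inter₁.2 hi)
  re i x hi := re_val (j := 0) (by omega) _ (mem_inter₁.2 hi) _
  map_inv i x hi := by
    rw [vec_inv₁]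
    exact val_inv_apply _ (mem_inter₁.2 hi)
  dC_eq i x hi := (oneForm_extD_val (by omega) (b 0 1) (mem_inter₁.2 hi)).symm.trans
    (congrArg oneForm (val_formDiff_succ hp (b 0 1) (mem_inter₁.2 hi)).symm)

lemma transition_totalDiff (hp : 0 < p) (b : BiCochains 𝒰 p) {i j : 𝒰.ι} {x : M} (hi : x ∈ 𝒰.U i)
    (hj : x ∈ 𝒰.U j) : transition (totalDiff 𝒰 p b) i j x =
      val (b 0 1) ![j] x ![] - val (b 0 1) ![i] x ![] - val (b 1 0) ![i, j] x ![] :=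
  congrArg (fun η : FormAt E 0 x => η ![]) (val_totalDiff₁₁ hp b hi hj)

end CocycleData

/-! ### The homomorphism from cohomology to isomorphism classes -/

section ClassMap
variable {E : Type v} [NormedAddCommGroup E] [NormedSpace ℝ E] [FiniteDimensional ℝ E]
  {M : Type u} [TopologicalSpace M] [T2Space M] [ChartedSpace E M] [IsManifold 𝓘(ℝ, E) ∞ M]
  {τ : SmoothInvolution E M} {𝒰 𝒱 : EquivariantCover τ} {p : ℕ}

open scoped FlatRealLineBundle.IsoClass
open EquivariantCover (Refinement mem_inter₁ mem_inter₂ mem_inter₃)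
open FlatRealLineBundle (IsoClass)
open DeligneData (Represents)

lemma DeligneData.Represents.congr {f f' : 𝒰.ι → 𝒰.ι → M → ℂ} {A A' : 𝒰.ι → ∀ x : M, FormAt E 1 x}
    {a : IsoClass τ} (h : Represents 𝒰 f A a)
    (hf : ∀ i j x, x ∈ 𝒰.U i → x ∈ 𝒰.U j → f' i j x = f i j x)
    (hA : ∀ i x, x ∈ 𝒰.U i → A' i x = A i x) : Represents 𝒰 f' A' a := by
  obtain ⟨𝒱, φ, h, hh, ha⟩ := h
  refine ⟨𝒱, φ, h, ⟨hh.smooth, hh.re, hh.map_inv, fun i x hi => ?_⟩,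
    ha.congr fun i j x hi hj => ?_⟩
  · rw [hA _ x (φ.le _ hi), hh.dC_eq i x hi]
  · rw [expCocycle, hf _ _ x (φ.le _ hi) (φ.le _ hj), expCocycle]

lemma eq_of_represents (hp : 2 < p) {c : BiCochains 𝒰 p} (hc : totalDiff 𝒰 p c = 0) {a b : IsoClass τ}
    (ha : Represents 𝒰 (transition c) (potential c) a)
    (hb : Represents 𝒰 (transition c) (potential c) b) : a = b :=
  ha.unique (deligneData hp hc) hb

/-- The coboundary of `(n, b)` has one-forms `db` and functions `δb - n`, so with `b` as primitive
its cocycle is `uexp (-n) = 1`. -/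
lemma represents_totalDiff (hp : 2 < p) (b : BiCochains 𝒰 p) :
    Represents 𝒰 (transition (totalDiff 𝒰 p b)) (potential (totalDiff 𝒰 p b)) 1 := by
  refine DeligneData.represents_one (isPrimitive_totalDiff (by omega) b) fun i j x hi hj => ?_
  obtain ⟨n, hn⟩ := exists_int_val (b 1 0) (mem_inter₂.2 ⟨hi, hj⟩)
  refine ⟨-n, ?_⟩
  rw [transition_totalDiff (by omega) b hi hj, hn]
  push_cast
  ring

/-- The isomorphism class represented by a cocycle of degree two. -/
def cocycleClass (𝒰 : EquivariantCover τ) (hp : 2 < p) :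
    totalCocycles 𝒰 p 2 →+ Additive (IsoClass τ) :=
  AddMonoidHom.mk' (fun c => Additive.ofMul (deligneData hp c.2.2).exists_represents.choose)
    fun c c' => by
      refine eq_of_represents hp (c + c').2.2 (deligneData hp (c + c').2.2).exists_represents.choose_spec
        ?_
      have h := (deligneData hp c.2.2).exists_represents.choose_spec.add (deligneData hp c.2.2)
        (deligneData hp c'.2.2) (deligneData hp c'.2.2).exists_represents.choose_spec
      rw [← transition_add, ← potential_add] at h
      exact h

/-- The class of a cocycle is defined by a choice; the relation `Represents` characterises it, and
later arguments go through this characterisation. -/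
lemma cocycleClass_eq_iff (hp : 2 < p) (c : totalCocycles 𝒰 p 2) (a : IsoClass τ) :
    cocycleClass 𝒰 hp c = Additive.ofMul a ↔
      Represents 𝒰 (transition c.1) (potential c.1) a := by
  have h := (deligneData hp c.2.2).exists_represents.choose_spec
  refine ⟨fun e => ?_, fun h' => eq_of_represents hp c.2.2 h h'⟩
  rw [← show (deligneData hp c.2.2).exists_represents.choose = a from e]
  exact h

/-- The isomorphism class of a class of degree two in the hypercohomology of a cover. -/
def coverClass (𝒰 : EquivariantCover τ) (hp : 2 < p) :
    CoverCohomology 𝒰 p 2 →+ Additive (IsoClass τ) :=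
  QuotientAddGroup.lift _ (cocycleClass 𝒰 hp) fun c hc => by
    obtain ⟨b, -, hb⟩ := AddSubgroup.mem_addSubgroupOf.1 hc
    refine (cocycleClass_eq_iff hp c 1).2 ?_
    change totalDiff 𝒰 p b = c.1 at hb
    rw [← hb]
    exact represents_totalDiff hp b

lemma coverClass_pullback (hp : 2 < p) (φ : Refinement 𝒱 𝒰) (c : CoverCohomology 𝒰 p 2) :
    coverClass 𝒱 hp (cohomologyPullback p φ 2 c) = coverClass 𝒰 hp c := by
  induction c using QuotientAddGroup.induction_on with | _ c => ?_
  change cocycleClass 𝒱 hp (cocyclePullback p φ 2 c) = cocycleClass 𝒰 hp c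
  have h := (cocycleClass_eq_iff hp (cocyclePullback p φ 2 c) _).1 rfl
  refine ((cocycleClass_eq_iff hp c _).2 ?_).symm
  exact Represents.of_pullback (h.congr (fun i j x hi hj => (transition_biPullback φ hi hj).symm)
    fun i x hi => (potential_biPullback φ hi).symm)

open Classical in
/-- The isomorphism class of a Real Deligne cohomology class of degree two. -/
def deligneClass (τ : SmoothInvolution E M) (hp : 2 < p) :
    RealDeligneCohomology τ p 2 →+ Additive (IsoClass τ) :=
  QuotientAddGroup.lift _ (DirectSum.toAddMonoid fun 𝒰 => coverClass 𝒰 hp) <|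
    (AddSubgroup.closure_le _).2 <| by
      rintro _ ⟨𝒰, 𝒱, φ, c, rfl⟩
      rw [SetLike.mem_coe, AddMonoidHom.mem_ker]
      rw [map_sub, DirectSum.toAddMonoid_of, DirectSum.toAddMonoid_of, coverClass_pullback, sub_self]

open Classical in
/-- The Real Deligne cohomology class of a cocycle of a cover. -/
def ofCocycle (𝒰 : EquivariantCover τ) (p n : ℕ) : totalCocycles 𝒰 p n →+ RealDeligneCohomology τ p n :=
  ((QuotientAddGroup.mk' (refinementRelations τ p n)).comp
    (DirectSum.of (fun 𝒲 : EquivariantCover τ => CoverCohomology 𝒲 p n) 𝒰)).comp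
      (QuotientAddGroup.mk' _)

lemma deligneClass_ofCocycle (hp : 2 < p) (c : totalCocycles 𝒰 p 2) :
    deligneClass τ hp (ofCocycle 𝒰 p 2 c) = cocycleClass 𝒰 hp c := by
  classical
  exact DirectSum.toAddMonoid_of (fun 𝒰 => coverClass 𝒰 hp) 𝒰 _

omit [FiniteDimensional ℝ E] [T2Space M] in
lemma ofCocycle_pullback {n : ℕ} (φ : Refinement 𝒱 𝒰) (c : totalCocycles 𝒰 p n) :
    ofCocycle 𝒱 p n (cocyclePullback p φ n c) = ofCocycle 𝒰 p n c := by
  classical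
  rw [← sub_eq_zero]
  exact (QuotientAddGroup.eq_zero_iff _).2
    (AddSubgroup.subset_closure ⟨𝒰, 𝒱, φ, QuotientAddGroup.mk c, rfl⟩)

omit [FiniteDimensional ℝ E] [T2Space M] in
lemma ofCocycle_eq_zero {n : ℕ} {c : totalCocycles 𝒰 p n} (hc : c.1 ∈ totalCoboundaries 𝒰 p n) :
    ofCocycle 𝒰 p n c = 0 := by
  classical
  have h : (QuotientAddGroup.mk c : CoverCohomology 𝒰 p n) = 0 :=
    (QuotientAddGroup.eq_zero_iff _).2 (AddSubgroup.mem_addSubgroupOf.2 hc)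
  have h' : ofCocycle 𝒰 p n c = QuotientAddGroup.mk' (refinementRelations τ p n)
    (DirectSum.of (fun 𝒲 : EquivariantCover τ => CoverCohomology 𝒲 p n) 𝒰
      (QuotientAddGroup.mk c)) := rfl
  rw [h', h, map_zero, map_zero]

omit [FiniteDimensional ℝ E] [T2Space M] in
/-- Every Real Deligne cohomology class comes from a cocycle of one cover. -/
theorem exists_ofCocycle {n : ℕ} (ξ : RealDeligneCohomology τ p n) :
    ∃ (𝒰 : EquivariantCover τ) (c : totalCocycles 𝒰 p n), ofCocycle 𝒰 p n c = ξ := by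
  classical
  induction ξ using QuotientAddGroup.induction_on with | _ ξ => ?_
  induction ξ using DirectSum.induction_on with
  | zero => exact ⟨EquivariantCover.double τ (fun _ => ⊤) fun _ => trivial, 0, map_zero _⟩
  | of 𝒰 c =>
    induction c using QuotientAddGroup.induction_on with | _ c => ?_
    exact ⟨𝒰, c, rfl⟩
  | add ξ ξ' h h' =>
    obtain ⟨𝒰, c, hc⟩ := h
    obtain ⟨𝒰', c', hc'⟩ := h'
    -- The system of covers is directed: both cocycles are pulled back to the common refinement and
    -- added there.
    refine ⟨𝒰.inf 𝒰', cocyclePullback p (𝒰.infFst 𝒰') n c + cocyclePullback p (𝒰.infSnd 𝒰') n c', ?_⟩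
    rw [map_add, ofCocycle_pullback, ofCocycle_pullback, hc, hc']
    rfl

end ClassMap

/-! ### Logarithms of cocycles and bijectivity -/

section Bijectivity
variable {E : Type v} [NormedAddCommGroup E] [NormedSpace ℝ E]
  {M : Type u} [TopologicalSpace M] [ChartedSpace E M]
  {τ : SmoothInvolution E M} {𝒰 𝒱 : EquivariantCover τ} {p : ℕ}

open scoped FlatRealLineBundle.IsoClass
open EquivariantCover (Refinement mem_inter₁ mem_inter₂ mem_inter₃)
open FlatRealLineBundle (IsoClass)
open DeligneData (Represents)

lemma exists_int_of_uexp_eq {z w : ℂ} (h : uexp z = uexp w) : ∃ n : ℤ, z - w = n * Complex.I := by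
  refine uexp_eq_one_iff.1 (mul_right_cancel₀ (b := uexp w) (Complex.exp_ne_zero _) ?_)
  rw [← uexp_add, sub_add_cancel, h, one_mul]

/-- Real lifts of locally constant `U(1)`-valued functions along the exponential. -/
lemma exists_real_lift {κ : Type*} {inv : κ → κ} (hinv : Function.Involutive inv) {o : κ → Bool}
    (ho : ∀ k, o (inv k) = !o k) {W : κ → Set M} (hW : ∀ k x, x ∈ W k → τ x ∈ W (inv k))
    {G : κ → M → ℂ} (hG : ∀ k, ∀ x ∈ W k, ∀ᶠ y in 𝓝 x, G k y = G k x)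
    (hn : ∀ k, ∀ x ∈ W k, ‖G k x‖ = 1)
    (hτ : ∀ k, ∀ x ∈ W k, G (inv k) (τ x) = conj (G k x)) :
    ∃ F : κ → M → ℂ, (∀ k, ∀ x ∈ W k, uexp (F k x) = G k x) ∧
      (∀ k, ∀ x ∈ W k, ∀ᶠ y in 𝓝 x, F k y = F k x) ∧ (∀ k, ∀ x ∈ W k, (F k x).re = 0) ∧
      ∀ k, ∀ x ∈ W k, F (inv k) (τ x) = conj (F k x) := by
  -- The principal logarithm does not commute with conjugation at `-1`, so it is used on one index
  -- of each orbit and transported to the other by equivariance. Its discontinuity is harmless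
  -- because `G` is locally constant.
  refine ⟨fun k x => if o k then ulog (G k x) else conj (ulog (G (inv k) (τ x))), fun k x hx => ?_,
    fun k x hx => ?_, fun k x hx => ?_, fun k x hx => ?_⟩
  · dsimp only
    split_ifs
    · exact uexp_ulog (hn k x hx)
    · rw [← conj_uexp, uexp_ulog (hn _ _ (hW k x hx)), hτ k x hx, Complex.conj_conj]
  · have h := hG _ _ (hW k x hx)
    filter_upwards [hG k x hx, τ.contMDiff.continuous.continuousAt.eventually h] with y hy hy'
    simp only [hy, hy']
  · dsimp only
    split_ifs
    · exact re_ulog (hn k x hx)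
    · rw [Complex.conj_re]
      exact re_ulog (hn _ _ (hW k x hx))
  · simp only [ho, hinv k]
    rw [τ.involutive x]
    cases o k <;> simp

/-- The cochain of total degree two with the given components. -/
def biCochain₂ (n : cochains 𝒰 p 2 0) (f : cochains 𝒰 p 1 1) (A : cochains 𝒰 p 0 2) :
    BiCochains 𝒰 p := fun q j => match q, j with
  | 2, 0 => n
  | 1, 1 => f
  | 0, 2 => A
  | _, _ => 0

lemma biCochain₂_mem {n : cochains 𝒰 p 2 0} {f : cochains 𝒰 p 1 1} {A : cochains 𝒰 p 0 2} :
    biCochain₂ n f A ∈ totalDegree 𝒰 p 2 := by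
  intro q j h
  match q, j with
  | 0, 0 | 0, 1 | 1, 0 | 0, j + 3 | 1, j + 2 | 2, j + 1 | q + 3, j => rfl
  | 2, 0 | 1, 1 | 0, 2 => exact absurd rfl h

/-- The cochain of total degree one with the given components. -/
def biCochain₁ (n : cochains 𝒰 p 1 0) (f : cochains 𝒰 p 0 1) :
    BiCochains 𝒰 p := fun q j => match q, j with
  | 1, 0 => n
  | 0, 1 => f
  | _, _ => 0

lemma biCochain₁_mem {n : cochains 𝒰 p 1 0} {f : cochains 𝒰 p 0 1} :
    biCochain₁ n f ∈ totalDegree 𝒰 p 1 := by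
  intro q j h
  match q, j with
  | 0, 0 | 0, j + 2 | 1, j + 1 | q + 2, j => rfl
  | 1, 0 | 0, 1 => exact absurd rfl h

variable [IsManifold 𝓘(ℝ, E) ∞ M]

omit [IsManifold 𝓘(ℝ, E) ∞ M] in
lemma ext_of_mem_totalDegree₂ {c c' : BiCochains 𝒰 p} (hc : c ∈ totalDegree 𝒰 p 2)
    (hc' : c' ∈ totalDegree 𝒰 p 2)
    (h₂₀ : ∀ i j k x, x ∈ 𝒰.U i → x ∈ 𝒰.U j → x ∈ 𝒰.U k →
      val (c 2 0) ![i, j, k] x = val (c' 2 0) ![i, j, k] x)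
    (h₁₁ : ∀ i j x, x ∈ 𝒰.U i → x ∈ 𝒰.U j → val (c 1 1) ![i, j] x = val (c' 1 1) ![i, j] x)
    (h₀₂ : ∀ i x, x ∈ 𝒰.U i → val (c 0 2) ![i] x = val (c' 0 2) ![i] x) : c = c' := by
  funext q j
  by_cases h : q + j = 2
  · obtain ⟨rfl, rfl⟩ | ⟨rfl, rfl⟩ | ⟨rfl, rfl⟩ :
      (q = 2 ∧ j = 0) ∨ (q = 1 ∧ j = 1) ∨ (q = 0 ∧ j = 2) := by omega
    · refine cochain_ext fun s x hx => ?_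
      rw [eq_vec₃ s] at hx ⊢
      obtain ⟨h0, h1, h2⟩ := mem_inter₃.1 hx
      exact h₂₀ _ _ _ x h0 h1 h2
    · refine cochain_ext fun s x hx => ?_
      rw [eq_vec₂ s] at hx ⊢
      obtain ⟨h0, h1⟩ := mem_inter₂.1 hx
      exact h₁₁ _ _ x h0 h1
    · refine cochain_ext fun s x hx => ?_
      rw [eq_vec₁ s] at hx ⊢
      exact h₀₂ _ x (mem_inter₁.1 hx)
  · rw [hc q j h, hc' q j h]

variable [FiniteDimensional ℝ E] [T2Space M]

/-- A cocycle is a coboundary when its one-forms have primitives that trivialise its functions up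
to integers. -/
theorem mem_totalCoboundaries (hp : 2 < p) {c : BiCochains 𝒰 p} (hc : totalDiff 𝒰 p c = 0)
    (hc' : c ∈ totalDegree 𝒰 p 2) {b : 𝒰.ι → M → ℂ}
    (hb : IsPrimitive (Refinement.id 𝒰) (potential c) b)
    (hf : ∀ i j x, x ∈ 𝒰.U i → x ∈ 𝒰.U j →
      ∃ n : ℤ, transition c i j x - b j x + b i x = n * Complex.I) :
    c ∈ totalCoboundaries 𝒰 p 2 := by
  have hD := deligneData hp hc
  have hsm : ∀ (s : Fin 1 → 𝒰.ι), ∀ x ∈ 𝒰.inter s, x ∈ 𝒰.U (s 0) :=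
    fun s x hx => EquivariantCover.mem_inter.1 hx 0
  have hsm2 : ∀ (s : Fin 2 → 𝒰.ι), ∀ x ∈ 𝒰.inter s, x ∈ 𝒰.U (s 0) ∧ x ∈ 𝒰.U (s 1) :=
    fun s x hx => ⟨EquivariantCover.mem_inter.1 hx 0, EquivariantCover.mem_inter.1 hx 1⟩
  let B : cochains 𝒰 p 0 1 := mkFunctions (by omega) (fun s => b (s 0))
    (fun s x hx => hb.smooth _ x (hsm s x hx)) (fun s x hx => hb.re _ x (hsm s x hx))
    fun s x hx => hb.map_inv _ x (hsm s x hx)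
  -- The sign is dictated by the component `δB - N` of the coboundary, which has to equal the
  -- function part of `c`.
  let N : cochains 𝒰 p 1 0 := mkInts
    (fun s x => -(transition c (s 0) (s 1) x - b (s 1) x + b (s 0) x))
    (fun s x hx => by
      filter_upwards [hD.eventually_expCocycle hb (hsm2 s x hx).1 (hsm2 s x hx).2] with y hy
      exact congrArg Neg.neg hy)
    (fun s x hx => by
      obtain ⟨n, hn⟩ := hf _ _ x (hsm2 s x hx).1 (hsm2 s x hx).2
      exact ⟨-n, by rw [hn]; push_cast; ring⟩)
    fun s x hx => by
      have h1 := hb.map_inv _ x (hsm2 s x hx).1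
      have h2 := hb.map_inv _ x (hsm2 s x hx).2
      have h3 := hD.inv_fun _ _ x (hsm2 s x hx).1 (hsm2 s x hx).2
      simp only [Function.comp_apply, h1, h2, h3, map_neg, map_add, map_sub]
  have hB : ∀ i x, x ∈ 𝒰.U i → val B ![i] x = zeroForm x (b i x) := fun i x hi =>
    val_mkFunctions (mem_inter₁.2 hi)
  have hN : ∀ i j x, x ∈ 𝒰.U i → x ∈ 𝒰.U j →
      val N ![i, j] x = zeroForm x (-(transition c i j x - b j x + b i x)) := fun i j x hi hj =>
    val_mkInts (mem_inter₂.2 ⟨hi, hj⟩)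
  refine ⟨biCochain₁ N B, biCochain₁_mem, ext_of_mem_totalDegree₂ (totalDiff_mem biCochain₁_mem) hc'
    (fun i j k x hi hj hk => ?_) (fun i j x hi hj => ?_) fun i x hi => ?_⟩
  -- Since `δδb = 0`, the coboundary of `N` is minus that of the functions of `c`, and the cocycle
  -- condition identifies it with the integral part of `c`.
  · have h := val_totalDiff₂₁ (by omega) c hi hj hk
    rw [hc, show val ((0 : BiCochains 𝒰 p) 2 1) ![i, j, k] x = 0 from val_zero _ x] at h
    refine (val_cechDiff₁ N hi hj hk).trans ?_
    refine Eq.trans ?_ (neg_eq_of_add_eq_zero_right h.symm)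
    rw [hN j k x hj hk, hN i k x hi hk, hN i j x hi hj]
    refine zeroForm_ext ?_
    change -(val (c 1 1) ![j, k] x ![] - b k x + b j x) - -(val (c 1 1) ![i, k] x ![] - b k x + b i x)
      + -(val (c 1 1) ![i, j] x ![] - b j x + b i x) =
      -(val (c 1 1) ![j, k] x ![] - val (c 1 1) ![i, k] x ![] + val (c 1 1) ![i, j] x ![])
    ring
  · rw [val_totalDiff₁₁ (by omega) _ hi hj]
    change val B ![j] x - val B ![i] x - val N ![i, j] x = _
    rw [hB i x hi, hB j x hj, hN i j x hi hj]
    refine zeroForm_ext ?_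
    change b j x - b i x - -(val (c 1 1) ![i, j] x ![] - b j x + b i x) = val (c 1 1) ![i, j] x ![]
    ring
  · refine (val_formDiff_succ (j := 0) (by omega) B (mem_inter₁.2 hi)).trans (oneForm_injective ?_)
    refine (oneForm_extD_val (by omega) B (mem_inter₁.2 hi)).trans ?_
    refine Eq.trans (dC_congr ?_) (hb.dC_eq i x hi)
    filter_upwards [(𝒰.U i).isOpen.mem_nhds hi] with y hy
    exact congrArg (fun η : FormAt E 0 y => η ![]) (hB i y hy)

/-- Triviality of the class gives a gauge `l` with `uexp (f - δh) = δl` on a refinement. A Real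
locally constant logarithm `m` of `l` corrects the primitives to `h + m` without changing their
differentials, and `f - δ(h + m)` is then integral, as `mem_totalCoboundaries` requires. -/
theorem deligneClass_injective (hp : 2 < p) : Function.Injective (deligneClass τ hp) := by
  rw [injective_iff_map_eq_zero]
  intro ξ hξ
  obtain ⟨𝒰, c, rfl⟩ := exists_ofCocycle ξ
  rw [deligneClass_ofCocycle] at hξ
  obtain ⟨𝒱, φ, h, hh, ha⟩ := (cocycleClass_eq_iff hp c 1).1 hξ
  obtain ⟨l, hl, hl'⟩ := (IsoClass.hasCocycle_one 𝒱).exists_gauge ha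
  obtain ⟨o, ho⟩ := 𝒱.exists_orientation
  obtain ⟨m, hm, hmc, hmr, hmi⟩ := exists_real_lift (τ := τ) 𝒱.inv_involutive ho
    (W := fun i => 𝒱.U i) (fun i x hx => (𝒱.mem_inv i (τ x)).2 (by rwa [τ.involutive x]))
    hl.locConst hl.norm hl.map_inv
  rw [← ofCocycle_pullback φ c]
  have hD := deligneData hp c.2.2
  refine ofCocycle_eq_zero (mem_totalCoboundaries hp (cocyclePullback p φ 2 c).2.2
    (cocyclePullback p φ 2 c).2.1 (b := fun i x => h i x + m i x) ⟨fun i x hi => ?_, fun i x hi => ?_,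
    fun i x hi => ?_, fun i x hi => ?_⟩ fun i j x hi hj => ?_)
  · exact (hh.smooth i x hi).add
      (contMDiffAt_const.congr_of_eventuallyEq (hmc i x hi))
  · simp [hh.re i x hi, hmr i x hi]
  · rw [hh.map_inv i x hi, hmi i x hi, map_add]
  · have hmd : dC E (m i) x = 0 := (dC_congr (hmc i x hi)).trans (dC_const _ x)
    rw [dC_add (mdiff (hh.smooth i x hi)) (mdiff (contMDiffAt_const.congr_of_eventuallyEq (hmc i x hi))),
      hmd, add_zero, hh.dC_eq i x hi]
    exact congrArg oneForm (potential_biPullback φ hi).symm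
  · have h1 := hl' i j x hi hj
    rw [one_mul, ← hm i x hi, ← hm j x hj, expCocycle, ← uexp_add] at h1
    obtain ⟨n, hn⟩ := exists_int_of_uexp_eq h1
    refine ⟨n, ?_⟩
    rw [show transition (cocyclePullback p φ 2 c).1 i j x =
      transition c.1 (φ.toFun i) (φ.toFun j) x from transition_biPullback φ hi hj, ← hn]
    ring

omit [FiniteDimensional ℝ E] [T2Space M] in
lemma totalDiff_eq_zero {c : BiCochains 𝒰 p} (hc : c ∈ totalDegree 𝒰 p 2)
    (h₃₀ : cechDiff 𝒰 p 2 0 (c 2 0) = 0)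
    (h₂₁ : ∀ i j k x, x ∈ 𝒰.U i → x ∈ 𝒰.U j → x ∈ 𝒰.U k →
      val (totalDiff 𝒰 p c 2 1) ![i, j, k] x = 0)
    (h₁₂ : ∀ i j x, x ∈ 𝒰.U i → x ∈ 𝒰.U j → val (totalDiff 𝒰 p c 1 2) ![i, j] x = 0)
    (h₀₃ : formDiff 𝒰 p 0 2 (c 0 2) = 0) : totalDiff 𝒰 p c = 0 := by
  funext q j
  by_cases h : q + j = 3
  · obtain ⟨rfl, rfl⟩ | ⟨rfl, rfl⟩ | ⟨rfl, rfl⟩ | ⟨rfl, rfl⟩ : (q = 3 ∧ j = 0) ∨ (q = 2 ∧ j = 1) ∨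
      (q = 1 ∧ j = 2) ∨ (q = 0 ∧ j = 3) := by omega
    · exact h₃₀
    · refine cochain_ext fun s x hx => ?_
      rw [eq_vec₃ s] at hx ⊢
      obtain ⟨h0, h1, h2⟩ := mem_inter₃.1 hx
      exact (h₂₁ _ _ _ x h0 h1 h2).trans (val_zero _ x).symm
    · refine cochain_ext fun s x hx => ?_
      rw [eq_vec₂ s] at hx ⊢
      obtain ⟨h0, h1⟩ := mem_inter₂.1 hx
      exact (h₁₂ _ _ x h0 h1).trans (val_zero _ x).symm
    · exact h₀₃
  · exact totalDiff_mem hc q j h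

omit [FiniteDimensional ℝ E] [T2Space M] in
/-- Locally constant functions whose coboundary is integral form a cocycle. -/
theorem exists_cocycle (hp : 2 < p) {F : 𝒰.ι → 𝒰.ι → M → ℂ}
    (hF : ∀ i j x, x ∈ 𝒰.U i → x ∈ 𝒰.U j → ∀ᶠ y in 𝓝 x, F i j y = F i j x)
    (hre : ∀ i j x, x ∈ 𝒰.U i → x ∈ 𝒰.U j → (F i j x).re = 0)
    (hinv : ∀ i j x, x ∈ 𝒰.U i → x ∈ 𝒰.U j → F (𝒰.inv i) (𝒰.inv j) (τ x) = conj (F i j x))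
    (hint : ∀ i j k x, x ∈ 𝒰.U i → x ∈ 𝒰.U j → x ∈ 𝒰.U k →
      ∃ n : ℤ, F i j x + F j k x - F i k x = n * Complex.I) :
    ∃ c : totalCocycles 𝒰 p 2,
      (∀ i j x, x ∈ 𝒰.U i → x ∈ 𝒰.U j → transition c.1 i j x = F i j x) ∧ potential c.1 = 0 := by
  have mem {q : ℕ} {s : Fin (q + 1) → 𝒰.ι} {x : M} (hx : x ∈ 𝒰.inter s) (a : Fin (q + 1)) :
      x ∈ 𝒰.U (s a) := EquivariantCover.mem_inter.1 hx a
  let f : cochains 𝒰 p 1 1 := mkFunctions (by omega) (fun s => F (s 0) (s 1))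
    (fun s x hx => contMDiffAt_const.congr_of_eventuallyEq (hF _ _ x (mem hx 0) (mem hx 1)))
    (fun s x hx => hre _ _ x (mem hx 0) (mem hx 1)) fun s x hx => hinv _ _ x (mem hx 0) (mem hx 1)
  -- The integral part is forced by `δf + n = 0`. Its own Čech coboundary vanishes as a double
  -- coboundary.
  let n : cochains 𝒰 p 2 0 := mkInts
    (fun s x => -(F (s 1) (s 2) x - F (s 0) (s 2) x + F (s 0) (s 1) x))
    (fun s x hx => by
      filter_upwards [hF _ _ x (mem hx 1) (mem hx 2), hF _ _ x (mem hx 0) (mem hx 2),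
        hF _ _ x (mem hx 0) (mem hx 1)] with y h1 h2 h3
      rw [h1, h2, h3])
    (fun s x hx => by
      obtain ⟨m, hm⟩ := hint _ _ _ x (mem hx 0) (mem hx 1) (mem hx 2)
      refine ⟨-m, ?_⟩
      push_cast
      linear_combination -hm)
    fun s x hx => by
      simp only [Function.comp_apply, hinv _ _ x (mem hx 1) (mem hx 2),
        hinv _ _ x (mem hx 0) (mem hx 2), hinv _ _ x (mem hx 0) (mem hx 1), map_neg, map_add, map_sub]
  have hf : ∀ i j x, x ∈ 𝒰.U i → x ∈ 𝒰.U j → val f ![i, j] x = zeroForm x (F i j x) :=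
    fun i j x hi hj => val_mkFunctions (mem_inter₂.2 ⟨hi, hj⟩)
  have hn : ∀ s x, x ∈ 𝒰.inter s → val n s x =
      zeroForm x (-(F (s 1) (s 2) x - F (s 0) (s 2) x + F (s 0) (s 1) x)) :=
    fun s x hx => val_mkInts hx
  refine ⟨⟨biCochain₂ n f 0, biCochain₂_mem, totalDiff_eq_zero biCochain₂_mem ?_
    (fun i j k x hi hj hk => ?_) (fun i j x hi hj => ?_) (map_zero _)⟩,
    fun i j x hi hj => congrArg (fun η : FormAt E 0 x => η ![]) (hf i j x hi hj), ?_⟩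
  · refine cochain_ext fun s x hx => ?_
    rw [val_zero]
    refine (val_cechDiff n hx).trans ?_
    have hs : ∀ a : Fin 4, val n (s ∘ a.succAbove) x = _ := fun a => hn _ x (𝒰.inter_face s a hx)
    simp only [hs, ← map_zsmul, ← map_sum]
    rw [Fin.sum_univ_four]
    refine (congrArg (zeroForm x) ?_).trans (map_zero _)
    simp [Fin.succAbove, Fin.lt_def]
    ring
  · rw [val_totalDiff₂₁ (by omega) _ hi hj hk]
    change val f ![j, k] x - val f ![i, k] x + val f ![i, j] x + val n ![i, j, k] x = 0
    rw [hf j k x hj hk, hf i k x hi hk, hf i j x hi hj, hn _ x (mem_inter₃.2 ⟨hi, hj, hk⟩)]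
    refine zeroForm_ext ?_
    change F j k x - F i k x + F i j x + -(F j k x - F i k x + F i j x) = 0
    ring
  · rw [val_totalDiff₁₂ (by omega) _ hi hj]
    change val (0 : cochains 𝒰 p 0 2) ![j] x - val (0 : cochains 𝒰 p 0 2) ![i] x -
      extD (val f ![i, j]) x = 0
    rw [val_zero, val_zero, sub_self, zero_sub, neg_eq_zero]
    refine oneForm_injective ((oneForm_extD_val (by omega) f (mem_inter₂.2 ⟨hi, hj⟩)).trans
      ((dC_congr (g := fun _ => F i j x) ?_).trans (dC_const _ x)))
    filter_upwards [(𝒰.U i).isOpen.mem_nhds hi, (𝒰.U j).isOpen.mem_nhds hj, hF i j x hi hj] with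
      y hy hy' h
    exact (congrArg (fun η : FormAt E 0 y => η ![]) (hf i j y hy hy')).trans h
  · funext i x
    exact val_zero _ x

/-- A Real logarithm `F` of a cocycle of the bundle is locally constant with integral coboundary, so
`(-δF, F, 0)` is a Deligne cocycle. With zero primitives its associated cocycle is the original one.
-/
theorem deligneClass_surjective (hp : 2 < p) : Function.Surjective (deligneClass τ hp) := by
  intro a
  obtain ⟨𝒰, g, ha⟩ := IsoClass.exists_hasCocycle a.toMul
  have hg := ha.isCocycle
  obtain ⟨o, ho⟩ := 𝒰.exists_orientation
  -- The involution acts on both members of a pair of indices, so an orientation of the first member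
  -- orients the pairs.
  obtain ⟨F, hF, hFc, hFr, hFi⟩ := exists_real_lift (τ := τ) (κ := 𝒰.ι × 𝒰.ι)
    (inv := fun k => (𝒰.inv k.1, 𝒰.inv k.2)) (o := fun k => o k.1)
    (W := fun k => 𝒰.U k.1 ∩ 𝒰.U k.2) (G := fun k => g k.1 k.2)
    (fun k => Prod.ext (𝒰.inv_involutive _) (𝒰.inv_involutive _)) (fun k => ho _)
    (fun k x hx => ⟨(𝒰.mem_inv _ (τ x)).2 (by rw [τ.involutive x]; exact hx.1),
      (𝒰.mem_inv _ (τ x)).2 (by rw [τ.involutive x]; exact hx.2)⟩)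
    (fun k x hx => hg.locConst _ _ x hx.1 hx.2) (fun k x hx => hg.norm _ _ x hx.1 hx.2)
    (fun k x hx => hg.map_inv _ _ x hx.1 hx.2)
  obtain ⟨c, hc, hc'⟩ := exists_cocycle hp (F := fun i j => F (i, j))
    (fun i j x hi hj => hFc (i, j) x ⟨hi, hj⟩) (fun i j x hi hj => hFr (i, j) x ⟨hi, hj⟩)
    (fun i j x hi hj => hFi (i, j) x ⟨hi, hj⟩) (fun i j k x hi hj hk => exists_int_of_uexp_eq (by
      rw [uexp_add, hF (i, j) x ⟨hi, hj⟩, hF (j, k) x ⟨hj, hk⟩, hF (i, k) x ⟨hi, hk⟩]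
      exact hg.mul i j k x hi hj hk))
  refine ⟨ofCocycle 𝒰 p 2 c, (deligneClass_ofCocycle hp c).trans
    ((cocycleClass_eq_iff hp c a.toMul).2 ⟨𝒰, Refinement.id 𝒰, fun _ _ => 0,
      ⟨fun _ _ _ => contMDiffAt_const, fun _ _ _ => rfl, fun _ _ _ => (map_zero _).symm,
        fun i x hi => ?_⟩, ha.congr fun i j x hi hj => ?_⟩)⟩
  · rw [hc']
    exact dC_const _ x
  · rw [expCocycle, sub_zero, add_zero, ← hF (i, j) x ⟨hi, hj⟩]
    exact congrArg uexp (hc i j x hi hj)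

/-- Flat Real line bundles are classified by Real Deligne cohomology of degree two. -/
def classEquiv (τ : SmoothInvolution E M) (hp : 2 < p) :
    Additive (IsoClass τ) ≃+ RealDeligneCohomology τ p 2 :=
  (AddEquiv.ofBijective (deligneClass τ hp)
    ⟨deligneClass_injective hp, deligneClass_surjective hp⟩).symm

end Bijectivity

end RealDeligne

end

theorem mainTheorem5 {E : Type*} [NormedAddCommGroup E] [NormedSpace ℝ E] [FiniteDimensional ℝ E]
    {M : Type*} [TopologicalSpace M] [T2Space M] [ParacompactSpace M] [ChartedSpace E M]
    [IsManifold 𝓘(ℝ, E) ∞ M] (τ : RealDeligne.SmoothInvolution E M) :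
    ∃ G : CommGroup (RealDeligne.FlatRealLineBundle.IsoClass τ),
      RealDeligne.FlatRealLineBundle.IsTensorGroupLaw G ∧
      ∀ p : ℕ, 2 < p →
        Nonempty (Additive (RealDeligne.FlatRealLineBundle.IsoClass τ) ≃+
          RealDeligne.RealDeligneCohomology τ p 2) :=
  ⟨RealDeligne.FlatRealLineBundle.IsoClass.instCommGroup,
    RealDeligne.FlatRealLineBundle.isTensorGroupLaw,
    fun _ hp => ⟨RealDeligne.classEquiv τ hp⟩⟩
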